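/- Let $R>0$ and $V_0\in(0,1)$, let $\Omega=\mathbb B(0;R)\subset\mathbb R^2$, and for $V\in L^\infty(\Omega)$ let $$\lambda(V)=\inf\Big\{\int_\Omega|\nabla u|^2-\int_\Omega Vu^2\;:\;u\in W^{1,2}_0(\Omega),\ \int_\Omega u^2=1\Big\}$$ be the first Dirichlet eigenvalue of $-\Delta-V$ in $\Omega$. A normalised eigenfunction for $V$ is a weak solution $u\in W^{1,2}_0(\Omega)$ of $-\Delta u-Vu=\lambda(V)u$ with $\int_\Omega u^2=1$. Let $\mathcal M=\{V\in L^\infty(\Omega): 0\le V\le 1,\ \frac1{|\Omega|}\int_\Omega V=V_0\}$, let $r^*$ be such that $V^*:=\chi_{\mathbb B(0;r^*)}\in\mathcal M$, and for $\delta>0$ let $\tilde{\mathcal M}_\delta$ be the set of radially symmetric $V\in\mathcal M$ with $\|V-V^*\|_{L^1(\Omega)}=\delta$. There are constants $C>0$ and $\overline\delta>0$, depending only on $R$ and $V_0$, such that the following holds. 1. For every $\delta>0$ and every $V\in\tilde{\mathcal M}_\delta$, $$\lambda(V)-\lambda(V^*)\ge C\delta^2 .$$ 2. For every $0<\delta\le\overline\delta$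 there are $r_\delta\in(0,r^*)$ and $r_\delta'\in(0,R-r^*)$ such that the set $$\mathbb A_\delta=\{|x|\le r^*-r_\delta\}\cup\{r^*\le|x|\le r^*+r_\delta'\}$$ satisfies $\chi_{\mathbb A_\delta}\in\tilde{\mathcal M}_\delta$, and $\chi_{\mathbb A_\delta}$ is, up to null sets, the unique minimizer of $\lambda$ in $\tilde{\mathcal M}_\delta$. 3. For every $0<\delta\le\overline\delta$, with $h_\delta=\chi_{\mathbb A_\delta}-V^*$, and every $t\in[0,1]$, the potential $V^*+th_\delta$ has a normalised eigenfunction, and for every such eigenfunction $u_{\delta,t}$ the function $s\mapsto\lambda(V^*+sh_\delta)$ on $[0,1]$ is differentiable at $t$ (one-sidedly if $t\in\{0,1\}$) with derivative $-\int_\Omega h_\delta u_{\delta,t}^2$, and $$-\int_\Omega h_\delta u_{\delta,t}^2\ge C\delta^2 .$$ -/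

import Mathlib

open MeasureTheory Filter Topology Set
open scoped ContDiff

namespace RadialSchrodinger

/-- The Euclidean plane. -/
abbrev Plane : Type := EuclideanSpace ℝ (Fin 2)

/-- The domain `Ω = 𝔹(0; R)`, an open disc of the plane. -/
def Omega (R : ℝ) : Set Plane := Metric.ball 0 R

/-- Lebesgue measure on `Ω`. -/
noncomputable def muOmega (R : ℝ) : Measure Plane := volume.restrict (Omega R)

/-- Test functions: smooth functions with compact support contained in `Ω`. -/
def IsTest (R : ℝ) (φ : Plane → ℝ) : Prop :=
  ContDiff ℝ ∞ φ ∧ HasCompactSupport φ ∧ tsupport φ ⊆ Omega R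

/-- `u` belongs to `W^{1,2}_0(Ω)`, the closure of the test functions in the `W^{1,2}` norm, and `G`
is its (weak) gradient. The function `G` is determined by `u` almost everywhere on `Ω`, as the
`L²` limit of the gradients of test functions that converge to `u` in `L²`. -/
def MemW12Zero (R : ℝ) (u : Plane → ℝ) (G : Plane → Plane) : Prop :=
  MemLp u 2 (muOmega R) ∧ MemLp G 2 (muOmega R) ∧
    ∃ φ : ℕ → Plane → ℝ, (∀ k, IsTest R (φ k)) ∧
      Tendsto (fun k => eLpNorm (fun x => φ k x - u x) 2 (muOmega R)) atTop (𝓝 0) ∧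
      Tendsto (fun k => eLpNorm (fun x => gradient (φ k) x - G x) 2 (muOmega R)) atTop (𝓝 0)

/-- The first Dirichlet eigenvalue `λ(V)` of `-Δ - V` in `Ω`: the infimum of
`∫ |∇u|² - ∫ V u²` over all `u ∈ W^{1,2}_0(Ω)` with `∫ u² = 1`. -/
noncomputable def firstEigenvalue (R : ℝ) (V : Plane → ℝ) : ℝ :=
  sInf {E : ℝ | ∃ (u : Plane → ℝ) (G : Plane → Plane), MemW12Zero R u G ∧
    (∫ x, u x ^ 2 ∂(muOmega R)) = 1 ∧
    E = (∫ x, ‖G x‖ ^ 2 ∂(muOmega R)) - ∫ x, V x * u x ^ 2 ∂(muOmega R)}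

/-- `u` is an `L²`-normalised first eigenfunction: a weak solution in `W^{1,2}_0(Ω)` of
`-Δu - V u = λ(V) u` in `Ω`, `u = 0` on `∂Ω`, with `∫ u² = 1`. -/
def IsEigenfunction (R : ℝ) (V : Plane → ℝ) (u : Plane → ℝ) : Prop :=
  ∃ G : Plane → Plane, MemW12Zero R u G ∧ (∫ x, u x ^ 2 ∂(muOmega R)) = 1 ∧
    ∀ φ : Plane → ℝ, IsTest R φ →
      (∫ x, inner ℝ (G x) (gradient φ x) ∂(muOmega R)) - (∫ x, V x * u x * φ x ∂(muOmega R))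
        = firstEigenvalue R V * ∫ x, u x * φ x ∂(muOmega R)

/-- The admissible class `𝓜(Ω)`: potentials `V ∈ L^∞(Ω)` with `0 ≤ V ≤ 1` and mean value `V₀`. -/
def admissible (R V₀ : ℝ) : Set (Plane → ℝ) :=
  {V | AEStronglyMeasurable V (muOmega R) ∧ (∀ᵐ x ∂(muOmega R), 0 ≤ V x ∧ V x ≤ 1) ∧
    ((volume (Omega R)).toReal)⁻¹ * (∫ x, V x ∂(muOmega R)) = V₀}

/-- The characteristic function `χ_A`. -/
noncomputable def chi (A : Set Plane) : Plane → ℝ := A.indicator fun _ => 1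

/-- `V* = χ_{𝔹(0; r*)}`. -/
noncomputable def VStar (rs : ℝ) : Plane → ℝ := chi (Metric.ball 0 rs)

/-- `V` is radially symmetric: up to a null set, it depends on `|x|` only. -/
def IsRadial (R : ℝ) (V : Plane → ℝ) : Prop :=
  ∃ v : ℝ → ℝ, Measurable v ∧ ∀ᵐ x ∂(muOmega R), V x = v ‖x‖

/-- The radially symmetric admissible potentials at `L¹` distance exactly `δ` from `V*`. -/
def radialAdmissible (R V₀ rs δ : ℝ) : Set (Plane → ℝ) :=
  {V | V ∈ admissible R V₀ ∧ IsRadial R V ∧ (∫ x, |V x - VStar rs x| ∂(muOmega R)) = δ}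

/-- The union of the centred disc of radius `r* - a` and of the annulus `r* ≤ |x| ≤ r* + b`. -/
def annularSet (rs a b : ℝ) : Set Plane :=
  {x | ‖x‖ ≤ rs - a} ∪ {x | rs ≤ ‖x‖ ∧ ‖x‖ ≤ rs + b}

/-- The perturbation `h = χ_𝔸 - V*`, where `𝔸` is the annular set. -/
noncomputable def hPert (rs a b : ℝ) : Plane → ℝ :=
  fun x => chi (annularSet rs a b) x - VStar rs x

/-- The potential `V* + t h`. -/
noncomputable def VPath (rs a b t : ℝ) : Plane → ℝ :=
  fun x => VStar rs x + t * hPert rs a b x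

end RadialSchrodinger

/-! In the variable t = |x|², Lebesgue measure on the disc becomes π dt on (0, R²], and the
Laplacian of f(|x|²) is 4 (t f')'. For a radial potential v the eigenvalue equation becomes 4 (t
u')' = -(v + μ) u with u(0) = 1. Its solution `sol` is a Neumann series that depends continuously on
the potential. Barta's inequality bounds λ(v) from below when the solution is positive. The Rayleigh
quotient of a solution cut off at a zero bounds λ(v) from above. Together they show that for μ =
λ(v) the solution is positive inside and vanishes at R² (`ground_pos_and_eq_zero`), so the ground
state is obtained without compactness or spectral theory.

As λ is an infimum of functionals affine in V, the ground state u_w of w is a trial function for v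
and gives (λ(v) - λ(w)) ∫ u_w² ≤ ∫ (w - v) u_w² (`eig_sub_eig_mul_le`). The stability and minimality
statements use it with the ground state of the competitor, not that of V*; hence no second variation
has to be controlled.

Put t* = r*² and let d = ∫ (1 - w) over [0, t*] be the deficit of w. If v is L¹-close to V*, then
u_v² exceeds its value at t* by at least a multiple of t* - t on the left, and is smaller on the
right (`exists_ground_separation`). Since 0 ≤ w ≤ 1, the deficit cannot concentrate at t*, and ∫ (1
- w)(t* - t) ≥ d²/4 (`sq_deficit_le`). Hence ∫ (V* - w) u_v² ≥ c d² ∫ u_v²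
(`exists_first_variation_le`). The choice w = v gives quadratic stability near V*; v on the segment
from V* to the annular profile w gives the lower bound for the derivative.

Far from V* the ground state need not be decreasing. It is translated so that its last critical
point t₁ moves to the origin. This lowers the kinetic energy by an amount proportional to t₁, and
the translated function is decreasing, so moving the translated potential towards V* lowers the
energy further (`eig_segment_le`). Either t₁ is at least d/2 and the kinetic gain suffices, or the
translated potential still has deficit d/2 and a point on the segment to it falls under the local
estimate (`exists_global_stability`).

For the minimiser, prescribed mean and L¹ distance fix the mass of v on each side of t*, and the
bathtub principle on the two intervals selects the annular profile (`exists_annular_minimiser`). For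
the derivative, λ along a segment has supporting lines from above whose slopes are continuous, so it
is differentiable. Every normalised eigenfunction yields such a line, so simplicity of the
eigenvalue is not needed (`eigSlope_eq_integral`). -/

namespace RadialSchrodinger

/-! ### The radial equation as a singular Volterra equation. -/

/-- The Volterra operator `w ↦ ∫₀ᵗ (4s)⁻¹ ∫₀ˢ q w`, extended by `0` to `t ≤ 0`. -/
noncomputable def volterra (q w : ℝ → ℝ) (t : ℝ) : ℝ :=
  ∫ s in (0 : ℝ)..max t 0, (∫ σ in (0 : ℝ)..s, q σ * w σ) / (4 * s)

/-- The Neumann series of the Volterra operator. -/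
noncomputable def neumannTerm (q : ℝ → ℝ) : ℕ → ℝ → ℝ
  | 0 => fun _ => 1
  | n + 1 => fun t => -volterra q (neumannTerm q n) t

/-- The solution of `4 (t u')' = -q u`, `u 0 = 1`. -/
noncomputable def sol (q : ℝ → ℝ) (t : ℝ) : ℝ := ∑' n, neumannTerm q n t

/-- The flux `∫₀ᵗ q u = -4 t u'` of the solution. -/
noncomputable def flux (q : ℝ → ℝ) (t : ℝ) : ℝ := ∫ σ in (0 : ℝ)..t, q σ * sol q σ

section Volterra

variable {q : ℝ → ℝ} {B : ℝ}

lemma intervalIntegrable_of_bounded {f : ℝ → ℝ} (hf : Measurable f) {C : ℝ} (hC : ∀ t, |f t| ≤ C)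
    (a b : ℝ) : IntervalIntegrable f volume a b := by
  rw [intervalIntegrable_iff]
  exact Measure.integrableOn_of_bounded (M := C) (by simp) hf.aestronglyMeasurable
    (ae_of_all _ fun x => by simpa using hC x)

lemma intervalIntegrable_bounded_mul {w : ℝ → ℝ} (hq : Measurable q) (hB : ∀ t, |q t| ≤ B)
    (hw : Continuous w) (a b : ℝ) : IntervalIntegrable (fun s => q s * w s) volume a b :=
  (intervalIntegrable_of_bounded hq hB a b).mul_continuousOn hw.continuousOn

lemma continuous_primitive_mul {w : ℝ → ℝ} (hq : Measurable q) (hB : ∀ t, |q t| ≤ B)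
    (hw : Continuous w) : Continuous fun s => ∫ σ in (0 : ℝ)..s, q σ * w σ :=
  intervalIntegral.continuous_primitive (fun a b => intervalIntegrable_bounded_mul hq hB hw a b) 0

lemma abs_primitive_mul_le {w : ℝ → ℝ} (hB : ∀ t, |q t| ≤ B) {M s : ℝ}
    (hs : 0 ≤ s) (hM : ∀ σ ∈ Icc 0 s, |w σ| ≤ M) :
    |∫ σ in (0 : ℝ)..s, q σ * w σ| ≤ B * M * s := by
  have h := intervalIntegral.norm_integral_le_of_norm_le_const (a := 0) (b := s)
    (f := fun σ => q σ * w σ) (C := B * M) ?_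
  · simpa [abs_of_nonneg hs] using h
  · intro σ hσ
    rw [uIoc_of_le hs] at hσ
    rw [Real.norm_eq_abs, abs_mul]
    exact mul_le_mul (hB σ) (hM σ ⟨hσ.1.le, hσ.2⟩) (abs_nonneg _) ((abs_nonneg _).trans (hB σ))

/-- The inner integral is O(s) and absorbs the singular factor 1/(4s); at s = 0 the quotient is 0 by
convention. This makes the singular point t = 0 harmless. -/
lemma abs_primitive_div_le {w : ℝ → ℝ} (hB : ∀ t, |q t| ≤ B) {M s : ℝ} (hs : 0 ≤ s)
    (hM : ∀ σ ∈ Icc 0 s, |w σ| ≤ M) :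
    |(∫ σ in (0 : ℝ)..s, q σ * w σ) / (4 * s)| ≤ B * M / 4 := by
  have hB0 : 0 ≤ B := (abs_nonneg _).trans (hB 0)
  have hM0 : 0 ≤ M := (abs_nonneg _).trans (hM 0 ⟨le_rfl, hs⟩)
  rcases hs.eq_or_lt with rfl | hs'
  · simp; positivity
  · rw [abs_div, abs_of_pos (by positivity : (0 : ℝ) < 4 * s), div_le_div_iff₀ (by positivity)
      (by norm_num)]
    have := abs_primitive_mul_le hB hs hM
    nlinarith

lemma intervalIntegrable_primitive_div {w : ℝ → ℝ} (hq : Measurable q) (hB : ∀ t, |q t| ≤ B)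
    (hw : Continuous w) {T : ℝ} (hT : 0 ≤ T) :
    IntervalIntegrable (fun s => (∫ σ in (0 : ℝ)..s, q σ * w σ) / (4 * s)) volume 0 T := by
  obtain ⟨M, hM⟩ := isCompact_Icc.exists_bound_of_continuousOn (s := Icc 0 T) hw.continuousOn
  rw [intervalIntegrable_iff, uIoc_of_le hT]
  refine Measure.integrableOn_of_bounded (M := B * M / 4) (by simp) ?_ ?_
  · exact ((continuous_primitive_mul hq hB hw).measurable.div
      (measurable_const.mul measurable_id)).aestronglyMeasurable
  · filter_upwards [ae_restrict_mem measurableSet_Ioc] with s hs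
    exact abs_primitive_div_le hB hs.1.le fun σ hσ => hM σ ⟨hσ.1, hσ.2.trans hs.2⟩

lemma continuous_volterra {w : ℝ → ℝ} (hq : Measurable q) (hB : ∀ t, |q t| ≤ B)
    (hw : Continuous w) : Continuous (volterra q w) := by
  rw [continuous_iff_continuousAt]
  intro t
  have hT : (0 : ℝ) ≤ max t 0 + 1 := by positivity
  have h1 : ContinuousOn (fun x => ∫ s in (0 : ℝ)..x, (∫ σ in (0 : ℝ)..s, q σ * w σ) / (4 * s))
      (Icc 0 (max t 0 + 1)) := by
    have := intervalIntegral.continuousOn_primitive_interval'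
      (intervalIntegrable_primitive_div hq hB hw hT) (a := 0) (by simp [hT])
    rwa [uIcc_of_le hT] at this
  have h2 : ContinuousOn (volterra q w) (Iio (max t 0 + 1)) := by
    refine h1.comp (f := fun t => max t 0) (by fun_prop) ?_
    intro x hx
    simp only [mem_Iio] at hx
    exact ⟨le_max_right _ _, max_le hx.le hT⟩
  exact h2.continuousAt (Iio_mem_nhds (by linarith [le_max_left t 0]))

lemma continuous_neumannTerm (hq : Measurable q) (hB : ∀ t, |q t| ≤ B) (n : ℕ) :
    Continuous (neumannTerm q n) := by
  induction n with
  | zero => exact continuous_const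
  | succ n ih => exact (continuous_volterra hq hB ih).neg

/-- The inner integral is absorbed by 1/(4s), so each application of the operator amounts to one
integration, and n of them give the factorial. The powers of 1/4 are dropped. -/
lemma abs_neumannTerm_le (hB : ∀ t, |q t| ≤ B) (n : ℕ) (t : ℝ) :
    |neumannTerm q n t| ≤ (B * max t 0) ^ n / n.factorial := by
  have hB0 : 0 ≤ B := (abs_nonneg _).trans (hB 0)
  induction n generalizing t with
  | zero => simp [neumannTerm]
  | succ n ih =>
    simp only [neumannTerm, abs_neg, volterra]
    set m := max t 0
    have hm : 0 ≤ m := le_max_right _ _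
    have h := intervalIntegral.norm_integral_le_of_norm_le (a := 0) (b := m) (μ := volume)
      (f := fun s => (∫ σ in (0 : ℝ)..s, q σ * neumannTerm q n σ) / (4 * s))
      (g := fun s => B ^ (n + 1) / n.factorial * s ^ n) hm ?_ ?_
    · refine h.trans (le_of_eq ?_)
      rw [intervalIntegral.integral_const_mul, integral_pow, Nat.factorial_succ]
      push_cast
      field_simp
      ring
    · refine ae_of_all _ fun s hs => ?_
      have := abs_primitive_div_le hB hs.1.le (w := neumannTerm q n)
        (M := (B * s) ^ n / n.factorial) fun σ hσ => (ih σ).trans ?_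
      · refine this.trans ?_
        have h0 : 0 ≤ B ^ (n + 1) / n.factorial * s ^ n := by have := hs.1.le; positivity
        have : B * ((B * s) ^ n / n.factorial) = B ^ (n + 1) / n.factorial * s ^ n := by
          rw [mul_pow]; ring
        rw [this]; linarith
      · rw [max_eq_left hσ.1]
        gcongr
        · have := hσ.1; positivity
        · exact hσ.2
    · exact Continuous.intervalIntegrable (by fun_prop) _ _

lemma abs_neumannTerm_le_of_le (hB : ∀ t, |q t| ≤ B) (n : ℕ) {t T : ℝ} (h : t ≤ T) (hT : 0 ≤ T) :
    |neumannTerm q n t| ≤ (B * T) ^ n / n.factorial := by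
  have hB0 : 0 ≤ B := (abs_nonneg _).trans (hB 0)
  refine (abs_neumannTerm_le hB n t).trans ?_
  gcongr
  exact max_le h hT

lemma continuous_sol (hq : Measurable q) (hB : ∀ t, |q t| ≤ B) : Continuous (sol q) := by
  rw [continuous_iff_continuousAt]
  intro t
  have hT : (0 : ℝ) ≤ max t 0 + 1 := by positivity
  have h2 : ContinuousOn (sol q) (Iio (max t 0 + 1)) :=
    continuousOn_tsum (fun n => (continuous_neumannTerm hq hB n).continuousOn)
      (Real.summable_pow_div_factorial (B * (max t 0 + 1)))
      fun n x hx => abs_neumannTerm_le_of_le hB n (le_of_lt hx) hT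
  exact h2.continuousAt (Iio_mem_nhds (by linarith [le_max_left t 0]))

lemma hasSum_sol (hB : ∀ t, |q t| ≤ B) (t : ℝ) : HasSum (fun n => neumannTerm q n t) (sol q t) :=
  (Summable.of_norm_bounded (Real.summable_pow_div_factorial (B * max t 0))
    fun n => abs_neumannTerm_le hB n t).hasSum

lemma continuous_flux (hq : Measurable q) (hB : ∀ t, |q t| ≤ B) : Continuous (flux q) :=
  continuous_primitive_mul hq hB (continuous_sol hq hB)

lemma hasSum_flux (hq : Measurable q) (hB : ∀ t, |q t| ≤ B) {t : ℝ} (ht : 0 ≤ t) :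
    HasSum (fun n => ∫ σ in (0 : ℝ)..t, q σ * neumannTerm q n σ) (flux q t) := by
  have hB0 : 0 ≤ B := (abs_nonneg _).trans (hB 0)
  refine intervalIntegral.hasSum_integral_of_dominated_convergence
    (fun n _ => B * ((B * t) ^ n / n.factorial)) ?_ ?_ ?_ ?_ ?_
  · intro n
    exact (hq.mul (continuous_neumannTerm hq hB n).measurable).aestronglyMeasurable
  · intro n
    refine ae_of_all _ fun σ hσ => ?_
    rw [uIoc_of_le ht] at hσ
    rw [Real.norm_eq_abs, abs_mul]
    exact mul_le_mul (hB σ) (abs_neumannTerm_le_of_le hB n hσ.2 ht) (abs_nonneg _) hB0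
  · exact ae_of_all _ fun σ _ => (Real.summable_pow_div_factorial (B * t)).mul_left B
  · exact intervalIntegrable_const
  · exact ae_of_all _ fun σ _ => (hasSum_sol hB σ).mul_left _

lemma sol_eq (hq : Measurable q) (hB : ∀ t, |q t| ≤ B) {t : ℝ} (ht : 0 ≤ t) :
    sol q t = 1 - ∫ s in (0 : ℝ)..t, flux q s / (4 * s) := by
  have hB0 : 0 ≤ B := (abs_nonneg _).trans (hB 0)
  have h1 : HasSum (fun n => ∫ s in (0 : ℝ)..t,
      (∫ σ in (0 : ℝ)..s, q σ * neumannTerm q n σ) / (4 * s))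
      (∫ s in (0 : ℝ)..t, flux q s / (4 * s)) := by
    refine intervalIntegral.hasSum_integral_of_dominated_convergence
      (fun n _ => B * ((B * t) ^ n / n.factorial) / 4) ?_ ?_ ?_ ?_ ?_
    · intro n
      exact ((continuous_primitive_mul hq hB (continuous_neumannTerm hq hB n)).measurable.div
        (measurable_const.mul measurable_id)).aestronglyMeasurable
    · intro n
      refine ae_of_all _ fun σ hσ => ?_
      rw [uIoc_of_le ht] at hσ
      exact abs_primitive_div_le hB hσ.1.le fun τ hτ =>
        abs_neumannTerm_le_of_le hB n (hτ.2.trans hσ.2) ht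
    · exact ae_of_all _ fun σ _ =>
        ((Real.summable_pow_div_factorial (B * t)).mul_left B).div_const 4
    · exact intervalIntegrable_const
    · refine ae_of_all _ fun σ hσ => ?_
      rw [uIoc_of_le ht] at hσ
      exact (hasSum_flux hq hB hσ.1.le).div_const _
  have h2 : HasSum (fun n => neumannTerm q (n + 1) t)
      (-∫ s in (0 : ℝ)..t, flux q s / (4 * s)) := by
    have : (fun n => neumannTerm q (n + 1) t) = fun n => -∫ s in (0 : ℝ)..t,
        (∫ σ in (0 : ℝ)..s, q σ * neumannTerm q n σ) / (4 * s) := by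
      funext n
      simp [neumannTerm, volterra, max_eq_left ht]
    rw [this]
    exact h1.neg
  have h3 := (hasSum_nat_add_iff' 1).2 (hasSum_sol hB t)
  have h4 := h2.unique h3
  simp [neumannTerm] at h4
  linarith

lemma sol_zero (hq : Measurable q) (hB : ∀ t, |q t| ≤ B) : sol q 0 = 1 := by
  simpa using sol_eq hq hB le_rfl

lemma flux_zero : flux q 0 = 0 := by simp [flux]

lemma intervalIntegrable_flux_div (hq : Measurable q) (hB : ∀ t, |q t| ≤ B) {T : ℝ} (hT : 0 ≤ T) :
    IntervalIntegrable (fun s => flux q s / (4 * s)) volume 0 T :=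
  intervalIntegrable_primitive_div hq hB (continuous_sol hq hB) hT

lemma sol_sub_sol (hq : Measurable q) (hB : ∀ t, |q t| ≤ B) {a b : ℝ} (ha : 0 ≤ a) (hab : a ≤ b) :
    sol q b = sol q a + ∫ s in a..b, -flux q s / (4 * s) := by
  have h := intervalIntegral.integral_add_adjacent_intervals
    (intervalIntegrable_flux_div hq hB ha)
    ((intervalIntegrable_flux_div hq hB ha).symm.trans
      (intervalIntegrable_flux_div hq hB (ha.trans hab)))
  rw [sol_eq hq hB ha, sol_eq hq hB (ha.trans hab), ← h]
  simp only [neg_div, intervalIntegral.integral_neg]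
  ring

lemma flux_sub_flux (hq : Measurable q) (hB : ∀ t, |q t| ≤ B) (a b : ℝ) :
    flux q b = flux q a + ∫ s in a..b, q s * sol q s := by
  have hi := fun a b => intervalIntegrable_bounded_mul hq hB (continuous_sol hq hB) a b
  exact (intervalIntegral.integral_add_adjacent_intervals (hi 0 a) (hi a b)).symm

lemma sol_hasDerivAt (hq : Measurable q) (hB : ∀ t, |q t| ≤ B) {t : ℝ} (ht : 0 < t) :
    HasDerivAt (sol q) (-flux q t / (4 * t)) t := by
  have hm : Measurable fun s => flux q s / (4 * s) :=
    (continuous_flux hq hB).measurable.div (measurable_const.mul measurable_id)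
  have h := intervalIntegral.integral_hasDerivAt_right (intervalIntegrable_flux_div hq hB ht.le)
    hm.stronglyMeasurable.stronglyMeasurableAtFilter
    ((continuous_flux hq hB).continuousAt.div (by fun_prop) (by positivity))
  rw [neg_div]
  refine (h.const_sub 1).congr_of_eventuallyEq ?_
  filter_upwards [lt_mem_nhds ht] with s hs using sol_eq hq hB (le_of_lt hs)

/-- A Grönwall inequality for the Volterra operator in a weighted norm. -/
lemma abs_le_two_mul_exp_of_contraction {w : ℝ → ℝ} {A T : ℝ} (hT : 0 ≤ T) (hw : Continuous w)
    (h : ∀ N, 0 ≤ N → (∀ s ∈ Icc 0 T, |w s| ≤ N * Real.exp (B * s)) →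
      ∀ t ∈ Icc 0 T, |w t| ≤ (A + N / 2) * Real.exp (B * t)) :
    ∀ t ∈ Icc 0 T, |w t| ≤ 2 * A * Real.exp (B * t) := by
  -- N is the norm of w with weight exp(-Bt), attained at x; the hypothesis read at x becomes N ≤ A
  -- + N/2.
  obtain ⟨x, hx, hmax⟩ := isCompact_Icc.exists_isMaxOn (s := Icc 0 T) ⟨0, le_rfl, hT⟩
    (f := fun t => |w t| * Real.exp (-(B * t))) (by fun_prop)
  set N := |w x| * Real.exp (-(B * x))
  have key : ∀ s ∈ Icc 0 T, |w s| ≤ N * Real.exp (B * s) := by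
    intro s hs
    have := isMaxOn_iff.1 hmax s hs
    calc |w s| = |w s| * Real.exp (-(B * s)) * Real.exp (B * s) := by
          rw [mul_assoc, ← Real.exp_add]; simp
      _ ≤ _ := by gcongr
  have hN := h N (by positivity) key x hx
  have hN' : N ≤ A + N / 2 := by
    have := mul_le_mul_of_nonneg_right hN (Real.exp_pos (-(B * x))).le
    rwa [mul_assoc, ← Real.exp_add, add_neg_cancel, Real.exp_zero, mul_one] at this
  intro t ht
  refine (key t ht).trans ?_
  gcongr
  linarith

/-- Supplies the factor 1/2 for `abs_le_two_mul_exp_of_contraction`: in the weighted norm the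
Volterra operator contracts on intervals of any length. -/
lemma integral_exp_mul_le {N t : ℝ} (hN : 0 ≤ N) :
    ∫ s in (0 : ℝ)..t, B * N * Real.exp (B * s) / 4 ≤ N / 2 * Real.exp (B * t) := by
  have h : ∫ s in (0 : ℝ)..t, B * N * Real.exp (B * s) / 4
      = N / 4 * Real.exp (B * t) - N / 4 * Real.exp (B * 0) := by
    rw [intervalIntegral.integral_eq_sub_of_hasDerivAt (f := fun s => N / 4 * Real.exp (B * s))]
    · intro s _
      exact ((((hasDerivAt_id' s).const_mul B).exp).const_mul (N / 4)).congr_deriv (by ring)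
    · exact Continuous.intervalIntegrable (by fun_prop) _ _
  rw [h]
  have := Real.exp_pos (B * t)
  have := Real.exp_pos (B * 0)
  nlinarith [mul_nonneg hN (Real.exp_pos (B * t)).le, mul_nonneg hN (Real.exp_pos (B * 0)).le]

lemma abs_sol_le (hq : Measurable q) (hB : ∀ t, |q t| ≤ B) {T : ℝ} (hT : 0 ≤ T) {t : ℝ}
    (ht : t ∈ Icc 0 T) : |sol q t| ≤ 2 * Real.exp (B * T) := by
  have hB0 : 0 ≤ B := (abs_nonneg _).trans (hB 0)
  have := abs_le_two_mul_exp_of_contraction (B := B) (A := 1) hT (continuous_sol hq hB) ?_ t ht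
  · refine this.trans ?_
    rw [mul_one]
    gcongr
    exact ht.2
  · intro N hN0 hN t ht
    have h1 : |∫ s in (0 : ℝ)..t, flux q s / (4 * s)|
        ≤ ∫ s in (0 : ℝ)..t, B * N * Real.exp (B * s) / 4 := by
      have hi : IntervalIntegrable (fun s => B * N * Real.exp (B * s) / 4) volume 0 t :=
        Continuous.intervalIntegrable (by fun_prop) _ _
      rw [← Real.norm_eq_abs]
      refine intervalIntegral.norm_integral_le_of_norm_le ht.1 (ae_of_all _ fun s hs => ?_) hi
      have := abs_primitive_div_le hB hs.1.le (w := sol q) (M := N * Real.exp (B * s)) ?_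
      · rw [Real.norm_eq_abs]
        exact this.trans (le_of_eq (by ring))
      · intro σ hσ
        refine (hN σ ⟨hσ.1, hσ.2.trans (hs.2.trans ht.2)⟩).trans ?_
        gcongr
        exact hσ.2
    rw [sol_eq hq hB ht.1]
    have h2 := integral_exp_mul_le (B := B) (t := t) hN0
    have h3 : 1 ≤ Real.exp (B * t) := Real.one_le_exp (mul_nonneg hB0 ht.1)
    calc _ ≤ 1 + |∫ s in (0 : ℝ)..t, flux q s / (4 * s)| := by
          simpa using abs_sub (1 : ℝ) (∫ s in (0 : ℝ)..t, flux q s / (4 * s))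
      _ ≤ _ := by linarith

lemma abs_flux_le (hq : Measurable q) (hB : ∀ t, |q t| ≤ B) {T : ℝ} (hT : 0 ≤ T) {t : ℝ}
    (ht : t ∈ Icc 0 T) : |flux q t| ≤ B * (2 * Real.exp (B * T)) * t :=
  abs_primitive_mul_le hB ht.1 fun _ hσ => abs_sol_le hq hB hT ⟨hσ.1, hσ.2.trans ht.2⟩

lemma abs_flux_div_le (hq : Measurable q) (hB : ∀ t, |q t| ≤ B) {T : ℝ} (hT : 0 ≤ T) {t : ℝ}
    (ht : t ∈ Icc 0 T) : |flux q t / (4 * t)| ≤ B * (2 * Real.exp (B * T)) / 4 :=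
  abs_primitive_div_le hB ht.1 fun _ hσ => abs_sol_le hq hB hT ⟨hσ.1, hσ.2.trans ht.2⟩

lemma integral_const_div_sqrt {c t : ℝ} :
    ∫ s in (0 : ℝ)..t, c * s ^ (-(1 / 2) : ℝ) = 2 * c * √t := by
  rw [intervalIntegral.integral_const_mul, integral_rpow (by norm_num), Real.sqrt_eq_rpow]
  norm_num
  ring

/-- Splits q₁u₁ - q₂u₂ into q₁(u₁ - u₂) + (q₁ - q₂)u₂. The bound κ√s, rather than a constant, keeps
the quotient by 4s integrable at 0. -/
lemma abs_flux_sub_flux_le {q₁ q₂ : ℝ → ℝ} (hq₁ : Measurable q₁) (hB₁ : ∀ t, |q₁ t| ≤ B)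
    (hq₂ : Measurable q₂) (hB₂ : ∀ t, |q₂ t| ≤ B) {T M κ : ℝ} (hT : 0 ≤ T) {s : ℝ}
    (hs : s ∈ Icc 0 T) (hκ : ∫ σ in (0 : ℝ)..s, |q₁ σ - q₂ σ| ≤ κ * √s)
    (hM : ∀ σ ∈ Icc 0 s, |sol q₁ σ - sol q₂ σ| ≤ M) :
    |flux q₁ s - flux q₂ s| ≤ B * M * s + 2 * Real.exp (B * T) * κ * √s := by
  have hc₁ := continuous_sol hq₁ hB₁
  have hc₂ := continuous_sol hq₂ hB₂
  have hqq : ∀ t, |q₁ t - q₂ t| ≤ B + B := fun t =>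
    (abs_sub _ _).trans (add_le_add (hB₁ t) (hB₂ t))
  have e : flux q₁ s - flux q₂ s = (∫ σ in (0 : ℝ)..s, q₁ σ * (sol q₁ σ - sol q₂ σ))
      + ∫ σ in (0 : ℝ)..s, (q₁ σ - q₂ σ) * sol q₂ σ := by
    rw [flux, flux, ← intervalIntegral.integral_sub
      (intervalIntegrable_bounded_mul hq₁ hB₁ hc₁ _ _)
      (intervalIntegrable_bounded_mul hq₂ hB₂ hc₂ _ _), ← intervalIntegral.integral_add
      (intervalIntegrable_bounded_mul hq₁ hB₁ (w := fun σ => sol q₁ σ - sol q₂ σ) (hc₁.sub hc₂) _ _)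
      (intervalIntegrable_bounded_mul (q := fun σ => q₁ σ - q₂ σ) (hq₁.sub hq₂) hqq hc₂ _ _)]
    congr 1
    funext σ
    ring
  rw [e]
  refine (abs_add_le _ _).trans (add_le_add (abs_primitive_mul_le hB₁ hs.1 hM) ?_)
  have hi : IntervalIntegrable (fun σ => 2 * Real.exp (B * T) * |q₁ σ - q₂ σ|) volume 0 s :=
    ((intervalIntegrable_of_bounded (hq₁.sub hq₂) hqq _ _).abs).const_mul _
  have h := intervalIntegral.norm_integral_le_of_norm_le (f := fun σ => (q₁ σ - q₂ σ) * sol q₂ σ)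
    hs.1 (ae_of_all _ fun σ hσ => ?_) hi
  · rw [Real.norm_eq_abs] at h
    refine h.trans ?_
    rw [intervalIntegral.integral_const_mul, mul_assoc _ κ]
    gcongr
  · rw [Real.norm_eq_abs, abs_mul, mul_comm]
    gcongr
    exact abs_sol_le hq₂ hB₂ hT ⟨hσ.1.le, hσ.2.trans hs.2⟩

/-- Continuous dependence of the solution on the potential. -/
lemma abs_sol_sub_sol_le {q₁ q₂ : ℝ → ℝ} (hq₁ : Measurable q₁) (hB₁ : ∀ t, |q₁ t| ≤ B)
    (hq₂ : Measurable q₂) (hB₂ : ∀ t, |q₂ t| ≤ B) {T κ : ℝ} (hT : 0 ≤ T) (hκ0 : 0 ≤ κ)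
    (hκ : ∀ s ∈ Icc 0 T, ∫ σ in (0 : ℝ)..s, |q₁ σ - q₂ σ| ≤ κ * √s) {t : ℝ} (ht : t ∈ Icc 0 T) :
    |sol q₁ t - sol q₂ t| ≤ 2 * (Real.exp (B * T) * κ * √T) * Real.exp (B * T) := by
  have hB0 : 0 ≤ B := (abs_nonneg _).trans (hB₁ 0)
  have := abs_le_two_mul_exp_of_contraction (B := B) (A := Real.exp (B * T) * κ * √T) hT
    ((continuous_sol hq₁ hB₁).sub (continuous_sol hq₂ hB₂)) ?_ t ht
  · refine this.trans ?_
    gcongr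
    exact ht.2
  · intro N hN0 hN t ht
    have e : sol q₁ t - sol q₂ t = -∫ s in (0 : ℝ)..t, (flux q₁ s / (4 * s) - flux q₂ s / (4 * s)) := by
      rw [sol_eq hq₁ hB₁ ht.1, sol_eq hq₂ hB₂ ht.1, intervalIntegral.integral_sub
        (intervalIntegrable_flux_div hq₁ hB₁ ht.1) (intervalIntegrable_flux_div hq₂ hB₂ ht.1)]
      ring
    have hi1 : IntervalIntegrable (fun s => B * N * Real.exp (B * s) / 4) volume 0 t :=
      Continuous.intervalIntegrable (by fun_prop) _ _
    have hi2 : IntervalIntegrable (fun s => (2 * Real.exp (B * T) * κ / 4) * s ^ (-(1 / 2) : ℝ))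
        volume 0 t := (intervalIntegral.intervalIntegrable_rpow' (by norm_num)).const_mul _
    have h1 : |∫ s in (0 : ℝ)..t, (flux q₁ s / (4 * s) - flux q₂ s / (4 * s))|
        ≤ ∫ s in (0 : ℝ)..t, (B * N * Real.exp (B * s) / 4
          + (2 * Real.exp (B * T) * κ / 4) * s ^ (-(1 / 2) : ℝ)) := by
      rw [← Real.norm_eq_abs]
      refine intervalIntegral.norm_integral_le_of_norm_le ht.1 (ae_of_all _ fun s hs => ?_)
        (hi1.add hi2)
      have hs' : s ∈ Icc 0 T := ⟨hs.1.le, hs.2.trans ht.2⟩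
      have hs0 : 0 < s := hs.1
      have := abs_flux_sub_flux_le hq₁ hB₁ hq₂ hB₂ hT hs' (hκ s hs') (M := N * Real.exp (B * s)) ?_
      · rw [Real.norm_eq_abs, ← sub_div, abs_div, abs_of_pos (by positivity : (0 : ℝ) < 4 * s),
          div_le_iff₀ (by positivity)]
        refine this.trans (le_of_eq ?_)
        have h2 : s ^ (-(1 / 2) : ℝ) * s = √s := by
          rw [Real.sqrt_eq_rpow]
          nth_rw 2 [← Real.rpow_one s]
          rw [← Real.rpow_add hs0]
          norm_num
        rw [← h2]
        ring
      · intro σ hσ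
        refine (hN σ ⟨hσ.1, hσ.2.trans hs'.2⟩).trans ?_
        gcongr
        exact hσ.2
    rw [intervalIntegral.integral_add hi1 hi2, integral_const_div_sqrt] at h1
    have h2 := integral_exp_mul_le (B := B) (t := t) hN0
    have h3 : 1 ≤ Real.exp (B * t) := Real.one_le_exp (mul_nonneg hB0 ht.1)
    have h4 : √t ≤ √T := Real.sqrt_le_sqrt ht.2
    have h5 : 0 ≤ Real.exp (B * T) * κ := by positivity
    have h6 := mul_le_mul_of_nonneg_left h4 h5
    have h7 : 0 ≤ Real.exp (B * T) * κ * √T := by positivity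
    rw [Pi.sub_apply, e, abs_neg]
    nlinarith

/-- Integration by parts for primitives of integrable functions. -/
lemma integral_mul_primitive_add {f g F G : ℝ → ℝ} {a b : ℝ} (hab : a ≤ b)
    (hf : IntervalIntegrable f volume a b) (hg : IntervalIntegrable g volume a b)
    (hF : ∀ t ∈ Icc a b, F t = F a + ∫ s in a..t, f s)
    (hG : ∀ t ∈ Icc a b, G t = G a + ∫ s in a..t, g s) :
    ∫ s in a..b, (f s * G s + F s * g s) = F b * G b - F a * G a := by
  have hc : ∀ c : ℝ, AbsolutelyContinuousOnInterval (fun _ : ℝ => c) a b := fun c =>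
    (LipschitzWith.const c).lipschitzOnWith.absolutelyContinuousOnInterval
  have hAF : AbsolutelyContinuousOnInterval (fun t => F a + ∫ s in a..t, f s) a b :=
    (hc (F a)).add (hf.absolutelyContinuousOnInterval_intervalIntegral (c := a) (by simp))
  have hAG : AbsolutelyContinuousOnInterval (fun t => G a + ∫ s in a..t, g s) a b :=
    (hc (G a)).add (hg.absolutelyContinuousOnInterval_intervalIntegral (c := a) (by simp))
  have h := hAF.integral_deriv_mul_eq_sub hAG
  rw [← hF b ⟨hab, le_rfl⟩, ← hG b ⟨hab, le_rfl⟩] at h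
  simp only [intervalIntegral.integral_same, add_zero] at h
  rw [← h]
  refine intervalIntegral.integral_congr_ae ?_
  filter_upwards [hf.ae_hasDerivAt_integral, hg.ae_hasDerivAt_integral] with x hx₁ hx₂ hx
  have hx' : x ∈ uIcc a b := uIoc_subset_uIcc hx
  have hx'' : x ∈ Icc a b := by rwa [uIcc_of_le hab] at hx'
  rw [((hx₁ hx' a (by simp)).const_add (F a)).deriv, ((hx₂ hx' a (by simp)).const_add (G a)).deriv,
    ← hF x hx'', ← hG x hx'']

end Volterra

/-! ### Radial functions on the disc and radial elements of the Sobolev space. -/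

/-- The disc of radius √a has area πa, so |x|² is uniformly distributed; it suffices to compare the
two finite measures on half-lines. -/
lemma map_normSq_muOmega {R : ℝ} (hR : 0 < R) :
    Measure.map (fun x : Plane => ‖x‖ ^ 2) (muOmega R)
      = ENNReal.ofReal Real.pi • volume.restrict (Ioc 0 (R ^ 2)) := by
  have hm : Measurable fun x : Plane => ‖x‖ ^ 2 := by fun_prop
  have hfin : IsFiniteMeasure (muOmega R) := by
    refine ⟨?_⟩
    rw [muOmega, Measure.restrict_apply_univ, Omega]
    exact measure_ball_lt_top
  refine Measure.ext_of_Iic _ _ fun a => ?_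
  rw [Measure.map_apply hm measurableSet_Iic, muOmega, Measure.restrict_apply (hm measurableSet_Iic),
    Measure.smul_apply, Measure.restrict_apply measurableSet_Iic, smul_eq_mul]
  rcases lt_or_ge a 0 with ha | ha
  · have h1 : (fun x : Plane => ‖x‖ ^ 2) ⁻¹' Iic a ∩ Omega R = ∅ := by
      ext x
      simp only [mem_inter_iff, mem_preimage, mem_Iic, mem_empty_iff_false, iff_false, not_and]
      intro h
      nlinarith [sq_nonneg ‖x‖]
    have h2 : Iic a ∩ Ioc 0 (R ^ 2) = ∅ := by
      ext x
      simp only [mem_inter_iff, mem_Iic, mem_Ioc, mem_empty_iff_false, iff_false]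
      intro h
      linarith [h.1, h.2.1]
    rw [h1, h2]
    simp
  rcases lt_or_ge a (R ^ 2) with haR | haR
  · have h1 : (fun x : Plane => ‖x‖ ^ 2) ⁻¹' Iic a ∩ Omega R = Metric.closedBall 0 (√a) := by
      ext x
      simp only [mem_inter_iff, mem_preimage, mem_Iic, Omega, Metric.mem_ball, dist_zero_right,
        Metric.mem_closedBall]
      rw [Real.le_sqrt (norm_nonneg _) ha]
      refine ⟨fun h => h.1, fun h => ⟨h, ?_⟩⟩
      exact lt_of_pow_lt_pow_left₀ 2 hR.le (h.trans_lt haR)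
    have h2 : Iic a ∩ Ioc 0 (R ^ 2) = Ioc 0 a := by
      ext x
      simp only [mem_inter_iff, mem_Iic, mem_Ioc]
      constructor
      · rintro ⟨h, h', _⟩; exact ⟨h', h⟩
      · rintro ⟨h, h'⟩; exact ⟨h', h, by linarith⟩
    rw [h1, h2, EuclideanSpace.volume_closedBall_fin_two, Real.volume_Ioc,
      ← ENNReal.ofReal_pow (Real.sqrt_nonneg _), Real.sq_sqrt ha, mul_comm, sub_zero]
  · have h1 : (fun x : Plane => ‖x‖ ^ 2) ⁻¹' Iic a ∩ Omega R = Metric.ball 0 R := by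
      ext x
      simp only [mem_inter_iff, mem_preimage, mem_Iic, Omega, Metric.mem_ball, dist_zero_right]
      refine ⟨fun h => h.2, fun h => ⟨?_, h⟩⟩
      exact (pow_le_pow_left₀ (norm_nonneg _) h.le 2).trans haR
    have h2 : Iic a ∩ Ioc 0 (R ^ 2) = Ioc 0 (R ^ 2) := by
      ext x
      simp only [mem_inter_iff, mem_Iic, mem_Ioc]
      constructor
      · rintro ⟨h, h', h''⟩; exact ⟨h', h''⟩
      · rintro ⟨h, h'⟩; exact ⟨h'.trans haR, h, h'⟩
    rw [h1, h2, EuclideanSpace.volume_ball_fin_two, Real.volume_Ioc,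
      ← ENNReal.ofReal_pow hR.le, mul_comm, sub_zero]

instance isFiniteMeasure_muOmega (R : ℝ) : IsFiniteMeasure (muOmega R) := by
  refine ⟨?_⟩
  rw [muOmega, Measure.restrict_apply_univ, Omega]
  exact measure_ball_lt_top

/-- The radial function `x ↦ f (|x|²)`. -/
noncomputable def radial (f : ℝ → ℝ) : Plane → ℝ := fun x => f (‖x‖ ^ 2)

lemma measurable_radial {f : ℝ → ℝ} (hf : Measurable f) : Measurable (radial f) :=
  hf.comp (by fun_prop)

lemma integral_radial {R : ℝ} (hR : 0 < R) {f : ℝ → ℝ} (hf : Measurable f) :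
    ∫ x, radial f x ∂(muOmega R) = Real.pi * ∫ t in (0 : ℝ)..R ^ 2, f t := by
  have hm : Measurable fun x : Plane => ‖x‖ ^ 2 := by fun_prop
  have h := integral_map (μ := muOmega R) hm.aemeasurable (f := f) hf.aestronglyMeasurable
  rw [map_normSq_muOmega hR, integral_smul_measure, ENNReal.toReal_ofReal Real.pi_pos.le] at h
  rw [intervalIntegral.integral_of_le (by positivity)]
  exact h.symm

lemma ae_radial {R : ℝ} (hR : 0 < R) {p : ℝ → Prop}
    (h : ∀ᵐ t ∂(volume.restrict (Ioc 0 (R ^ 2))), p t) : ∀ᵐ x ∂(muOmega R), p (‖x‖ ^ 2) := by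
  have hm : Measurable fun x : Plane => ‖x‖ ^ 2 := by fun_prop
  refine ae_of_ae_map hm.aemeasurable ?_
  rw [map_normSq_muOmega hR]
  exact Measure.ae_smul_measure h _

lemma normSq_mem_of_mem_Omega {R : ℝ} {x : Plane} (hx : x ∈ Omega R) :
    ‖x‖ ^ 2 < R ^ 2 := by
  rw [Omega, Metric.mem_ball, dist_zero_right] at hx
  exact pow_lt_pow_left₀ hx (norm_nonneg _) two_ne_zero

lemma ae_mem_Omega (R : ℝ) : ∀ᵐ x ∂(muOmega R), x ∈ Omega R :=
  ae_restrict_mem Metric.isOpen_ball.measurableSet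

lemma tendsto_integral_inner_of_tendsto {α E : Type*} [MeasurableSpace α] {μ : Measure α}
    [NormedAddCommGroup E] [InnerProductSpace ℝ E] {f h : ℕ → α → E} {f₀ h₀ : α → E}
    (hf : ∀ k, MemLp (f k) 2 μ) (hh : ∀ k, MemLp (h k) 2 μ) (hf₀ : MemLp f₀ 2 μ)
    (hh₀ : MemLp h₀ 2 μ)
    (hfl : Tendsto (fun k => eLpNorm (fun x => f k x - f₀ x) 2 μ) atTop (𝓝 0))
    (hhl : Tendsto (fun k => eLpNorm (fun x => h k x - h₀ x) 2 μ) atTop (𝓝 0)) :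
    Tendsto (fun k => ∫ x, inner ℝ (f k x) (h k x) ∂μ) atTop (𝓝 (∫ x, inner ℝ (f₀ x) (h₀ x) ∂μ)) := by
  have h1 := (Lp.tendsto_Lp_iff_tendsto_eLpNorm'' f hf f₀ hf₀).2 hfl
  have h2 := (Lp.tendsto_Lp_iff_tendsto_eLpNorm'' h hh h₀ hh₀).2 hhl
  have h3 := h1.inner (𝕜 := ℝ) h2
  have key : ∀ {a b : α → E} (ha : MemLp a 2 μ) (hb : MemLp b 2 μ),
      inner ℝ (ha.toLp a) (hb.toLp b) = ∫ x, inner ℝ (a x) (b x) ∂μ := by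
    intro a b ha hb
    rw [L2.inner_def]
    refine integral_congr_ae ?_
    filter_upwards [ha.coeFn_toLp, hb.coeFn_toLp] with x hx hy
    rw [hx, hy]
  simpa only [key] using h3

lemma IsTest.gradient_hasFDerivAt {R : ℝ} {φ : Plane → ℝ} (hφ : IsTest R φ) (x : Plane) :
    HasFDerivAt φ (InnerProductSpace.toDual ℝ Plane (gradient φ x)) x :=
  (hφ.1.differentiable (by simp)).differentiableAt.hasGradientAt

lemma IsTest.continuous_gradient {R : ℝ} {φ : Plane → ℝ} (hφ : IsTest R φ) :
    Continuous (gradient φ) := by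
  have : Continuous (fderiv ℝ φ) := hφ.1.continuous_fderiv (by simp)
  exact (InnerProductSpace.toDual ℝ Plane).symm.continuous.comp this

lemma gradient_eq_zero_of_notMem_tsupport {φ : Plane → ℝ} {x : Plane} (hx : x ∉ tsupport φ) :
    gradient φ x = 0 := by
  have : fderiv ℝ φ x = 0 := by
    by_contra h
    exact hx (support_fderiv_subset ℝ h)
  simp [gradient, this]

lemma IsTest.hasCompactSupport_gradient {R : ℝ} {φ : Plane → ℝ} (hφ : IsTest R φ) :
    HasCompactSupport (gradient φ) :=
  HasCompactSupport.of_support_subset_isCompact hφ.2.1 fun x hx => by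
    by_contra h
    exact hx (gradient_eq_zero_of_notMem_tsupport h)

lemma IsTest.memLp {R : ℝ} {φ : Plane → ℝ} (hφ : IsTest R φ) : MemLp φ 2 (muOmega R) :=
  hφ.1.continuous.memLp_of_hasCompactSupport hφ.2.1

lemma IsTest.memLp_gradient {R : ℝ} {φ : Plane → ℝ} (hφ : IsTest R φ) :
    MemLp (gradient φ) 2 (muOmega R) :=
  hφ.continuous_gradient.memLp_of_hasCompactSupport hφ.hasCompactSupport_gradient

lemma IsTest.apply_eq_zero {R : ℝ} {φ : Plane → ℝ} (hφ : IsTest R φ) {x : Plane} (hx : x ∉ Omega R) :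
    φ x = 0 := image_eq_zero_of_notMem_tsupport fun h => hx (hφ.2.2 h)

/-- Tests have support in a strictly smaller ball. -/
lemma IsTest.exists_radius {R : ℝ} (hR : 0 < R) {φ : Plane → ℝ} (hφ : IsTest R φ) :
    ∃ τ, 0 < τ ∧ τ < R ^ 2 ∧ ∀ x, τ < ‖x‖ ^ 2 → x ∉ tsupport φ := by
  obtain ⟨r, hr, hsub⟩ := exists_lt_subset_ball hφ.2.1.isClosed hφ.2.2
  refine ⟨max r (R / 2) ^ 2, by positivity,
    pow_lt_pow_left₀ (max_lt hr (by linarith)) (by positivity) two_ne_zero, fun x hx hmem => ?_⟩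
  have h1 := hsub hmem
  rw [Metric.mem_ball, dist_zero_right] at h1
  have h2 := lt_of_pow_lt_pow_left₀ 2 (norm_nonneg _) hx
  exact absurd h1 (not_lt.2 ((le_max_left _ _).trans h2.le))

/-- The primitive of `g` that vanishes at `T`. -/
noncomputable def tail (T : ℝ) (g : ℝ → ℝ) (t : ℝ) : ℝ := -∫ s in t..T, g s

lemma continuous_tail {T K : ℝ} {g : ℝ → ℝ} (hg : Measurable g) (hK : ∀ t, |g t| ≤ K) :
    Continuous (tail T g) := by
  have : tail T g = fun t => ∫ s in T..t, g s := by
    funext t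
    rw [tail, ← intervalIntegral.integral_symm]
  rw [this]
  exact intervalIntegral.continuous_primitive (fun a b => intervalIntegrable_of_bounded hg hK a b) T

/-- A cut-off is needed near T only: |x|² is smooth at the origin, so no condition at t = 0 arises.
Mollification and the removal of a strip at T each cost ε/2. -/
lemma exists_smooth_approx {T K : ℝ} (hT : 0 < T) {g : ℝ → ℝ} (hg : Measurable g)
    (hK : ∀ t, |g t| ≤ K) {ε : ℝ} (hε : 0 < ε) :
    ∃ ψ : ℝ → ℝ, ContDiff ℝ ∞ ψ ∧ (∃ τ < T, 0 < τ ∧ ∀ t, τ ≤ t → ψ t = 0) ∧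
      eLpNorm (fun t => ψ t - g t) 2 (volume.restrict (Ioc 0 T)) ≤ ENNReal.ofReal ε := by
  have hK0 : 0 ≤ K := (abs_nonneg _).trans (hK 0)
  -- The removed strip has width 2η and L² norm at most K√(2η) ≤ ε/2; the bound T/3 keeps it inside
  -- (0, T).
  set η := min (T / 3) ((ε / 2 / (K + 1)) ^ 2 / 2) with hη
  have hη0 : 0 < η := by positivity
  have hηT : η ≤ T / 3 := min_le_left _ _
  have hηε : 2 * η ≤ (ε / 2 / (K + 1)) ^ 2 := by
    have := min_le_right (T / 3) ((ε / 2 / (K + 1)) ^ 2 / 2)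
    linarith
  set f : ℝ → ℝ := (Ioc 0 (T - 2 * η)).indicator g
  have hfm : Measurable f := hg.indicator measurableSet_Ioc
  have hf : MemLp f 2 volume := by
    refine (memLp_indicator_iff_restrict measurableSet_Ioc).2 ?_
    exact MemLp.of_bound hg.aestronglyMeasurable K (ae_of_all _ fun t => by simpa using hK t)
  obtain ⟨ψ, -, hψ, hle⟩ := hf.exist_eLpNorm_sub_le (by simp) (by norm_num) (half_pos hε)
  set χ : ℝ → ℝ := fun t => Real.smoothTransition ((T - η - t) / η)
  have hχ : ContDiff ℝ ∞ χ := Real.smoothTransition.contDiff.comp (by fun_prop)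
  refine ⟨fun t => χ t * ψ t, hχ.mul hψ, ⟨T - η, by linarith, by linarith, fun t ht => ?_⟩, ?_⟩
  · have : χ t = 0 := Real.smoothTransition.zero_of_nonpos
      (div_nonpos_of_nonpos_of_nonneg (by linarith) hη0.le)
    simp [this]
  · have e : (fun t => χ t * ψ t - g t) = (fun t => χ t * (ψ t - f t)) + fun t => χ t * f t - g t := by
      funext t
      simp only [Pi.add_apply]
      ring
    have hm1 : Measurable fun t => χ t * (ψ t - f t) :=
      hχ.continuous.measurable.mul (hψ.continuous.measurable.sub hfm)
    have hm2 : Measurable fun t => χ t * f t - g t := (hχ.continuous.measurable.mul hfm).sub hg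
    rw [e]
    refine (eLpNorm_add_le hm1.aestronglyMeasurable hm2.aestronglyMeasurable (by norm_num)).trans ?_
    rw [← add_halves ε, ENNReal.ofReal_add (by positivity) (by positivity)]
    refine add_le_add ?_ ?_
    · refine le_trans ?_ hle
      refine (eLpNorm_restrict_le _ _ _ _).trans (eLpNorm_mono fun t => ?_)
      rw [Pi.sub_apply, norm_mul, norm_sub_rev]
      refine mul_le_of_le_one_left (norm_nonneg _) ?_
      rw [Real.norm_eq_abs, abs_of_nonneg (Real.smoothTransition.nonneg _)]
      exact Real.smoothTransition.le_one _
    · have e2 : (fun t => χ t * f t - g t) =ᵐ[volume.restrict (Ioc 0 T)]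
          (Ioc (T - 2 * η) T).indicator fun t => -g t := by
        filter_upwards [ae_restrict_mem measurableSet_Ioc] with t ht
        by_cases h : t ≤ T - 2 * η
        · have h1 : f t = g t := indicator_of_mem (show t ∈ Ioc 0 (T - 2 * η) from ⟨ht.1, h⟩) _
          have h2 : χ t = 1 := Real.smoothTransition.one_of_one_le (by
            rw [le_div_iff₀ hη0]; linarith)
          rw [indicator_of_notMem (fun h' => absurd h'.1 (not_lt.2 h)), h1, h2]
          ring
        · have h1 : f t = 0 := indicator_of_notMem (fun h' => h h'.2) _
          rw [indicator_of_mem (show t ∈ Ioc (T - 2 * η) T from ⟨not_le.1 h, ht.2⟩), h1]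
          ring
      rw [eLpNorm_congr_ae e2]
      refine (eLpNorm_restrict_le _ _ _ _).trans ?_
      rw [eLpNorm_indicator_eq_eLpNorm_restrict measurableSet_Ioc]
      refine (eLpNorm_le_of_ae_bound (C := K) (ae_of_all _ fun t => by simpa using hK t)).trans ?_
      rw [Measure.restrict_apply_univ, Real.volume_Ioc, ENNReal.ofReal_rpow_of_nonneg (by linarith)
        (by simp), ← ENNReal.ofReal_mul (Real.rpow_nonneg (by linarith) _)]
      refine ENNReal.ofReal_le_ofReal ?_
      have h3 : (T - (T - 2 * η)) ^ ((2 : ENNReal).toReal⁻¹) ≤ ε / 2 / (K + 1) := by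
        have : (T - (T - 2 * η)) ^ ((2 : ENNReal).toReal⁻¹) = √(2 * η) := by
          rw [Real.sqrt_eq_rpow]
          norm_num
        rw [this]
        exact Real.sqrt_le_iff.2 ⟨by positivity, hηε⟩
      calc _ ≤ ε / 2 / (K + 1) * K := by gcongr
        _ ≤ ε / 2 / (K + 1) * (K + 1) := by gcongr; linarith
        _ = ε / 2 := by field_simp

lemma isTest_radial_tail {R τ : ℝ} {ψ : ℝ → ℝ} (hR : 0 < R) (hψ : ContDiff ℝ ∞ ψ) (hτ0 : 0 < τ)
    (hτ : τ < R ^ 2) (hz : ∀ t, τ ≤ t → ψ t = 0) :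
    IsTest R (radial (tail (R ^ 2) ψ)) ∧
      ∀ x, gradient (radial (tail (R ^ 2) ψ)) x = (2 * ψ (‖x‖ ^ 2)) • x := by
  have hd : ∀ t, HasDerivAt (tail (R ^ 2) ψ) (ψ t) t := by
    intro t
    have h := intervalIntegral.integral_hasDerivAt_left (a := t) (b := R ^ 2) (f := ψ)
      (hψ.continuous.intervalIntegrable _ _)
      hψ.continuous.stronglyMeasurable.stronglyMeasurableAtFilter hψ.continuous.continuousAt
    exact h.neg.congr_deriv (neg_neg _)
  have hc : ContDiff ℝ ∞ (tail (R ^ 2) ψ) := by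
    rw [contDiff_infty_iff_deriv]
    refine ⟨fun t => (hd t).differentiableAt, ?_⟩
    rwa [show deriv (tail (R ^ 2) ψ) = ψ from funext fun t => (hd t).deriv]
  have hzero : ∀ t, τ ≤ t → tail (R ^ 2) ψ t = 0 := by
    intro t ht
    rw [tail, intervalIntegral.integral_zero_ae, neg_zero]
    refine ae_of_all _ fun s hs => hz s ?_
    have := (uIoc_subset_uIcc hs).1
    exact (le_inf ht hτ.le).trans this
  have hts : tsupport (radial (tail (R ^ 2) ψ)) ⊆ Metric.closedBall 0 (√τ) := by
    refine closure_minimal (fun x hx => ?_) Metric.isClosed_closedBall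
    rw [Metric.mem_closedBall, dist_zero_right, Real.le_sqrt (norm_nonneg _) hτ0.le]
    by_contra h
    exact hx (hzero _ (not_le.1 h).le)
  refine ⟨⟨hc.comp (contDiff_norm_sq ℝ), ?_, ?_⟩, fun x => ?_⟩
  · exact HasCompactSupport.of_support_subset_isCompact (isCompact_closedBall 0 (√τ))
      ((subset_tsupport _).trans hts)
  · refine hts.trans (Metric.closedBall_subset_ball ?_)
    rw [Real.sqrt_lt' hR]
    exact hτ
  · refine HasGradientAt.gradient ?_
    have h1 : HasFDerivAt (fun y : Plane => ‖y‖ ^ 2) (2 • (innerSL ℝ x)) x :=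
      (hasStrictFDerivAt_norm_sq x).hasFDerivAt
    have h2 := (hd (‖x‖ ^ 2)).comp_hasFDerivAt x h1
    refine h2.congr_fderiv ?_
    ext y
    simp
    ring

/-- Trial functions are given by a derivative g that is only bounded and measurable. If smooth ψ_k
tend to g in L², their primitives converge uniformly and the gradients 2ψ_k x converge in L². -/
lemma memW12Zero_radial_tail {R K : ℝ} (hR : 0 < R) {g : ℝ → ℝ} (hg : Measurable g)
    (hK : ∀ t, |g t| ≤ K) :
    MemW12Zero R (radial (tail (R ^ 2) g)) (fun x => (2 * g (‖x‖ ^ 2)) • x) := by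
  have hK0 : 0 ≤ K := (abs_nonneg _).trans (hK 0)
  have hT : 0 < R ^ 2 := by positivity
  have hnorm : ∀ᵐ x ∂(muOmega R), ‖x‖ ≤ R := by
    filter_upwards [ae_mem_Omega R] with x hx
    rw [Omega, Metric.mem_ball, dist_zero_right] at hx
    exact hx.le
  have hgm : Measurable fun x : Plane => (2 * g (‖x‖ ^ 2)) • x :=
    (measurable_const.mul (measurable_radial hg)).smul measurable_id
  have hsub : ∀ (h : ℝ → ℝ), Measurable h →
      eLpNorm (radial h) 2 (muOmega R) = (ENNReal.ofReal Real.pi) ^ (1 / 2 : ℝ) *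
        eLpNorm h 2 (volume.restrict (Ioc 0 (R ^ 2))) := by
    intro h hh
    have hm : Measurable fun x : Plane => ‖x‖ ^ 2 := by fun_prop
    have h1 := eLpNorm_map_measure (p := 2) (μ := muOmega R) (g := h) hh.aestronglyMeasurable
      hm.aemeasurable
    rw [map_normSq_muOmega hR, eLpNorm_smul_measure_of_ne_top (by simp)] at h1
    change eLpNorm (h ∘ fun x : Plane => ‖x‖ ^ 2) 2 (muOmega R) = _
    simpa using h1.symm
  choose ψ hψ hτ hle using fun k : ℕ =>
    exists_smooth_approx hT hg hK (ε := 1 / ((k : ℝ) + 1)) (by positivity)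
  choose τ hτT hτ0 hz using hτ
  have htest := fun k => isTest_radial_tail hR (hψ k) (hτ0 k) (hτT k) (hz k)
  have hlim : Tendsto (fun k => eLpNorm (fun t => ψ k t - g t) 2 (volume.restrict (Ioc 0 (R ^ 2))))
      atTop (𝓝 0) := by
    refine tendsto_of_tendsto_of_tendsto_of_le_of_le tendsto_const_nhds ?_ (fun _ => zero_le) hle
    rw [← ENNReal.ofReal_zero]
    exact ENNReal.tendsto_ofReal tendsto_one_div_add_atTop_nhds_zero_nat
  refine ⟨?_, ?_, fun k => radial (tail (R ^ 2) (ψ k)), fun k => (htest k).1, ?_, ?_⟩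
  · refine MemLp.of_bound (measurable_radial (continuous_tail hg hK).measurable).aestronglyMeasurable
      (K * R ^ 2) ?_
    filter_upwards [ae_mem_Omega R] with x hx
    have h1 := intervalIntegral.norm_integral_le_of_norm_le_const (a := ‖x‖ ^ 2) (b := R ^ 2) (f := g)
      (C := K) fun t _ => hK t
    rw [radial, tail, norm_neg]
    refine h1.trans ?_
    rw [abs_of_nonneg (by linarith [normSq_mem_of_mem_Omega hx])]
    have : 0 ≤ ‖x‖ ^ 2 := by positivity
    gcongr
    linarith
  · refine MemLp.of_bound hgm.aestronglyMeasurable (2 * K * R) ?_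
    filter_upwards [hnorm] with x hx
    rw [norm_smul, norm_mul, Real.norm_two]
    gcongr
    exact hK _
  · set c : ENNReal := (volume.restrict (Ioc 0 (R ^ 2))) univ ^ (1 / (1 : ENNReal).toReal
      - 1 / (2 : ENNReal).toReal)
    set d : ENNReal := (muOmega R) univ ^ (2 : ENNReal).toReal⁻¹
    have hc : c ≠ ⊤ := by
      refine ENNReal.rpow_ne_top_of_nonneg (by norm_num) ?_
      simp
    have hd : d ≠ ⊤ := ENNReal.rpow_ne_top_of_nonneg (by norm_num) (measure_ne_top _ _)
    have hbound : ∀ k, eLpNorm (fun x => radial (tail (R ^ 2) (ψ k)) x - radial (tail (R ^ 2) g) x) 2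
        (muOmega R) ≤ d * (eLpNorm (fun t => ψ k t - g t) 2 (volume.restrict (Ioc 0 (R ^ 2))) * c) := by
      intro k
      have hm : Measurable fun t => ψ k t - g t := (hψ k).continuous.measurable.sub hg
      have h0 := eLpNorm_le_eLpNorm_mul_rpow_measure_univ (p := 1) (q := 2) (by norm_num)
        (μ := volume.restrict (Ioc 0 (R ^ 2))) hm.aestronglyMeasurable
      have hi : IntervalIntegrable (fun t => ψ k t - g t) volume 0 (R ^ 2) :=
        ((hψ k).continuous.intervalIntegrable _ _).sub (intervalIntegrable_of_bounded hg hK _ _)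
      refine (eLpNorm_le_of_ae_bound (C := ∫ t in Ioc 0 (R ^ 2), ‖ψ k t - g t‖) ?_).trans ?_
      · filter_upwards [ae_mem_Omega R] with x hx
        have h2 := (normSq_mem_of_mem_Omega hx).le
        rw [radial, radial, tail, tail, neg_sub_neg, norm_sub_rev, ← intervalIntegral.integral_sub
          ((hψ k).continuous.intervalIntegrable _ _) (intervalIntegrable_of_bounded hg hK _ _)]
        refine (intervalIntegral.norm_integral_le_integral_norm h2).trans ?_
        rw [intervalIntegral.integral_of_le h2]
        refine setIntegral_mono_set hi.norm.1 (ae_of_all _ fun _ => norm_nonneg _) ?_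
        exact (Ioc_subset_Ioc_left (by positivity)).eventuallyLE
      · refine mul_le_mul_right ?_ _
        refine le_trans (le_of_eq ?_) h0
        rw [eLpNorm_one_eq_lintegral_enorm, ofReal_integral_norm_eq_lintegral_enorm hi.1]
    refine tendsto_of_tendsto_of_tendsto_of_le_of_le tendsto_const_nhds ?_ (fun _ => zero_le) hbound
    have h1 := ENNReal.Tendsto.mul_const hlim (b := c) (Or.inr hc)
    have h2 := ENNReal.Tendsto.const_mul h1 (a := d) (Or.inr hd)
    simpa using h2
  · have hbound : ∀ k, eLpNorm (fun x => gradient (radial (tail (R ^ 2) (ψ k))) x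
        - (2 * g (‖x‖ ^ 2)) • x) 2 (muOmega R) ≤ ENNReal.ofReal (2 * R) *
          ((ENNReal.ofReal Real.pi) ^ (1 / 2 : ℝ) *
            eLpNorm (fun t => ψ k t - g t) 2 (volume.restrict (Ioc 0 (R ^ 2)))) := by
      intro k
      have hm : Measurable fun t => ψ k t - g t := (hψ k).continuous.measurable.sub hg
      rw [← hsub _ hm]
      refine eLpNorm_le_mul_eLpNorm_of_ae_le_mul ?_ 2
      filter_upwards [hnorm] with x hx
      rw [(htest k).2 x, ← sub_smul, ← mul_sub, norm_smul, norm_mul, Real.norm_two, radial]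
      calc _ ≤ 2 * ‖ψ k (‖x‖ ^ 2) - g (‖x‖ ^ 2)‖ * R := by gcongr
        _ = _ := by ring
    refine tendsto_of_tendsto_of_tendsto_of_le_of_le tendsto_const_nhds ?_ (fun _ => zero_le) hbound
    have h1 := ENNReal.Tendsto.const_mul hlim (a := (ENNReal.ofReal Real.pi) ^ (1 / 2 : ℝ))
      (Or.inr (ENNReal.rpow_ne_top_of_nonneg (by norm_num) ENNReal.ofReal_ne_top))
    have h2 := ENNReal.Tendsto.const_mul h1 (a := ENNReal.ofReal (2 * R))
      (Or.inr ENNReal.ofReal_ne_top)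
    simpa using h2

/-! ### Divergence theorem for radial fields and Barta's inequality. -/

/-- A function on the plane whose integral along every ray vanishes has integral zero. -/
lemma integral_eq_zero_of_rays {F : Plane → ℝ} (hF : Integrable F)
    (h : ∀ θ : Plane, ‖θ‖ = 1 → ∫ r in Ioi (0 : ℝ), r * F (r • θ) = 0) : ∫ x, F x = 0 := by
  set μ : Measure Plane := volume
  have hmp := μ.measurePreserving_homeomorphUnitSphereProd
  have hd : Module.finrank ℝ Plane - 1 = 1 := by simp
  rw [hd] at hmp
  set e := homeomorphUnitSphereProd Plane
  set F' : Metric.sphere (0 : Plane) 1 × Ioi (0 : ℝ) → ℝ := fun p => F ((p.2 : ℝ) • (p.1 : Plane))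
  have hFF : (fun x : ({0}ᶜ : Set Plane) => F x) = F' ∘ e := by
    funext x
    have := homeomorphUnitSphereProd_symm_apply_coe Plane (e x)
    rw [Homeomorph.symm_apply_apply] at this
    simp only [Function.comp, F']
    rw [← this]
  have h1 : ∫ x, F x ∂μ = ∫ p, F' p ∂(μ.toSphere.prod (.volumeIoiPow 1)) := by
    rw [← hmp.integral_comp (Homeomorph.measurableEmbedding _) F']
    calc ∫ x, F x ∂μ = ∫ x in ({0}ᶜ : Set Plane), F x ∂μ := by rw [restrict_compl_singleton]
      _ = ∫ x : ({0}ᶜ : Set Plane), F x ∂(μ.comap Subtype.val) :=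
        (integral_subtype_comap (measurableSet_singleton _).compl F).symm
      _ = _ := congrArg (fun f => ∫ x, f x ∂(μ.comap Subtype.val)) hFF
  have h2 : Integrable F' (μ.toSphere.prod (.volumeIoiPow 1)) := by
    rw [← hmp.integrable_comp_emb (Homeomorph.measurableEmbedding _), ← hFF]
    have := hF.integrableOn (s := ({0}ᶜ : Set Plane))
    rwa [integrableOn_iff_comap_subtypeVal (measurableSet_singleton _).compl] at this
  rw [h1, integral_prod _ h2]
  refine integral_eq_zero_of_ae (ae_of_all _ fun θ => ?_)
  have h3 := h θ (by simp)
  simp only [Pi.zero_apply, F']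
  rw [Measure.volumeIoiPow]
  simp only [ENNReal.ofReal]
  rw [integral_withDensity_eq_integral_smul ((measurable_subtype_coe.pow_const _).real_toNNReal)]
  rw [integral_subtype_comap measurableSet_Ioi
    fun r : ℝ => Real.toNNReal (r ^ 1) • F (r • (θ : Plane))]
  refine Eq.trans ?_ h3
  refine setIntegral_congr_fun measurableSet_Ioi fun r hr => ?_
  simp only [NNReal.smul_def, smul_eq_mul, pow_one]
  rw [Real.coe_toNNReal _ (le_of_lt hr)]

/-- The divergence theorem for the radial field `p(|x|²) x / |x|²`, where `p` is the primitive of the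
bounded function `f`. -/
lemma integral_radialField {R K : ℝ} (hR : 0 < R) {f : ℝ → ℝ} (hf : Measurable f)
    (hK : ∀ t, |f t| ≤ K) {k : Plane → ℝ} (hk : IsTest R k) :
    Integrable (fun x => (∫ s in (0 : ℝ)..‖x‖ ^ 2, f s) / ‖x‖ ^ 2 * inner ℝ x (gradient k x)) ∧
    Integrable (fun x => 2 * f (‖x‖ ^ 2) * k x) ∧
    ∫ x, ((∫ s in (0 : ℝ)..‖x‖ ^ 2, f s) / ‖x‖ ^ 2 * inner ℝ x (gradient k x)
      + 2 * f (‖x‖ ^ 2) * k x) = 0 := by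
  have hK0 : 0 ≤ K := (abs_nonneg _).trans (hK 0)
  set p : ℝ → ℝ := fun t => ∫ s in (0 : ℝ)..t, f s
  have hp : Continuous p :=
    intervalIntegral.continuous_primitive (fun a b => intervalIntegrable_of_bounded hf hK a b) 0
  have hpK : ∀ t, 0 ≤ t → |p t| ≤ K * t := by
    intro t ht
    have := intervalIntegral.norm_integral_le_of_norm_le_const (a := 0) (b := t) (f := f)
      (C := K) fun t _ => hK t
    simpa [abs_of_nonneg ht] using this
  have hgi : Integrable fun x => ‖x‖ * ‖gradient k x‖ :=
    (continuous_norm.mul hk.continuous_gradient.norm).integrable_of_hasCompactSupport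
      (hk.hasCompactSupport_gradient.norm.mul_left)
  have hki : Integrable k := hk.1.continuous.integrable_of_hasCompactSupport hk.2.1
  have hm1 : Measurable fun x : Plane => p (‖x‖ ^ 2) / ‖x‖ ^ 2 :=
    measurable_radial (f := fun t => p t / t) (hp.measurable.div measurable_id)
  have hm2 : Measurable fun x : Plane => f (‖x‖ ^ 2) := measurable_radial hf
  have I1 : Integrable fun x => p (‖x‖ ^ 2) / ‖x‖ ^ 2 * inner ℝ x (gradient k x) := by
    refine (hgi.const_mul K).mono' (hm1.aestronglyMeasurable.mul
      (continuous_id.inner hk.continuous_gradient).aestronglyMeasurable) (ae_of_all _ fun x => ?_)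
    rw [norm_mul]
    refine mul_le_mul ?_ (norm_inner_le_norm _ _) (norm_nonneg _) hK0
    rw [Real.norm_eq_abs, abs_div, abs_of_nonneg (by positivity : 0 ≤ ‖x‖ ^ 2)]
    exact div_le_of_le_mul₀ (by positivity) hK0 (hpK _ (by positivity))
  have I2 : Integrable fun x => 2 * f (‖x‖ ^ 2) * k x := by
    refine hki.bdd_mul (c := 2 * K) (measurable_const.mul hm2).aestronglyMeasurable
      (ae_of_all _ fun x => ?_)
    rw [norm_mul, Real.norm_two]
    exact mul_le_mul_of_nonneg_left (hK _) (by norm_num)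
  -- On the ray rθ, the integrand times r is the derivative of p(r²) k(rθ), which vanishes at r = 0
  -- because p(0) = 0 and at r = R because of the support of k.
  refine ⟨I1, I2, integral_eq_zero_of_rays (I1.add I2) fun θ hθ => ?_⟩
  set κ : ℝ → ℝ := fun r => k (r • θ)
  set κ' : ℝ → ℝ := fun r => inner ℝ (gradient k (r • θ)) θ
  have hκ : ∀ r, HasDerivAt κ (κ' r) r := by
    intro r
    have h1 := (hk.gradient_hasFDerivAt (r • θ)).comp_hasDerivAt r ((hasDerivAt_id r).smul_const θ)
    refine h1.congr_deriv ?_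
    simp [κ']
  have hκ'c : Continuous κ' :=
    (hk.continuous_gradient.comp (by fun_prop)).inner continuous_const
  have hnr : ∀ r : ℝ, 0 < r → ‖r • θ‖ = r := by
    intro r hr
    rw [norm_smul, hθ, mul_one, Real.norm_of_nonneg hr.le]
  have hpr : ∀ r ∈ Icc 0 R, p (r ^ 2) = p (0 ^ 2) + ∫ s in (0 : ℝ)..r, f (s ^ 2) * (2 * s) := by
    intro r hr
    have := intervalIntegral.integral_comp_mul_deriv_of_deriv_nonneg (a := 0) (b := r)
      (f := fun s : ℝ => s ^ 2) (f' := fun s => 2 * s) (g := f) (by fun_prop) ?_ ?_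
    · simp only [Function.comp] at this
      rw [this]
      simp [p]
    · intro x _
      simpa using hasDerivAt_pow 2 x
    · intro x hx
      rw [min_eq_left hr.1] at hx
      linarith [hx.1]
  have hfi : IntervalIntegrable (fun s => f (s ^ 2) * (2 * s)) volume 0 R :=
    (intervalIntegrable_of_bounded (f := fun s => f (s ^ 2)) (hf.comp (by fun_prop))
      (fun t => hK _) _ _).mul_continuousOn (by fun_prop)
  have hparts := integral_mul_primitive_add (F := fun r => p (r ^ 2)) (G := κ) hR.le hfi
    (hκ'c.intervalIntegrable _ _) hpr (fun r _ => by
      rw [intervalIntegral.integral_eq_sub_of_hasDerivAt (fun x _ => hκ x)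
        (hκ'c.intervalIntegrable _ _)]
      ring)
  have hκR : κ R = 0 := by
    refine hk.apply_eq_zero ?_
    rw [Omega, Metric.mem_ball, dist_zero_right, hnr R hR]
    exact lt_irrefl _
  have hp0 : p (0 ^ 2) = 0 := by simp [p]
  simp only [hκR, hp0, mul_zero, zero_mul, sub_zero] at hparts
  refine Eq.trans ?_ hparts
  rw [intervalIntegral.integral_of_le hR.le, setIntegral_eq_of_subset_of_forall_sdiff_eq_zero measurableSet_Ioi
      (Ioc_subset_Ioi_self : Ioc 0 R ⊆ Ioi 0)]
  · refine setIntegral_congr_fun measurableSet_Ioc fun r hr => ?_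
    have hr0 : 0 < r := hr.1
    simp only [κ, κ', hnr r hr0, inner_smul_left, real_inner_comm θ]
    simp only [conj_trivial]
    field_simp
    ring
  · intro r hr
    have hr0 : 0 < r := hr.1
    have hrR : R < r := by
      by_contra h
      exact hr.2 ⟨hr0, not_lt.1 h⟩
    have hn : r • θ ∉ Omega R := by
      rw [Omega, Metric.mem_ball, dist_zero_right, hnr r hr0]
      exact not_lt.2 hrR.le
    rw [hk.apply_eq_zero hn, gradient_eq_zero_of_notMem_tsupport fun h => hn (hk.2.2 h)]
    simp

lemma setIntegral_muOmega_eq {R : ℝ} {F : Plane → ℝ} (h : ∀ x, x ∉ Omega R → F x = 0) :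
    ∫ x, F x ∂(muOmega R) = ∫ x, F x :=
  setIntegral_eq_integral_of_forall_compl_eq_zero h

lemma IsTest.sq {R : ℝ} {φ : Plane → ℝ} (hφ : IsTest R φ) :
    IsTest R (fun x => φ x ^ 2) ∧ ∀ x, gradient (fun x => φ x ^ 2) x = (2 * φ x) • gradient φ x := by
  have hs : tsupport (fun x => φ x ^ 2) ⊆ tsupport φ := by
    refine closure_mono fun x hx h => hx ?_
    simp [h]
  refine ⟨⟨hφ.1.pow 2, hφ.2.1.of_isClosed_subset (isClosed_tsupport _) hs, hs.trans hφ.2.2⟩,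
    fun x => ?_⟩
  refine HasGradientAt.gradient ?_
  have := (hφ.gradient_hasFDerivAt x).pow 2
  refine this.congr_fderiv ?_
  ext y
  simp

/-- The primitive of a certificate. -/
lemma flux_div_two_mul_sol {q : ℝ → ℝ} {B τ : ℝ} (hq : Measurable q) (hB : ∀ t, |q t| ≤ B)
    (hpos : ∀ t ∈ Icc 0 τ, 0 < sol q t) {t : ℝ} (ht : t ∈ Icc 0 τ) :
    flux q t / (2 * sol q t)
      = ∫ s in (0 : ℝ)..t, (q s / 2 + (flux q s / (2 * sol q s)) ^ 2 / (2 * s)) := by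
  have hcs := continuous_sol hq hB
  have hG : ∀ r ∈ Icc 0 t, 1 / (2 * sol q r) = 1 / (2 * sol q 0)
      + ∫ s in (0 : ℝ)..r, flux q s / (4 * s) * (1 / (2 * sol q s ^ 2)) := by
    intro r hr
    have hne : ∀ s ∈ Icc 0 r, sol q s ≠ 0 := fun s hs =>
      (hpos s ⟨hs.1, hs.2.trans (hr.2.trans ht.2)⟩).ne'
    rw [intervalIntegral.integral_eq_sub_of_hasDerivAt_of_le (f := fun s => 1 / (2 * sol q s)) hr.1]
    · ring
    · exact continuousOn_const.div (by fun_prop) fun s hs => by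
        have := hne s hs
        positivity
    · intro s hs
      have h0 := hne s ⟨hs.1.le, hs.2.le⟩
      have hs0 : 0 < s := hs.1
      have h1 := ((sol_hasDerivAt hq hB hs0).const_mul 2).inv (by positivity)
      simp only [one_div]
      refine h1.congr_deriv ?_
      field_simp
    · refine (intervalIntegrable_flux_div hq hB hr.1).mul_continuousOn ?_
      rw [uIcc_of_le hr.1]
      exact continuousOn_const.div (by fun_prop) fun s hs => by
        have := hne s hs
        positivity
  have hgi : IntervalIntegrable (fun s => flux q s / (4 * s) * (1 / (2 * sol q s ^ 2))) volume 0 t := by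
    refine (intervalIntegrable_flux_div hq hB ht.1).mul_continuousOn ?_
    rw [uIcc_of_le ht.1]
    exact continuousOn_const.div (by fun_prop) fun s hs => by
      have := (hpos s ⟨hs.1, hs.2.trans ht.2⟩).ne'
      positivity
  -- With p = flux/(2u) = -2tu'/u, the field p x/|x|² is -∇ log u, and the product rule for p gives
  -- the Riccati expression q/2 + p²/(2t).
  have h := integral_mul_primitive_add ht.1 (intervalIntegrable_bounded_mul hq hB hcs 0 t) hgi
    (F := flux q) (G := fun s => 1 / (2 * sol q s)) (fun r _ => flux_sub_flux hq hB 0 r) hG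
  rw [flux_zero, zero_mul, sub_zero] at h
  rw [div_eq_mul_one_div, ← h]
  refine intervalIntegral.integral_congr fun s hs => ?_
  rw [uIcc_of_le ht.1] at hs
  have h0 := (hpos s ⟨hs.1, hs.2.trans ht.2⟩).ne'
  rcases hs.1.eq_or_lt with h00 | h00
  · subst h00
    simp
    field_simp
  · field_simp
    ring

/-- The flux is O(t), so its square over t stays bounded where u is bounded away from zero. -/
lemma abs_certificate_le {q : ℝ → ℝ} {B τ m : ℝ} (hτ0 : 0 ≤ τ) (hq : Measurable q)
    (hB : ∀ t, |q t| ≤ B) (hm : 0 < m) (hmin : ∀ t ∈ Icc 0 τ, m ≤ sol q t) {t : ℝ}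
    (ht : t ∈ Icc 0 τ) :
    |q t / 2 + (flux q t / (2 * sol q t)) ^ 2 / (2 * t)|
      ≤ B / 2 + ((B * (2 * Real.exp (B * τ))) ^ 2 * τ) / (8 * m ^ 2) := by
  set C := B * (2 * Real.exp (B * τ))
  refine (abs_add_le _ _).trans (add_le_add ?_ ?_)
  · rw [abs_div, abs_two]
    gcongr
    exact hB t
  · have h1 : |flux q t| ≤ C * t := abs_flux_le hq hB hτ0 ht
    have h2 : m ≤ sol q t := hmin t ht
    have h3 : 0 ≤ t := ht.1
    have h4 : flux q t ^ 2 ≤ (C * t) ^ 2 := by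
      rw [← sq_abs]
      exact pow_le_pow_left₀ (abs_nonneg _) h1 2
    rw [abs_of_nonneg (by positivity)]
    rcases h3.eq_or_lt with h0 | h0
    · rw [← h0, mul_zero, div_zero]
      positivity
    have h5 : 0 < sol q t := hm.trans_le h2
    rw [div_pow, div_div, div_le_div_iff₀ (by positivity) (by positivity)]
    calc flux q t ^ 2 * (8 * m ^ 2) ≤ (C * t) ^ 2 * (8 * sol q t ^ 2) := by gcongr
      _ = C ^ 2 * t * ((2 * sol q t) ^ 2 * (2 * t)) := by ring
      _ ≤ _ := by gcongr; exact ht.2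

/-- Picone's identity: with A = (p/|x|²) x the expression is |G + φA|². At x = 0 the quotients are 0
by convention and |G|² remains. -/
lemma picone_pointwise (x G : Plane) (p q φ : ℝ) :
    0 ≤ ‖G‖ ^ 2 - q * φ ^ 2 + (p / ‖x‖ ^ 2 * ((2 * φ) * inner ℝ x G)
      + 2 * (q / 2 + p ^ 2 / (2 * ‖x‖ ^ 2)) * φ ^ 2) := by
  rcases eq_or_ne x 0 with hx0 | hx0
  · subst hx0
    simp
    nlinarith [sq_nonneg ‖G‖]
  · have hn : 0 < ‖x‖ ^ 2 := by positivity
    have key := sq_nonneg ‖G + (φ * (p / ‖x‖ ^ 2)) • x‖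
    rw [norm_add_sq_real, inner_smul_right, norm_smul, mul_pow, Real.norm_eq_abs, sq_abs,
      real_inner_comm] at key
    have e3 : (φ * (p / ‖x‖ ^ 2)) ^ 2 * ‖x‖ ^ 2 = φ ^ 2 * (p ^ 2 / ‖x‖ ^ 2) := by
      field_simp
    rw [e3] at key
    have e4 : p ^ 2 / (2 * ‖x‖ ^ 2) = p ^ 2 / ‖x‖ ^ 2 / 2 := by field_simp
    rw [e4]
    linarith [key]

/-- The Riccati expression is extended by zero beyond τ, because `integral_radialField` asks for a
bound on the whole line. -/
lemma exists_certificate {q : ℝ → ℝ} {B τ : ℝ} (hτ0 : 0 ≤ τ) (hq : Measurable q)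
    (hB : ∀ t, |q t| ≤ B) (hpos : ∀ t ∈ Icc 0 τ, 0 < sol q t) :
    ∃ f : ℝ → ℝ, Measurable f ∧ (∃ K, ∀ t, |f t| ≤ K) ∧ ∀ t ∈ Icc 0 τ,
      f t = q t / 2 + (flux q t / (2 * sol q t)) ^ 2 / (2 * t) ∧
      ∫ s in (0 : ℝ)..t, f s = flux q t / (2 * sol q t) := by
  have hcs := continuous_sol hq hB
  have hcf := continuous_flux hq hB
  obtain ⟨x₀, hx₀, hmin⟩ := isCompact_Icc.exists_isMinOn (s := Icc 0 τ) ⟨0, le_rfl, hτ0⟩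
    hcs.continuousOn
  have hind : ∀ t ∈ Icc 0 τ, (Icc 0 τ).indicator
      (fun s => q s / 2 + (flux q s / (2 * sol q s)) ^ 2 / (2 * s)) t
      = q t / 2 + (flux q t / (2 * sol q t)) ^ 2 / (2 * t) := fun t ht => indicator_of_mem ht _
  refine ⟨(Icc 0 τ).indicator fun s => q s / 2 + (flux q s / (2 * sol q s)) ^ 2 / (2 * s), ?_,
    ⟨B / 2 + ((B * (2 * Real.exp (B * τ))) ^ 2 * τ) / (8 * sol q x₀ ^ 2), fun t => ?_⟩,
    fun t ht => ⟨hind t ht, ?_⟩⟩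
  · refine Measurable.indicator ?_ measurableSet_Icc
    exact (hq.div_const 2).add (((hcf.measurable.div (measurable_const.mul hcs.measurable)).pow_const
      2).div (measurable_const.mul measurable_id))
  · have hB0 : 0 ≤ B := (abs_nonneg _).trans (hB 0)
    by_cases ht : t ∈ Icc 0 τ
    · rw [hind t ht]
      exact abs_certificate_le hτ0 hq hB (hpos _ hx₀) (fun t ht => isMinOn_iff.1 hmin t ht) ht
    · rw [indicator_of_notMem ht, abs_zero]
      positivity
  · rw [flux_div_two_mul_sol hq hB hpos ht]
    refine intervalIntegral.integral_congr fun s hs => ?_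
    rw [uIcc_of_le ht.1] at hs
    exact hind s ⟨hs.1, hs.2.trans ht.2⟩

/-- Barta's inequality for test functions. -/
lemma IsTest.integral_le {R : ℝ} (hR : 0 < R) {q : ℝ → ℝ} {B : ℝ} (hq : Measurable q)
    (hB : ∀ t, |q t| ≤ B) (hpos : ∀ t ∈ Ico 0 (R ^ 2), 0 < sol q t) {φ : Plane → ℝ}
    (hφ : IsTest R φ) :
    ∫ x, radial q x * φ x ^ 2 ∂(muOmega R) ≤ ∫ x, ‖gradient φ x‖ ^ 2 ∂(muOmega R) := by
  -- The solution may vanish at R²; the support of φ stays in |x|² ≤ τ < R², where the solution has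
  -- a positive minimum.
  obtain ⟨τ, hτ0, hτR, hτ⟩ := hφ.exists_radius hR
  obtain ⟨f, hf, ⟨K, hK⟩, hfτ⟩ := exists_certificate hτ0.le hq hB
    fun t ht => hpos t ⟨ht.1, ht.2.trans_lt hτR⟩
  obtain ⟨I1, I2, h0⟩ := integral_radialField hR hf hK hφ.sq.1
  have hi : Integrable (fun x => φ x ^ 2) := by
    have hc : Continuous (fun x => φ x ^ 2) := hφ.1.continuous.pow 2
    exact hc.integrable_of_hasCompactSupport hφ.sq.1.2.1
  have hIq : Integrable fun x => radial q x * φ x ^ 2 := by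
    refine hi.bdd_mul (c := B) (measurable_radial hq).aestronglyMeasurable (ae_of_all _ fun x => ?_)
    exact hB _
  have hIg : Integrable fun x => ‖gradient φ x‖ ^ 2 := by
    have hc : Continuous (fun x => ‖gradient φ x‖ ^ 2) := hφ.continuous_gradient.norm.pow 2
    refine hc.integrable_of_hasCompactSupport ?_
    refine HasCompactSupport.of_support_subset_isCompact hφ.2.1 fun x hx => ?_
    by_contra h
    refine hx ?_
    simp only
    rw [gradient_eq_zero_of_notMem_tsupport h, norm_zero]
    norm_num
  have e1 : ∫ x, radial q x * φ x ^ 2 ∂(muOmega R) = ∫ x, radial q x * φ x ^ 2 :=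
    setIntegral_muOmega_eq fun x hx => by rw [hφ.apply_eq_zero hx]; ring
  have e2 : ∫ x, ‖gradient φ x‖ ^ 2 ∂(muOmega R) = ∫ x, ‖gradient φ x‖ ^ 2 :=
    setIntegral_muOmega_eq fun x hx => by
      rw [gradient_eq_zero_of_notMem_tsupport fun h => hx (hφ.2.2 h), norm_zero]; ring
  rw [e1, e2]
  -- The added bracket is the divergence of φ²A, with integral zero; after the addition the
  -- integrand is nonnegative by Picone.
  have h1 : 0 ≤ ∫ x, (‖gradient φ x‖ ^ 2 - radial q x * φ x ^ 2
      + ((∫ s in (0 : ℝ)..‖x‖ ^ 2, f s) / ‖x‖ ^ 2 * inner ℝ x (gradient (fun x => φ x ^ 2) x)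
      + 2 * f (‖x‖ ^ 2) * φ x ^ 2)) := by
    refine integral_nonneg fun x => ?_
    simp only [Pi.zero_apply, hφ.sq.2 x, inner_smul_right]
    by_cases hx : ‖x‖ ^ 2 ≤ τ
    · obtain ⟨e1, e2⟩ := hfτ (‖x‖ ^ 2) ⟨by positivity, hx⟩
      rw [e1, e2]
      exact picone_pointwise x (gradient φ x) _ _ _
    · have hx' := hτ x (not_le.1 hx)
      have : φ x = 0 := image_eq_zero_of_notMem_tsupport hx'
      simp [this]
  have J1 : Integrable (fun x => ‖gradient φ x‖ ^ 2 - radial q x * φ x ^ 2) := hIg.sub hIq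
  have J2 : Integrable (fun x => (∫ s in (0 : ℝ)..‖x‖ ^ 2, f s) / ‖x‖ ^ 2 *
      inner ℝ x (gradient (fun x => φ x ^ 2) x) + 2 * f (‖x‖ ^ 2) * φ x ^ 2) := I1.add I2
  rw [integral_add J1 J2, h0, integral_sub hIg hIq] at h1
  linarith

lemma memLp_bdd_mul {R b : ℝ} {w u : Plane → ℝ} (hw : AEStronglyMeasurable w (muOmega R))
    (hb : ∀ᵐ x ∂(muOmega R), |w x| ≤ b) (hu : MemLp u 2 (muOmega R)) :
    MemLp (fun x => w x * u x) 2 (muOmega R) := by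
  refine MemLp.of_le_mul (c := b) hu (hw.mul hu.1) ?_
  filter_upwards [hb] with x hx
  rw [norm_mul]
  gcongr
  exact hx

lemma tendsto_bdd_mul {R b : ℝ} {w u : Plane → ℝ} {φ : ℕ → Plane → ℝ}
    (hb : ∀ᵐ x ∂(muOmega R), |w x| ≤ b)
    (h : Tendsto (fun k => eLpNorm (fun x => φ k x - u x) 2 (muOmega R)) atTop (𝓝 0)) :
    Tendsto (fun k => eLpNorm (fun x => w x * φ k x - w x * u x) 2 (muOmega R)) atTop (𝓝 0) := by
  have hbound : ∀ k, eLpNorm (fun x => w x * φ k x - w x * u x) 2 (muOmega R)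
      ≤ ENNReal.ofReal b * eLpNorm (fun x => φ k x - u x) 2 (muOmega R) := by
    intro k
    refine eLpNorm_le_mul_eLpNorm_of_ae_le_mul ?_ 2
    filter_upwards [hb] with x hx
    rw [← mul_sub, norm_mul]
    gcongr
    exact hx
  refine tendsto_of_tendsto_of_tendsto_of_le_of_le tendsto_const_nhds ?_ (fun _ => zero_le) hbound
  simpa using ENNReal.Tendsto.const_mul h (a := ENNReal.ofReal b) (Or.inr ENNReal.ofReal_ne_top)

/-- Both sides are continuous for convergence of functions and gradients in L², so the inequality
passes to the closure of the test functions. -/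
lemma MemW12Zero.le_energy {R b : ℝ} {w u : Plane → ℝ} {G : Plane → Plane}
    (hw : AEStronglyMeasurable w (muOmega R)) (hb : ∀ᵐ x ∂(muOmega R), |w x| ≤ b)
    (hu : MemW12Zero R u G)
    (h : ∀ φ, IsTest R φ →
      ∫ x, w x * φ x ^ 2 ∂(muOmega R) ≤ ∫ x, ‖gradient φ x‖ ^ 2 ∂(muOmega R)) :
    ∫ x, w x * u x ^ 2 ∂(muOmega R) ≤ ∫ x, ‖G x‖ ^ 2 ∂(muOmega R) := by
  obtain ⟨hu, hG, φ, hφ, h1, h2⟩ := hu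
  have t1 := tendsto_integral_inner_of_tendsto (fun k => (hφ k).memLp_gradient)
    (fun k => (hφ k).memLp_gradient) hG hG h2 h2
  have t2 := tendsto_integral_inner_of_tendsto (fun k => (hφ k).memLp)
    (fun k => memLp_bdd_mul hw hb (hφ k).memLp) hu (memLp_bdd_mul hw hb hu) h1
    (tendsto_bdd_mul hb h1)
  simp only [real_inner_self_eq_norm_sq] at t1
  have e : ∀ a c : ℝ, inner ℝ a (c * a) = c * a ^ 2 := by
    intro a c
    simp
    ring
  simp only [e] at t2
  exact le_of_tendsto_of_tendsto' t2 t1 fun k => h _ (hφ k)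

lemma integrable_mul_sq {R b : ℝ} {w u : Plane → ℝ} (hw : AEStronglyMeasurable w (muOmega R))
    (hb : ∀ᵐ x ∂(muOmega R), |w x| ≤ b) (hu : MemLp u 2 (muOmega R)) :
    Integrable (fun x => w x * u x ^ 2) (muOmega R) :=
  hu.integrable_sq.bdd_mul hw (by simpa using hb)

lemma neg_le_energy {R b : ℝ} {V u : Plane → ℝ} {G : Plane → Plane}
    (hV : AEStronglyMeasurable V (muOmega R)) (hb : ∀ᵐ x ∂(muOmega R), |V x| ≤ b)
    (hu : MemW12Zero R u G) (hn : ∫ x, u x ^ 2 ∂(muOmega R) = 1) :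
    -b ≤ (∫ x, ‖G x‖ ^ 2 ∂(muOmega R)) - ∫ x, V x * u x ^ 2 ∂(muOmega R) := by
  have h1 : 0 ≤ ∫ x, ‖G x‖ ^ 2 ∂(muOmega R) := integral_nonneg fun x => by positivity
  have h2 : ∫ x, V x * u x ^ 2 ∂(muOmega R) ≤ ∫ x, b * u x ^ 2 ∂(muOmega R) := by
    refine integral_mono_ae (integrable_mul_sq hV hb hu.1) (hu.1.integrable_sq.const_mul b) ?_
    filter_upwards [hb] with x hx
    exact mul_le_mul_of_nonneg_right ((le_abs_self _).trans hx) (sq_nonneg _)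
  rw [integral_const_mul, hn] at h2
  linarith

lemma firstEigenvalue_le {R b : ℝ} {V u : Plane → ℝ} {G : Plane → Plane}
    (hV : AEStronglyMeasurable V (muOmega R)) (hb : ∀ᵐ x ∂(muOmega R), |V x| ≤ b)
    (hu : MemW12Zero R u G) (hn : ∫ x, u x ^ 2 ∂(muOmega R) = 1) :
    firstEigenvalue R V ≤ (∫ x, ‖G x‖ ^ 2 ∂(muOmega R)) - ∫ x, V x * u x ^ 2 ∂(muOmega R) := by
  refine csInf_le ⟨-b, ?_⟩ ⟨u, G, hu, hn, rfl⟩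
  rintro E ⟨u, G, hu, hn, rfl⟩
  exact neg_le_energy hV hb hu hn

lemma firstEigenvalue_congr {R : ℝ} {V W : Plane → ℝ} (h : V =ᵐ[muOmega R] W) :
    firstEigenvalue R V = firstEigenvalue R W := by
  have e : ∀ u : Plane → ℝ, ∫ x, V x * u x ^ 2 ∂(muOmega R) = ∫ x, W x * u x ^ 2 ∂(muOmega R) :=
    fun u => integral_congr_ae (by filter_upwards [h] with x hx; rw [hx])
  simp only [firstEigenvalue, e]

/-! ### Rayleigh quotients of radial trial functions and radial eigenfunctions. -/

section Radial

variable {R b K : ℝ} {v g : ℝ → ℝ}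

lemma abs_radial_le (hb : ∀ t, |v t| ≤ b) : ∀ᵐ x ∂(muOmega R), |radial v x| ≤ b :=
  ae_of_all _ fun x => hb (‖x‖ ^ 2)

lemma integral_sq_radial_tail (hR : 0 < R) (hg : Measurable g) (hK : ∀ t, |g t| ≤ K) :
    ∫ x, radial (tail (R ^ 2) g) x ^ 2 ∂(muOmega R)
      = Real.pi * ∫ t in (0 : ℝ)..R ^ 2, tail (R ^ 2) g t ^ 2 :=
  integral_radial hR ((continuous_tail hg hK).pow 2).measurable

lemma integral_norm_sq_radial_grad (hR : 0 < R) (hg : Measurable g) :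
    ∫ x : Plane, ‖(2 * g (‖x‖ ^ 2)) • x‖ ^ 2 ∂(muOmega R)
      = Real.pi * ∫ t in (0 : ℝ)..R ^ 2, 4 * t * g t ^ 2 := by
  have h := integral_radial hR (f := fun t => 4 * t * g t ^ 2)
    ((measurable_const.mul measurable_id).mul (hg.pow_const 2))
  refine Eq.trans ?_ h
  refine integral_congr_ae (ae_of_all _ fun x => ?_)
  simp only [radial, norm_smul, mul_pow, Real.norm_eq_abs, sq_abs]
  ring

lemma tail_const_mul (T c : ℝ) (g : ℝ → ℝ) (t : ℝ) :
    tail T (fun s => c * g s) t = c * tail T g t := by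
  simp [tail]

lemma eq_inv_sqrt_mul {I : ℝ} (hI : 0 < I) : (1 / √I) ^ 2 * I = 1 := by
  rw [div_pow, Real.sq_sqrt hI.le]
  field_simp

/-- The Rayleigh quotient bound for radial trial functions. -/
lemma firstEigenvalue_mul_le (hR : 0 < R) (hv : Measurable v) (hb : ∀ t, |v t| ≤ b)
    (hg : Measurable g) (hK : ∀ t, |g t| ≤ K) :
    firstEigenvalue R (radial v) * ∫ t in (0 : ℝ)..R ^ 2, tail (R ^ 2) g t ^ 2
      ≤ (∫ t in (0 : ℝ)..R ^ 2, 4 * t * g t ^ 2)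
        - ∫ t in (0 : ℝ)..R ^ 2, v t * tail (R ^ 2) g t ^ 2 := by
  have hT : 0 ≤ R ^ 2 := by positivity
  have hct := continuous_tail (T := R ^ 2) hg hK
  have hb0 : 0 ≤ b := (abs_nonneg _).trans (hb 0)
  set U := tail (R ^ 2) g
  set I := ∫ t in (0 : ℝ)..R ^ 2, U t ^ 2
  set D := ∫ t in (0 : ℝ)..R ^ 2, 4 * t * g t ^ 2
  have hI0 : 0 ≤ I := intervalIntegral.integral_nonneg hT fun t _ => sq_nonneg _
  have hD0 : 0 ≤ D := intervalIntegral.integral_nonneg hT fun t ht => by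
    have := ht.1
    positivity
  have hUi : IntervalIntegrable (fun t => U t ^ 2) volume 0 (R ^ 2) :=
    (hct.pow 2).intervalIntegrable _ _
  have hle : ∫ t in (0 : ℝ)..R ^ 2, v t * U t ^ 2 ≤ b * I := by
    rw [← intervalIntegral.integral_const_mul]
    refine intervalIntegral.integral_mono_on hT ?_ (hUi.const_mul b) fun t _ =>
      mul_le_mul_of_nonneg_right ((le_abs_self _).trans (hb t)) (sq_nonneg _)
    exact (intervalIntegrable_of_bounded hv hb _ _).mul_continuousOn (hct.pow 2).continuousOn
  -- A trial function of zero norm cannot be normalised; then the potential term is at most 0 and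
  -- the kinetic term is nonnegative.
  rcases hI0.eq_or_lt with hI | hI
  · rw [← hI] at hle ⊢
    linarith
  have hpi : 0 < Real.pi * I := by positivity
  set c := 1 / √(Real.pi * I)
  have hc : c ^ 2 * (Real.pi * I) = 1 := eq_inv_sqrt_mul hpi
  have hgc : Measurable fun s => c * g s := measurable_const.mul hg
  have hKc : ∀ t, |c * g t| ≤ |c| * K := fun t => by
    rw [abs_mul]
    gcongr
    exact hK t
  have hn : ∫ x, radial (tail (R ^ 2) fun s => c * g s) x ^ 2 ∂(muOmega R) = 1 := by
    rw [integral_sq_radial_tail hR hgc hKc]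
    simp only [tail_const_mul, mul_pow, intervalIntegral.integral_const_mul]
    rw [← hc]
    ring
  have h := firstEigenvalue_le (measurable_radial hv).aestronglyMeasurable (abs_radial_le hb)
    (memW12Zero_radial_tail hR hgc hKc) hn
  have e1 := integral_norm_sq_radial_grad hR hgc
  have e2 : ∫ x, radial v x * radial (tail (R ^ 2) fun s => c * g s) x ^ 2 ∂(muOmega R)
      = Real.pi * (c ^ 2 * ∫ t in (0 : ℝ)..R ^ 2, v t * U t ^ 2) := by
    have := integral_radial hR (f := fun t => v t * (tail (R ^ 2) (fun s => c * g s)) t ^ 2)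
      (hv.mul ((continuous_tail hgc hKc).pow 2).measurable)
    rw [← intervalIntegral.integral_const_mul]
    refine Eq.trans this ?_
    congr 2
    funext t
    rw [tail_const_mul]
    ring
  have e3 : ∫ t in (0 : ℝ)..R ^ 2, 4 * t * (c * g t) ^ 2 = c ^ 2 * D := by
    rw [← intervalIntegral.integral_const_mul]
    congr 1
    funext t
    ring
  rw [e1, e2, e3] at h
  have h' := mul_le_mul_of_nonneg_right h hI0
  have e4 : (Real.pi * (c ^ 2 * D) - Real.pi * (c ^ 2 * ∫ t in (0 : ℝ)..R ^ 2, v t * U t ^ 2)) * I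
      = (c ^ 2 * (Real.pi * I)) * (D - ∫ t in (0 : ℝ)..R ^ 2, v t * U t ^ 2) := by ring
  rwa [e4, hc, one_mul] at h'

lemma tail_neg_one {T t : ℝ} : tail T (fun _ => -1) t = T - t := by
  simp [tail]

/-- Barta's inequality: a positive solution bounds the first eigenvalue from below. -/
lemma le_firstEigenvalue_of_sol_pos (hR : 0 < R) (hv : Measurable v) (hb : ∀ t, |v t| ≤ b) {μ : ℝ}
    (hpos : ∀ t ∈ Ico 0 (R ^ 2), 0 < sol (fun t => v t + μ) t) :
    μ ≤ firstEigenvalue R (radial v) := by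
  have hq : Measurable fun t => v t + μ := hv.add_const μ
  have hB : ∀ t, |v t + μ| ≤ b + |μ| := fun t => (abs_add_le _ _).trans (by gcongr; exact hb t)
  refine le_csInf ?_ ?_
  -- `le_csInf` needs a nonempty set of energies; a normalised multiple of R² - |x|² provides an
  -- element.
  · have hT : 0 < R ^ 2 := by positivity
    have hI : 0 < ∫ t in (0 : ℝ)..R ^ 2, tail (R ^ 2) (fun _ => -1) t ^ 2 := by
      refine intervalIntegral.intervalIntegral_pos_of_pos_on ?_ ?_ hT
      · exact ((continuous_tail (K := 1) measurable_const (by simp)).pow 2).intervalIntegrable _ _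
      · intro t ht
        rw [tail_neg_one]
        have : 0 < R ^ 2 - t := by linarith [ht.2]
        positivity
    set I := ∫ t in (0 : ℝ)..R ^ 2, tail (R ^ 2) (fun _ => -1) t ^ 2
    set c := 1 / √(Real.pi * I)
    have hc : c ^ 2 * (Real.pi * I) = 1 := eq_inv_sqrt_mul (by positivity)
    have hKc : ∀ t : ℝ, |c * (-1 : ℝ)| ≤ |c| := fun t => by simp
    refine ⟨_, _, _, memW12Zero_radial_tail hR (g := fun _ => c * (-1)) measurable_const hKc, ?_, rfl⟩
    rw [integral_sq_radial_tail hR measurable_const hKc]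
    simp only [tail_const_mul, mul_pow, intervalIntegral.integral_const_mul]
    refine Eq.trans ?_ hc
    ring
  · rintro E ⟨u, G, hu, hn, rfl⟩
    have h := hu.le_energy (measurable_radial hq).aestronglyMeasurable (abs_radial_le hB)
      fun φ hφ => hφ.integral_le hR hq hB hpos
    have e : ∫ x, radial (fun t => v t + μ) x * u x ^ 2 ∂(muOmega R)
        = ∫ x, radial v x * u x ^ 2 ∂(muOmega R) + μ := by
      have e' : ∀ x, radial (fun t => v t + μ) x * u x ^ 2 = radial v x * u x ^ 2 + μ * u x ^ 2 :=
        fun x => add_mul _ _ _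
      simp only [e']
      rw [integral_add (integrable_mul_sq (measurable_radial hv).aestronglyMeasurable
        (abs_radial_le hb) hu.1) (hu.1.integrable_sq.const_mul μ), integral_const_mul, hn, mul_one]
    linarith

/-- The derivative of the solution, cut off outside `(0, T]`. -/
noncomputable def solDeriv (q : ℝ → ℝ) (T : ℝ) : ℝ → ℝ :=
  (Ioc 0 T).indicator fun s => -flux q s / (4 * s)

lemma measurable_solDeriv {q : ℝ → ℝ} {B : ℝ} (hq : Measurable q) (hB : ∀ t, |q t| ≤ B) (T : ℝ) :
    Measurable (solDeriv q T) :=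
  Measurable.indicator ((continuous_flux hq hB).measurable.neg.div
    (measurable_const.mul measurable_id)) measurableSet_Ioc

lemma abs_solDeriv_le {q : ℝ → ℝ} {B : ℝ} (hq : Measurable q) (hB : ∀ t, |q t| ≤ B) {T : ℝ}
    (hT : 0 ≤ T) (t : ℝ) : |solDeriv q T t| ≤ B * (2 * Real.exp (B * T)) / 4 := by
  have hB0 : 0 ≤ B := (abs_nonneg _).trans (hB 0)
  by_cases ht : t ∈ Ioc 0 T
  · rw [solDeriv, indicator_of_mem ht, neg_div, abs_neg]
    exact abs_flux_div_le hq hB hT ⟨ht.1.le, ht.2⟩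
  · rw [solDeriv, indicator_of_notMem ht, abs_zero]
    positivity

lemma solDeriv_of_mem {q : ℝ → ℝ} {T t : ℝ} (ht : t ∈ Ioc 0 T) :
    solDeriv q T t = -flux q t / (4 * t) := indicator_of_mem ht _

/-- Since u(t₀) = 0, the solution cut off at t₀ is a primitive of its cut-off derivative, hence an
admissible trial function even when t₀ < T. -/
lemma tail_solDeriv {q : ℝ → ℝ} {B : ℝ} (hq : Measurable q) (hB : ∀ t, |q t| ≤ B) {T t₀ : ℝ}
    (ht₀ : t₀ ≤ T) (h0 : sol q t₀ = 0) {t : ℝ} (ht : t ∈ Icc 0 t₀) :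
    tail T (solDeriv q t₀) t = sol q t := by
  have hi := fun a b => intervalIntegrable_of_bounded (measurable_solDeriv hq hB t₀)
    (abs_solDeriv_le hq hB (ht.1.trans ht.2)) a b
  have h1 : ∫ s in t₀..T, solDeriv q t₀ s = 0 := by
    refine intervalIntegral.integral_zero_ae (ae_of_all _ fun s hs => ?_)
    rw [uIoc_of_le ht₀] at hs
    exact indicator_of_notMem (fun h => absurd hs.1 (not_lt.2 h.2)) _
  have h2 : ∫ s in t..t₀, solDeriv q t₀ s = ∫ s in t..t₀, -flux q s / (4 * s) := by
    refine intervalIntegral.integral_congr_ae (ae_of_all _ fun s hs => ?_)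
    rw [uIoc_of_le ht.2] at hs
    exact solDeriv_of_mem ⟨ht.1.trans_lt hs.1, hs.2⟩
  rw [tail, ← intervalIntegral.integral_add_adjacent_intervals (hi t t₀) (hi t₀ T), h1, h2]
  have := sol_sub_sol hq hB ht.1 ht.2
  linarith

lemma tail_solDeriv_of_le {q : ℝ → ℝ} {T t₀ : ℝ} {t : ℝ} (ht : t₀ ≤ t) (htT : t ≤ T) :
    tail T (solDeriv q t₀) t = 0 := by
  rw [tail, neg_eq_zero]
  refine intervalIntegral.integral_zero_ae (ae_of_all _ fun s hs => ?_)
  rw [uIoc_of_le htT] at hs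
  exact indicator_of_notMem (fun h => absurd (ht.trans_lt hs.1) (not_lt.2 h.2)) _

/-- A normalised solution that vanishes at the boundary is an eigenfunction. -/
lemma isEigenfunction_of_sol {μ : ℝ} (hR : 0 < R) (hv : Measurable v) (hb : ∀ t, |v t| ≤ b)
    (hμ : firstEigenvalue R (radial v) = μ) (h0 : sol (fun t => v t + μ) (R ^ 2) = 0) {c : ℝ}
    (hc : c ^ 2 * (Real.pi * ∫ t in (0 : ℝ)..R ^ 2, sol (fun t => v t + μ) t ^ 2) = 1) :
    ∃ u, IsEigenfunction R (radial v) u ∧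
      ∀ x ∈ Omega R, u x = c * sol (fun t => v t + μ) (‖x‖ ^ 2) := by
  have hT : 0 ≤ R ^ 2 := by positivity
  set q : ℝ → ℝ := fun t => v t + μ
  have hq : Measurable q := hv.add_const μ
  have hB : ∀ t, |q t| ≤ b + |μ| := fun t => (abs_add_le _ _).trans (by gcongr; exact hb t)
  set g := solDeriv q (R ^ 2)
  have hg : Measurable g := measurable_solDeriv hq hB _
  have hK := abs_solDeriv_le hq hB hT
  set K := (b + |μ|) * (2 * Real.exp ((b + |μ|) * R ^ 2)) / 4
  have hgc : Measurable fun s => c * g s := measurable_const.mul hg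
  have hKc : ∀ t, |c * g t| ≤ |c| * K := fun t => by
    rw [abs_mul]
    gcongr
    exact hK t
  have hU : ∀ t ∈ Icc 0 (R ^ 2), tail (R ^ 2) (fun s => c * g s) t = c * sol q t := fun t ht => by
    rw [tail_const_mul, tail_solDeriv hq hB le_rfl h0 ht]
  have hUx : ∀ x ∈ Omega R, radial (tail (R ^ 2) fun s => c * g s) x = c * sol q (‖x‖ ^ 2) :=
    fun x hx => hU _ ⟨by positivity, (normSq_mem_of_mem_Omega hx).le⟩
  refine ⟨_, ⟨_, memW12Zero_radial_tail hR hgc hKc, ?_, fun φ hφ => ?_⟩, hUx⟩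
  · have e : ∫ t in (0 : ℝ)..R ^ 2, tail (R ^ 2) (fun s => c * g s) t ^ 2
        = c ^ 2 * ∫ t in (0 : ℝ)..R ^ 2, sol q t ^ 2 := by
      rw [← intervalIntegral.integral_const_mul]
      refine intervalIntegral.integral_congr fun t ht => ?_
      rw [uIcc_of_le hT] at ht
      simp only [hU t ht]
      ring
    rw [integral_sq_radial_tail hR hgc hKc, e]
    refine Eq.trans ?_ hc
    ring
  -- For f = qu the primitive is the flux, and flux · x/|x|² = -2∇u, so `integral_radialField` is
  -- the weak equation up to a factor.
  · set f : ℝ → ℝ := (Icc 0 (R ^ 2)).indicator fun s => q s * sol q s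
    have hf : Measurable f :=
      (hq.mul (continuous_sol hq hB).measurable).indicator measurableSet_Icc
    have hfK : ∀ t, |f t| ≤ (b + |μ|) * (2 * Real.exp ((b + |μ|) * R ^ 2)) := by
      intro t
      have hb0 : 0 ≤ b + |μ| := (abs_nonneg _).trans (hB 0)
      by_cases ht : t ∈ Icc 0 (R ^ 2)
      · simp only [f, indicator_of_mem ht, abs_mul]
        exact mul_le_mul (hB t) (abs_sol_le hq hB hT ht) (abs_nonneg _) hb0
      · simp only [f, indicator_of_notMem ht, abs_zero]
        positivity
    obtain ⟨I1, I2, h⟩ := integral_radialField hR hf hfK hφ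
    rw [integral_add I1 I2] at h
    have e1 : ∫ x, inner ℝ ((2 * (c * g (‖x‖ ^ 2))) • x) (gradient φ x) ∂(muOmega R)
        = (-(c / 2)) * ∫ x, (∫ s in (0 : ℝ)..‖x‖ ^ 2, f s) / ‖x‖ ^ 2 * inner ℝ x (gradient φ x) := by
      rw [← integral_const_mul, ← setIntegral_muOmega_eq (R := R)]
      · refine integral_congr_ae ?_
        filter_upwards [ae_mem_Omega R] with x hx
        have hx' := normSq_mem_of_mem_Omega hx
        rw [inner_smul_left, conj_trivial]
        rcases eq_or_ne x 0 with hx0 | hx0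
        · simp [hx0]
        have hn : 0 < ‖x‖ ^ 2 := by positivity
        have ef : (∫ s in (0 : ℝ)..‖x‖ ^ 2, f s) = flux q (‖x‖ ^ 2) := by
          refine intervalIntegral.integral_congr fun s hs => ?_
          rw [uIcc_of_le hn.le] at hs
          exact indicator_of_mem (show s ∈ Icc 0 (R ^ 2) from ⟨hs.1, hs.2.trans hx'.le⟩) _
        rw [ef, show g (‖x‖ ^ 2) = _ from solDeriv_of_mem ⟨hn, hx'.le⟩]
        field_simp
        ring
      · intro x hx
        rw [gradient_eq_zero_of_notMem_tsupport fun h => hx (hφ.2.2 h)]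
        simp
    have e2 : ∫ x, 2 * f (‖x‖ ^ 2) * φ x
        = ∫ x, 2 * (q (‖x‖ ^ 2) * sol q (‖x‖ ^ 2)) * φ x ∂(muOmega R) := by
      rw [← setIntegral_muOmega_eq (R := R)]
      · refine integral_congr_ae ?_
        filter_upwards [ae_mem_Omega R] with x hx
        have : f (‖x‖ ^ 2) = q (‖x‖ ^ 2) * sol q (‖x‖ ^ 2) :=
          indicator_of_mem (show ‖x‖ ^ 2 ∈ Icc 0 (R ^ 2) from
            ⟨by positivity, (normSq_mem_of_mem_Omega hx).le⟩) _
        rw [this]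
      · intro x hx
        rw [hφ.apply_eq_zero hx, mul_zero]
    set U := radial (tail (R ^ 2) fun s => c * g s)
    have hUL := (memW12Zero_radial_tail hR hgc hKc).1
    have J1 : Integrable (fun x => U x * φ x) (muOmega R) := hUL.integrable_mul hφ.memLp
    have J2 : Integrable (fun x => radial v x * U x * φ x) (muOmega R) := by
      have := J1.bdd_mul (c := b) (measurable_radial hv).aestronglyMeasurable
        (ae_of_all _ fun x => hb (‖x‖ ^ 2))
      simpa only [mul_assoc] using this
    have e3 : c * ∫ x, 2 * (q (‖x‖ ^ 2) * sol q (‖x‖ ^ 2)) * φ x ∂(muOmega R)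
        = 2 * (∫ x, radial v x * U x * φ x ∂(muOmega R)) + 2 * (μ * ∫ x, U x * φ x ∂(muOmega R)) := by
      rw [← integral_const_mul, ← integral_const_mul, ← integral_const_mul, ← integral_const_mul,
        ← integral_add (J2.const_mul 2) ((J1.const_mul μ).const_mul 2)]
      refine integral_congr_ae ?_
      filter_upwards [ae_mem_Omega R] with x hx
      rw [hUx x hx, radial]
      simp only [q]
      ring
    rw [e1, hμ]
    rw [e2] at h
    linear_combination (-(c / 2)) * h + (1 / 2) * e3

end Radial

/-- Every eigenfunction is a minimiser of the Rayleigh quotient. -/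
lemma IsEigenfunction.energy_eq {R b : ℝ} {V u : Plane → ℝ} (hV : AEStronglyMeasurable V (muOmega R))
    (hb : ∀ᵐ x ∂(muOmega R), |V x| ≤ b) (hu : IsEigenfunction R V u) :
    ∃ G, MemW12Zero R u G ∧ (∫ x, u x ^ 2 ∂(muOmega R)) = 1 ∧
      (∫ x, ‖G x‖ ^ 2 ∂(muOmega R)) - ∫ x, V x * u x ^ 2 ∂(muOmega R) = firstEigenvalue R V := by
  obtain ⟨G, hm, hn, hw⟩ := hu
  refine ⟨G, hm, hn, ?_⟩
  obtain ⟨hu, hG, φ, hφ, h1, h2⟩ := hm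
  have hconst : ∀ {E : Type} [NormedAddCommGroup E] (f : Plane → E),
      Tendsto (fun _ : ℕ => eLpNorm (fun x => f x - f x) 2 (muOmega R)) atTop (𝓝 0) := by
    intro E _ f
    simp
  have t1 := tendsto_integral_inner_of_tendsto (fun _ => hG) (fun k => (hφ k).memLp_gradient) hG hG
    (hconst G) h2
  have hVu := memLp_bdd_mul hV hb hu
  have t2 := tendsto_integral_inner_of_tendsto (fun _ => hVu) (fun k => (hφ k).memLp) hVu hu
    (hconst _) h1
  have t3 := tendsto_integral_inner_of_tendsto (fun _ => hu) (fun k => (hφ k).memLp) hu hu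
    (hconst _) h1
  have e : ∀ a c : ℝ, inner ℝ a c = a * c := by
    intro a c
    simp
    ring
  simp only [e] at t2 t3
  simp only [real_inner_self_eq_norm_sq] at t1
  -- The weak equation for φ_k, in the limit φ_k → u, is the equation tested with u itself.
  have t4 := (t1.sub t2).congr fun k => hw (φ k) (hφ k)
  have t5 := tendsto_nhds_unique t4 (t3.const_mul (firstEigenvalue R V))
  have e1 : ∫ x, u x * u x ∂(muOmega R) = 1 := by
    rw [← hn]
    congr 1
    funext x
    ring
  have e2 : ∫ x, V x * u x * u x ∂(muOmega R) = ∫ x, V x * u x ^ 2 ∂(muOmega R) := by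
    congr 1
    funext x
    ring
  rw [e1, e2, mul_one] at t5
  exact t5

/-! ### Energy, monotonicity and first zero of a solution. -/

section Solution

variable {q : ℝ → ℝ} {B : ℝ}

lemma intervalIntegrable_neg_flux_div (hq : Measurable q) (hB : ∀ t, |q t| ≤ B) {a b : ℝ}
    (ha : 0 ≤ a) (hab : a ≤ b) :
    IntervalIntegrable (fun s => -flux q s / (4 * s)) volume a b :=
  ((intervalIntegrable_flux_div hq hB ha).symm.trans
    (intervalIntegrable_flux_div hq hB (ha.trans hab))).neg.congr
    fun _ _ => (neg_div _ _).symm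

/-- The equation multiplied by u and integrated by parts; as the flux is -4tu', the boundary terms
are flux times u. -/
lemma integral_energy_sol (hq : Measurable q) (hB : ∀ t, |q t| ≤ B) {a b : ℝ} (ha : 0 ≤ a)
    (hab : a ≤ b) : ∫ s in a..b, 4 * s * (-flux q s / (4 * s)) ^ 2
      = (∫ s in a..b, q s * sol q s ^ 2) - (flux q b * sol q b - flux q a * sol q a) := by
  have hcs := continuous_sol hq hB
  have hi1 := intervalIntegrable_bounded_mul hq hB hcs a b
  have hi3 := intervalIntegrable_neg_flux_div hq hB ha hab
  have h := integral_mul_primitive_add hab hi1 hi3 (fun t _ => flux_sub_flux hq hB a t)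
    (fun t ht => sol_sub_sol hq hB ha ht.1)
  have e : ∀ s ∈ uIcc a b, q s * sol q s * sol q s + flux q s * (-flux q s / (4 * s))
      = q s * sol q s ^ 2 - 4 * s * (-flux q s / (4 * s)) ^ 2 := by
    intro s _
    rcases eq_or_ne s 0 with hs | hs
    · subst hs
      simp
      ring
    · field_simp
      ring
  rw [intervalIntegral.integral_congr e, intervalIntegral.integral_sub] at h
  · linarith
  · exact intervalIntegrable_bounded_mul hq hB (hcs.pow 2) a b
  · have h1 := hi3.continuousOn_mul (continuous_flux hq hB).continuousOn
    refine (h1.neg).congr fun s _ => ?_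
    rcases eq_or_ne s 0 with hs | hs
    · subst hs
      simp
    · simp only [Pi.neg_apply]
      field_simp

lemma sol_lt_sol (hq : Measurable q) (hB : ∀ t, |q t| ≤ B) {a b : ℝ} (ha : 0 ≤ a) (hab : a < b)
    (h : ∀ s ∈ Ioo a b, 0 < flux q s) : sol q b < sol q a := by
  rw [sol_sub_sol hq hB ha hab.le]
  have : 0 < ∫ s in a..b, flux q s / (4 * s) := by
    refine intervalIntegral.intervalIntegral_pos_of_pos_on ?_ (fun s hs => ?_) hab
    · exact (intervalIntegrable_flux_div hq hB ha).symm.trans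
        (intervalIntegrable_flux_div hq hB (ha.trans hab.le))
    · have := h s hs
      have : 0 < s := ha.trans_lt hs.1
      positivity
  simp only [neg_div, intervalIntegral.integral_neg]
  linarith

lemma sol_gt_of_flux_neg (hq : Measurable q) (hB : ∀ t, |q t| ≤ B) {a b : ℝ} (ha : 0 ≤ a)
    (hab : a < b) (h : ∀ s ∈ Ioo a b, flux q s < 0) : sol q a < sol q b := by
  rw [sol_sub_sol hq hB ha hab.le]
  have : 0 < ∫ s in a..b, -flux q s / (4 * s) := by
    refine intervalIntegral.intervalIntegral_pos_of_pos_on ?_ (fun s hs => ?_) hab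
    · exact intervalIntegrable_neg_flux_div hq hB ha hab.le
    · have := h s hs
      have : 0 < s := ha.trans_lt hs.1
      exact div_pos (by linarith) (by positivity)
  linarith

/-- Unique continuation: the Cauchy data of the solution do not vanish where it first vanishes. -/
lemma flux_pos_of_first_zero (hq : Measurable q) (hB : ∀ t, |q t| ≤ B) {t₀ : ℝ} (ht₀ : 0 < t₀)
    (h0 : sol q t₀ = 0) (hpos : ∀ t ∈ Ico 0 t₀, 0 < sol q t) : 0 < flux q t₀ := by
  have hcs := continuous_sol hq hB
  have hcf := continuous_flux hq hB
  have hB0 : 0 ≤ B := (abs_nonneg _).trans (hB 0)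
  rcases lt_trichotomy (flux q t₀) 0 with hneg | hzero | hp
  · exfalso
    obtain ⟨l, hl, hlt⟩ : ∃ l < t₀, Ioc l t₀ ⊆ {t | flux q t < 0} :=
      exists_Ioc_subset_of_mem_nhds (hcf.continuousAt.eventually_lt continuousAt_const hneg) ⟨0, ht₀⟩
    have h1 := sol_gt_of_flux_neg hq hB (a := max l 0) (b := t₀) (le_max_right _ _)
      (max_lt hl ht₀) fun s hs => hlt ⟨(le_max_left _ _).trans_lt hs.1, hs.2.le⟩
    have h2 := hpos (max l 0) ⟨le_max_right _ _, max_lt hl ht₀⟩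
    linarith
  · exfalso
    -- On [t₀ - η, t₀], zero flux at t₀ gives |flux| ≤ BMη with M the maximum of u. There s ≥ η
    -- because η ≤ t₀/2, so |u'| ≤ BM/4. As u(t₀) = 0 and Bη ≤ 1, this forces M ≤ M/4.
    set η := min (t₀ / 2) (1 / (B + 1))
    have hη : 0 < η := by positivity
    have hη1 : η ≤ t₀ / 2 := min_le_left _ _
    have hη2 : η * (B + 1) ≤ 1 := by
      rw [← le_div_iff₀ (by positivity)]
      exact min_le_right _ _
    set a := t₀ - η
    have ha : 0 < a := by simp only [a]; linarith
    have hat : a ≤ t₀ := by simp only [a]; linarith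
    obtain ⟨x, hx, hmax⟩ := isCompact_Icc.exists_isMaxOn (s := Icc a t₀) ⟨a, le_rfl, hat⟩
      hcs.continuousOn
    set M := sol q x
    have hM : ∀ s ∈ Icc a t₀, sol q s ≤ M := fun s hs => isMaxOn_iff.1 hmax s hs
    have hMpos : 0 < M := (hpos a ⟨ha.le, by simp only [a]; linarith⟩).trans_le (hM a ⟨le_rfl, hat⟩)
    have hfl : ∀ s ∈ Icc a t₀, |flux q s| ≤ B * M * η := by
      intro s hs
      have h1 := flux_sub_flux hq hB s t₀
      rw [hzero] at h1
      have h2 := intervalIntegral.norm_integral_le_of_norm_le_const (a := s) (b := t₀)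
        (f := fun σ => q σ * sol q σ) (C := B * M) ?_
      · have h3 : flux q s = -∫ σ in s..t₀, q σ * sol q σ := by linarith
        rw [h3, abs_neg]
        refine h2.trans ?_
        rw [abs_of_nonneg (by linarith [hs.2])]
        gcongr
        have := hs.1
        simp only [a] at this
        linarith
      · intro σ hσ
        rw [uIoc_of_le hs.2] at hσ
        have h4 : σ ∈ Icc a t₀ := ⟨hs.1.trans hσ.1.le, hσ.2⟩
        have h5 : 0 ≤ sol q σ := by
          rcases hσ.2.eq_or_lt with h | h
          · rw [h, h0]
          · exact (hpos σ ⟨ha.le.trans h4.1, h⟩).le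
        rw [norm_mul, Real.norm_eq_abs, Real.norm_eq_abs, abs_of_nonneg h5]
        exact mul_le_mul (hB σ) (hM σ h4) h5 hB0
    have h6 := sol_sub_sol hq hB (ha.le.trans hx.1) hx.2
    have h7 := intervalIntegral.norm_integral_le_of_norm_le_const (a := x) (b := t₀)
      (f := fun s => -flux q s / (4 * s)) (C := B * M * η / (4 * η)) ?_
    · rw [h0] at h6
      have h8 : M = -∫ s in x..t₀, -flux q s / (4 * s) := by linarith
      have h9 : M ≤ B * M * η / (4 * η) * |t₀ - x| := by
        calc M ≤ |M| := le_abs_self _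
          _ = ‖∫ s in x..t₀, -flux q s / (4 * s)‖ := by rw [h8, abs_neg, Real.norm_eq_abs]
          _ ≤ _ := h7
      have h10 : |t₀ - x| ≤ η := by
        rw [abs_of_nonneg (by linarith [hx.2])]
        have := hx.1
        simp only [a] at this
        linarith
      have h11 : B * M * η / (4 * η) = B * M / 4 := by field_simp
      rw [h11] at h9
      have h12 : B * M / 4 * |t₀ - x| ≤ B * M / 4 * η := by gcongr
      have h13 : M * (η * B) ≤ M * 1 := by
        gcongr
        nlinarith
      nlinarith
    · intro s hs
      rw [uIoc_of_le hx.2] at hs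
      have h8 : a ≤ s := hx.1.trans hs.1.le
      have h9 : η ≤ s := by simp only [a] at h8; linarith
      rw [norm_div, norm_neg, Real.norm_eq_abs, Real.norm_eq_abs, abs_of_pos (by linarith : 0 < 4 * s)]
      exact div_le_div₀ (by positivity) (hfl s ⟨h8, hs.2⟩) (by positivity) (by linarith)
  · exact hp

end Solution

/-! ### The ground state by shooting. -/

/-- The first eigenvalue of a radial potential `x ↦ v (|x|²)`. -/
noncomputable def eig (R : ℝ) (v : ℝ → ℝ) : ℝ := firstEigenvalue R (radial v)

/-- The potential `v + λ(v)` in the equation of the ground state. -/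
noncomputable def shiftedPot (R : ℝ) (v : ℝ → ℝ) : ℝ → ℝ := fun t => v t + eig R v

/-- The ground state, as a function of `|x|²`, normalised by the value `1` at the origin. -/
noncomputable def ground (R : ℝ) (v : ℝ → ℝ) : ℝ → ℝ := sol (shiftedPot R v)

section Eig

variable {R b : ℝ} {v w : ℝ → ℝ}

lemma abs_add_const_le (hb : ∀ t, |v t| ≤ b) (μ : ℝ) (t : ℝ) : |v t + μ| ≤ b + |μ| :=
  (abs_add_le _ _).trans (by gcongr; exact hb t)

lemma integral_eq_of_eq_zero {f : ℝ → ℝ} {t₀ T : ℝ} (h0 : 0 ≤ t₀) (hT : t₀ ≤ T)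
    (h : ∀ t ∈ Ioc t₀ T, f t = 0) : ∫ t in (0 : ℝ)..T, f t = ∫ t in (0 : ℝ)..t₀, f t := by
  rw [intervalIntegral.integral_of_le (h0.trans hT), intervalIntegral.integral_of_le h0]
  refine setIntegral_eq_of_subset_of_forall_sdiff_eq_zero measurableSet_Ioc
    (Ioc_subset_Ioc_right hT) fun t ht => h t ⟨?_, ht.1.2⟩
  by_contra h'
  exact ht.2 ⟨ht.1.1, not_lt.1 h'⟩

/-- A solution with a zero in `(0, R²]` bounds the first eigenvalue from above. -/
lemma eig_le_of_sol_eq_zero (hR : 0 < R) (hv : Measurable v) (hb : ∀ t, |v t| ≤ b) {μ t₀ : ℝ}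
    (ht₀ : 0 < t₀) (htR : t₀ ≤ R ^ 2) (h0 : sol (fun t => v t + μ) t₀ = 0) : eig R v ≤ μ := by
  have hq : Measurable fun t => v t + μ := hv.add_const μ
  have hB := abs_add_const_le hb μ
  set q : ℝ → ℝ := fun t => v t + μ
  have hcs := continuous_sol hq hB
  have h := firstEigenvalue_mul_le hR hv hb (measurable_solDeriv hq hB t₀)
    (abs_solDeriv_le hq hB ht₀.le)
  have hU : ∀ t ∈ Icc 0 t₀, tail (R ^ 2) (solDeriv q t₀) t = sol q t := fun t ht =>
    tail_solDeriv hq hB htR h0 ht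
  have hU' : ∀ t ∈ Ioc t₀ (R ^ 2), tail (R ^ 2) (solDeriv q t₀) t = 0 := fun t ht =>
    tail_solDeriv_of_le ht.1.le ht.2
  rw [integral_eq_of_eq_zero ht₀.le htR fun t ht => by rw [hU' t ht]; ring,
    integral_eq_of_eq_zero ht₀.le htR fun t ht => by
      rw [solDeriv, indicator_of_notMem fun h => absurd ht.1 (not_lt.2 h.2)]; ring,
    integral_eq_of_eq_zero ht₀.le htR fun t ht => by rw [hU' t ht]; ring] at h
  have e1 : ∫ t in (0 : ℝ)..t₀, tail (R ^ 2) (solDeriv q t₀) t ^ 2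
      = ∫ t in (0 : ℝ)..t₀, sol q t ^ 2 := by
    refine intervalIntegral.integral_congr fun t ht => ?_
    rw [uIcc_of_le ht₀.le] at ht
    simp only [hU t ht]
  have e2 : ∫ t in (0 : ℝ)..t₀, v t * tail (R ^ 2) (solDeriv q t₀) t ^ 2
      = ∫ t in (0 : ℝ)..t₀, v t * sol q t ^ 2 := by
    refine intervalIntegral.integral_congr fun t ht => ?_
    rw [uIcc_of_le ht₀.le] at ht
    simp only [hU t ht]
  have e3 : ∫ t in (0 : ℝ)..t₀, 4 * t * solDeriv q t₀ t ^ 2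
      = ∫ t in (0 : ℝ)..t₀, 4 * t * (-flux q t / (4 * t)) ^ 2 := by
    refine intervalIntegral.integral_congr_ae (ae_of_all _ fun t ht => ?_)
    rw [uIoc_of_le ht₀.le] at ht
    rw [solDeriv_of_mem ht]
  have hi1 : IntervalIntegrable (fun t => v t * sol q t ^ 2) volume 0 t₀ :=
    intervalIntegrable_bounded_mul hv hb (hcs.pow 2) _ _
  have hi2 : IntervalIntegrable (fun t => μ * sol q t ^ 2) volume 0 t₀ :=
    (Continuous.intervalIntegrable (by fun_prop) _ _)
  have e4 : ∫ t in (0 : ℝ)..t₀, q t * sol q t ^ 2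
      = (∫ t in (0 : ℝ)..t₀, v t * sol q t ^ 2) + μ * ∫ t in (0 : ℝ)..t₀, sol q t ^ 2 := by
    rw [← intervalIntegral.integral_const_mul, ← intervalIntegral.integral_add hi1 hi2]
    congr 1
    funext t
    simp only [q]
    ring
  -- The boundary terms vanish because flux(0) = 0 and u(t₀) = 0, so the cut-off solution has
  -- Rayleigh quotient μ.
  rw [e1, e2, e3, integral_energy_sol hq hB le_rfl ht₀.le, h0, flux_zero, e4] at h
  have hI : 0 < ∫ t in (0 : ℝ)..t₀, sol q t ^ 2 := by
    refine intervalIntegral.integral_pos ht₀ (hcs.pow 2).continuousOn (fun t _ => sq_nonneg _)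
      ⟨0, ⟨le_rfl, ht₀.le⟩, ?_⟩
    rw [sol_zero hq hB]
    norm_num
  refine le_of_mul_le_mul_right ?_ hI
  rw [eig]
  linarith

/-- Shifting the potential by a constant satisfies the √s condition because s ≤ √T √s. The shooting
argument perturbs μ in this way. -/
lemma abs_sol_sub_sol_le_of_const (hv : Measurable v) (hb : ∀ t, |v t| ≤ b) {T : ℝ} (hT : 0 ≤ T)
    (μ : ℝ) : ∃ C, 0 ≤ C ∧ ∀ ν, |ν - μ| ≤ 1 → ∀ t ∈ Icc 0 T,
      |sol (fun t => v t + ν) t - sol (fun t => v t + μ) t| ≤ C * |ν - μ| := by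
  set B := b + (|μ| + 1)
  refine ⟨2 * (Real.exp (B * T) * √T * √T) * Real.exp (B * T), by positivity, fun ν hν t ht => ?_⟩
  have hBν : ∀ t, |v t + ν| ≤ B := fun t => (abs_add_const_le hb ν t).trans (by
    have : |ν| ≤ |ν - μ| + |μ| := by simpa using abs_add_le (ν - μ) μ
    simp only [B]
    linarith)
  have hBμ : ∀ t, |v t + μ| ≤ B := fun t => (abs_add_const_le hb μ t).trans (by
    simp only [B]
    linarith)
  have h := abs_sol_sub_sol_le (hv.add_const ν) hBν (hv.add_const μ) hBμ hT
    (κ := |ν - μ| * √T) (by positivity) ?_ ht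
  · refine h.trans (le_of_eq ?_)
    ring
  · intro s hs
    simp only [add_sub_add_left_eq_sub, intervalIntegral.integral_const, smul_eq_mul, sub_zero]
    have h1 : s = √s * √s := (Real.mul_self_sqrt hs.1).symm
    have h2 : √s ≤ √T := Real.sqrt_le_sqrt hs.2
    calc s * |ν - μ| = √s * √s * |ν - μ| := by rw [← h1]
      _ ≤ √T * √s * |ν - μ| := by gcongr
      _ = _ := by ring

/-- The solution for `μ = λ(v)` is positive in the interior and vanishes at the boundary. -/
lemma ground_pos_and_eq_zero (hR : 0 < R) (hv : Measurable v) (hb : ∀ t, |v t| ≤ b) :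
    (∀ t ∈ Ico 0 (R ^ 2), 0 < ground R v t) ∧ ground R v (R ^ 2) = 0 := by
  have hT : 0 ≤ R ^ 2 := by positivity
  set T := R ^ 2
  have hqm : ∀ μ, Measurable fun t => v t + μ := fun μ => hv.add_const μ
  have hq : Measurable (shiftedPot R v) := hqm _
  have hB : ∀ t, |shiftedPot R v t| ≤ b + |eig R v| := abs_add_const_le hb _
  have hcs : Continuous (ground R v) := continuous_sol hq hB
  have hone : ground R v 0 = 1 := sol_zero hq hB
  obtain ⟨C, hC0, hC⟩ := abs_sol_sub_sol_le_of_const hv hb hT (eig R v)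
  -- Without a zero the solution has a positive minimum, so it stays positive for λ + ε, and Barta's
  -- inequality would give λ + ε ≤ λ.
  have hex : ∃ t ∈ Icc 0 T, ground R v t = 0 := by
    by_contra! hne
    have hpos : ∀ t ∈ Icc 0 T, 0 < ground R v t := by
      intro t ht
      by_contra hle
      obtain ⟨s, hs, hs0⟩ := intermediate_value_Icc' ht.1 hcs.continuousOn
        ⟨not_lt.1 hle, by rw [hone]; exact zero_le_one⟩
      exact hne s ⟨hs.1, hs.2.trans ht.2⟩ hs0
    obtain ⟨x, hx, hmin⟩ := isCompact_Icc.exists_isMinOn (s := Icc 0 T) ⟨0, le_rfl, hT⟩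
      hcs.continuousOn
    have hm := hpos x hx
    set m := ground R v x
    set ε := min 1 (m / (2 * (C + 1)))
    have hε : 0 < ε := by positivity
    have hε1 : ε ≤ 1 := min_le_left _ _
    have hε2 : C * ε < m := by
      have h1 : ε * (2 * (C + 1)) ≤ m := by
        rw [← le_div_iff₀ (by positivity)]
        exact min_le_right _ _
      nlinarith
    have h2 : eig R v + ε ≤ eig R v := by
      refine le_firstEigenvalue_of_sol_pos hR hv hb fun t ht => ?_
      have h3 := hC (eig R v + ε) (by simpa [abs_of_pos hε] using hε1) t ⟨ht.1, ht.2.le⟩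
      rw [add_sub_cancel_left, abs_of_pos hε] at h3
      have h4 : m ≤ ground R v t := isMinOn_iff.1 hmin t ⟨ht.1, ht.2.le⟩
      have h5 := (abs_le.1 h3).1
      change _ ≤ sol (fun t => v t + (eig R v + ε)) t - ground R v t at h5
      linarith
    linarith
  obtain ⟨t₀, ⟨ht₀, h0⟩, hleast⟩ := (isCompact_Icc.inter_right
    (isClosed_singleton.preimage hcs : IsClosed (ground R v ⁻¹' {0}))).exists_isLeast
    (s := Icc 0 T ∩ ground R v ⁻¹' {0}) (by obtain ⟨t, ht, h⟩ := hex; exact ⟨t, ht, h⟩)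
  simp only [mem_preimage, mem_singleton_iff] at h0
  have hpos : ∀ t ∈ Ico 0 t₀, 0 < ground R v t := by
    intro t ht
    by_contra hle
    obtain ⟨s, hs, hs0⟩ := intermediate_value_Icc' ht.1 hcs.continuousOn
      ⟨not_lt.1 hle, by rw [hone]; exact zero_le_one⟩
    have := hleast ⟨⟨hs.1, hs.2.trans (ht.2.le.trans ht₀.2)⟩, hs0⟩
    linarith [hs.2, ht.2]
  have ht₀pos : 0 < t₀ := by
    refine ht₀.1.lt_of_ne fun h => ?_
    rw [← h, hone] at h0
    exact one_ne_zero h0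
  rcases ht₀.2.eq_or_lt with h | hlt
  · rw [← h]
    exact ⟨hpos, h0⟩
  exfalso
  -- A first zero before R² is crossed with nonzero slope, so the solution for λ - ε still changes
  -- sign before R², and its zero would give λ ≤ λ - ε.
  have hfl := flux_pos_of_first_zero hq hB ht₀pos h0 hpos
  obtain ⟨l, hl, hsub⟩ : ∃ l > t₀, Ico t₀ l ⊆ {t | 0 < flux (shiftedPot R v) t} :=
    exists_Ico_subset_of_mem_nhds
      (continuousAt_const.eventually_lt (continuous_flux hq hB).continuousAt hfl) ⟨t₀ + 1, by linarith⟩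
  set t₁ := min ((t₀ + l) / 2) T
  have ht₁ : t₀ < t₁ := lt_min (by linarith) hlt
  have ht₁T : t₁ ≤ T := min_le_right _ _
  have ht₁l : t₁ < l := (min_le_left _ _).trans_lt (by linarith)
  have hneg : ground R v t₁ < 0 := by
    have := sol_lt_sol hq hB ht₀pos.le ht₁ fun s hs => hsub ⟨hs.1.le, hs.2.trans ht₁l⟩
    rw [← h0]
    exact this
  set m := -ground R v t₁
  have hm : 0 < m := by simp only [m]; linarith
  set ε := min 1 (m / (2 * (C + 1)))
  have hε : 0 < ε := by positivity
  have hε1 : ε ≤ 1 := min_le_left _ _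
  have hε2 : C * ε < m := by
    have h1 : ε * (2 * (C + 1)) ≤ m := by
      rw [← le_div_iff₀ (by positivity)]
      exact min_le_right _ _
    nlinarith
  have e : eig R v - ε - eig R v = -ε := by ring
  have h3 := hC (eig R v - ε) (by rw [e, abs_neg, abs_of_pos hε]; exact hε1) t₁
    ⟨ht₀pos.le.trans ht₁.le, ht₁T⟩
  rw [e, abs_neg, abs_of_pos hε] at h3
  have h5 := (abs_le.1 h3).2
  change sol (fun t => v t + (eig R v - ε)) t₁ - ground R v t₁ ≤ _ at h5
  have h6 : sol (fun t => v t + (eig R v - ε)) t₁ < 0 := by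
    simp only [m] at hε2
    linarith
  have hBε := abs_add_const_le hb (eig R v - ε)
  obtain ⟨s, hs, hs0⟩ := intermediate_value_Icc' (ht₀pos.le.trans ht₁.le)
    (continuous_sol (hqm (eig R v - ε)) hBε).continuousOn
    ⟨h6.le, by rw [sol_zero (hqm _) hBε]; exact zero_le_one⟩
  have hs1 : 0 < s := by
    refine hs.1.lt_of_ne fun h => ?_
    rw [← h, sol_zero (hqm _) hBε] at hs0
    exact one_ne_zero hs0
  have := eig_le_of_sol_eq_zero hR hv hb hs1 (hs.2.trans ht₁T) hs0
  linarith

end Eig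

/-! ### Uniform bounds and continuous dependence on the potential. -/

/-- The squared norm of the ground state. -/
noncomputable def normSq (R : ℝ) (v : ℝ → ℝ) : ℝ := ∫ t in (0 : ℝ)..R ^ 2, ground R v t ^ 2

/-- A bound for `v + λ(v)` in terms of a bound `b` for `v`. -/
noncomputable def potBound (R b : ℝ) : ℝ := 2 * b + 6 / R ^ 2

section Bounds

variable {R b : ℝ} {v w : ℝ → ℝ}

lemma measurable_shiftedPot (R : ℝ) (hv : Measurable v) : Measurable (shiftedPot R v) :=
  hv.add_const _

lemma continuous_ground (R : ℝ) (hv : Measurable v) (hb : ∀ t, |v t| ≤ b) :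
    Continuous (ground R v) :=
  continuous_sol (measurable_shiftedPot R hv) (abs_add_const_le hb (eig R v))

lemma ground_zero (R : ℝ) (hv : Measurable v) (hb : ∀ t, |v t| ≤ b) : ground R v 0 = 1 :=
  sol_zero (measurable_shiftedPot R hv) (abs_add_const_le hb (eig R v))

lemma normSq_pos (hR : 0 < R) (hv : Measurable v) (hb : ∀ t, |v t| ≤ b) : 0 < normSq R v := by
  have hT : 0 < R ^ 2 := by positivity
  refine intervalIntegral.integral_pos hT ((continuous_ground R hv hb).pow 2).continuousOn
    (fun t _ => sq_nonneg _) ⟨0, ⟨le_rfl, hT.le⟩, ?_⟩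
  rw [ground_zero R hv hb]
  norm_num

lemma tail_solDeriv_ground (hR : 0 < R) (hv : Measurable v) (hb : ∀ t, |v t| ≤ b) {t : ℝ}
    (ht : t ∈ Icc 0 (R ^ 2)) : tail (R ^ 2) (solDeriv (shiftedPot R v) (R ^ 2)) t = ground R v t :=
  tail_solDeriv (measurable_shiftedPot R hv) (abs_add_const_le hb (eig R v)) le_rfl
    (ground_pos_and_eq_zero hR hv hb).2 ht

/-- The energy identity of the ground state. -/
lemma integral_energy_ground (hR : 0 < R) (hv : Measurable v) (hb : ∀ t, |v t| ≤ b) :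
    ∫ t in (0 : ℝ)..R ^ 2, 4 * t * solDeriv (shiftedPot R v) (R ^ 2) t ^ 2
      = (∫ t in (0 : ℝ)..R ^ 2, v t * ground R v t ^ 2) + eig R v * normSq R v := by
  have hT : 0 ≤ R ^ 2 := by positivity
  have hq := measurable_shiftedPot R hv
  have hB : ∀ t, |shiftedPot R v t| ≤ b + |eig R v| := abs_add_const_le hb (eig R v)
  have hc := continuous_ground R hv hb
  have hc2 : Continuous fun t => ground R v t ^ 2 := hc.pow 2
  have h1 := integral_energy_sol hq hB le_rfl hT
  have h0 : sol (shiftedPot R v) (R ^ 2) = 0 := (ground_pos_and_eq_zero hR hv hb).2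
  rw [h0, flux_zero, mul_zero, zero_mul, sub_zero, sub_zero] at h1
  have e1 : ∫ t in (0 : ℝ)..R ^ 2, 4 * t * solDeriv (shiftedPot R v) (R ^ 2) t ^ 2
      = ∫ t in (0 : ℝ)..R ^ 2, 4 * t * (-flux (shiftedPot R v) t / (4 * t)) ^ 2 := by
    refine intervalIntegral.integral_congr_ae (ae_of_all _ fun t ht => ?_)
    rw [uIoc_of_le hT] at ht
    rw [solDeriv_of_mem ht]
  rw [e1, h1, normSq, ← intervalIntegral.integral_const_mul, ← intervalIntegral.integral_add
    (intervalIntegrable_bounded_mul hv hb hc2 _ _)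
    ((hc2.intervalIntegrable _ _).const_mul _)]
  congr 1
  funext t
  simp only [shiftedPot, ground]
  ring

/-- The ground state of `w` as a trial function for `v`. -/
lemma eig_sub_eig_mul_le (hR : 0 < R) (hv : Measurable v) (hbv : ∀ t, |v t| ≤ b)
    (hw : Measurable w) (hbw : ∀ t, |w t| ≤ b) :
    (eig R v - eig R w) * normSq R w ≤ ∫ t in (0 : ℝ)..R ^ 2, (w t - v t) * ground R w t ^ 2 := by
  have hT : 0 ≤ R ^ 2 := by positivity
  have hq := measurable_shiftedPot R hw
  have hB : ∀ t, |shiftedPot R w t| ≤ b + |eig R w| := abs_add_const_le hbw (eig R w)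
  have hc := continuous_ground R hw hbw
  have h := firstEigenvalue_mul_le hR hv hbv (measurable_solDeriv hq hB (R ^ 2))
    (abs_solDeriv_le hq hB hT)
  have e1 : ∫ t in (0 : ℝ)..R ^ 2, tail (R ^ 2) (solDeriv (shiftedPot R w) (R ^ 2)) t ^ 2
      = normSq R w := by
    refine intervalIntegral.integral_congr fun t ht => ?_
    rw [uIcc_of_le hT] at ht
    simp only [tail_solDeriv_ground hR hw hbw ht]
  have e2 : ∫ t in (0 : ℝ)..R ^ 2, v t * tail (R ^ 2) (solDeriv (shiftedPot R w) (R ^ 2)) t ^ 2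
      = ∫ t in (0 : ℝ)..R ^ 2, v t * ground R w t ^ 2 := by
    refine intervalIntegral.integral_congr fun t ht => ?_
    rw [uIcc_of_le hT] at ht
    simp only [tail_solDeriv_ground hR hw hbw ht]
  rw [e1, e2, integral_energy_ground hR hw hbw] at h
  have e3 : ∫ t in (0 : ℝ)..R ^ 2, (w t - v t) * ground R w t ^ 2
      = (∫ t in (0 : ℝ)..R ^ 2, w t * ground R w t ^ 2)
        - ∫ t in (0 : ℝ)..R ^ 2, v t * ground R w t ^ 2 := by
    have hc2 : Continuous fun t => ground R w t ^ 2 := hc.pow 2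
    rw [← intervalIntegral.integral_sub (intervalIntegrable_bounded_mul hw hbw hc2 _ _)
      (intervalIntegrable_bounded_mul hv hbv hc2 _ _)]
    congr 1
    funext t
    ring
  rw [e3, sub_mul]
  rw [eig]
  linarith

/-- The trial function R² - t has kinetic integral 2R⁴ and squared norm R⁶/3, whence 6/R². The lower
bound comes from the nonnegative kinetic energy of the ground state. -/
lemma abs_eig_le (hR : 0 < R) (hv : Measurable v) (hb : ∀ t, |v t| ≤ b) :
    |eig R v| ≤ b + 6 / R ^ 2 := by
  have hT : 0 < R ^ 2 := by positivity
  have hb0 : 0 ≤ b := (abs_nonneg _).trans (hb 0)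
  refine abs_le.2 ⟨?_, ?_⟩
  · have h1 := integral_energy_ground hR hv hb
    have h2 : 0 ≤ ∫ t in (0 : ℝ)..R ^ 2, 4 * t * solDeriv (shiftedPot R v) (R ^ 2) t ^ 2 :=
      intervalIntegral.integral_nonneg hT.le fun t ht => by
        have := ht.1
        positivity
    have hc := continuous_ground R hv hb
    have h3 : ∫ t in (0 : ℝ)..R ^ 2, v t * ground R v t ^ 2 ≤ b * normSq R v := by
      rw [normSq, ← intervalIntegral.integral_const_mul]
      exact intervalIntegral.integral_mono_on hT.le
        (intervalIntegrable_bounded_mul hv hb (hc.pow 2) _ _)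
        ((continuous_const.mul (hc.pow 2)).intervalIntegrable _ _) fun t _ =>
          mul_le_mul_of_nonneg_right ((le_abs_self _).trans (hb t)) (sq_nonneg _)
    have h4 := normSq_pos hR hv hb
    have h5 : 0 ≤ 6 / R ^ 2 := by positivity
    have h6 : 0 ≤ (b + eig R v) * normSq R v := by linarith
    have h7 := nonneg_of_mul_nonneg_left h6 h4
    linarith
  · have h := firstEigenvalue_mul_le hR hv hb (g := fun _ => -1) (K := 1) measurable_const (by simp)
    simp only [tail_neg_one] at h
    set I := ∫ t in (0 : ℝ)..R ^ 2, (R ^ 2 - t) ^ 2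
    have hI : I = (R ^ 2) ^ 3 / 3 := by
      simp only [I]
      rw [intervalIntegral.integral_comp_sub_left (fun t => t ^ 2), integral_pow]
      norm_num
    have hD : ∫ t in (0 : ℝ)..R ^ 2, 4 * t * (-1 : ℝ) ^ 2 = 2 * (R ^ 2) ^ 2 := by
      have : (fun t : ℝ => 4 * t * (-1 : ℝ) ^ 2) = fun t => 4 * t := by
        funext t
        ring
      rw [this, intervalIntegral.integral_const_mul, integral_id]
      ring
    have hV : -(b * I) ≤ ∫ t in (0 : ℝ)..R ^ 2, v t * (R ^ 2 - t) ^ 2 := by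
      have hc : Continuous fun t : ℝ => (R ^ 2 - t) ^ 2 := by fun_prop
      have : ∫ t in (0 : ℝ)..R ^ 2, (-b) * (R ^ 2 - t) ^ 2
          ≤ ∫ t in (0 : ℝ)..R ^ 2, v t * (R ^ 2 - t) ^ 2 :=
        intervalIntegral.integral_mono_on hT.le ((continuous_const.mul hc).intervalIntegrable _ _)
          (intervalIntegrable_bounded_mul hv hb hc _ _) fun t _ =>
            mul_le_mul_of_nonneg_right (abs_le.1 (hb t)).1 (sq_nonneg _)
      rw [intervalIntegral.integral_const_mul] at this
      linarith
    rw [hD] at h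
    have hI0 : 0 < I := by rw [hI]; positivity
    refine le_of_mul_le_mul_right ?_ hI0
    rw [eig]
    have e : (b + 6 / R ^ 2) * I = b * I + 2 * (R ^ 2) ^ 2 := by
      rw [hI]
      field_simp
      ring
    rw [e]
    linarith

lemma abs_shiftedPot_le (hR : 0 < R) (hv : Measurable v) (hb : ∀ t, |v t| ≤ b) (t : ℝ) :
    |shiftedPot R v t| ≤ potBound R b := by
  refine (abs_add_const_le hb (eig R v) t).trans ?_
  have := abs_eig_le hR hv hb
  rw [potBound]
  linarith

lemma abs_ground_le (hR : 0 < R) (hv : Measurable v) (hb : ∀ t, |v t| ≤ b) {t : ℝ}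
    (ht : t ∈ Icc 0 (R ^ 2)) : |ground R v t| ≤ 2 * Real.exp (potBound R b * R ^ 2) :=
  abs_sol_le (measurable_shiftedPot R hv) (abs_shiftedPot_le hR hv hb) (by positivity) ht

/-- The norm of the ground state is bounded below, uniformly in the potential. -/
lemma exists_le_normSq (hR : 0 < R) (b : ℝ) : ∃ c, 0 < c ∧
    ∀ v : ℝ → ℝ, Measurable v → (∀ t, |v t| ≤ b) → c ≤ normSq R v := by
  by_cases hb0 : 0 ≤ b
  swap
  · exact ⟨1, one_pos, fun v _ hb => absurd ((abs_nonneg _).trans (hb 0)) hb0⟩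
  have hT : 0 < R ^ 2 := by positivity
  have hp : 0 ≤ potBound R b := by
    rw [potBound]
    positivity
  set K := potBound R b * (2 * Real.exp (potBound R b * R ^ 2)) / 4
  have hK : 0 ≤ K := by positivity
  -- From u(0) = 1 and |u'| ≤ K it follows that u ≥ 1/2 on [0, η].
  set η := min (R ^ 2) (1 / (2 * (K + 1)))
  have hη : 0 < η := by positivity
  have hηK : K * η ≤ 1 / 2 := by
    have h1 : η * (2 * (K + 1)) ≤ 1 := by
      rw [← le_div_iff₀ (by positivity)]
      exact min_le_right _ _
    nlinarith
  have hηT : η ≤ R ^ 2 := min_le_left _ _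
  refine ⟨(1 / 2) ^ 2 * η, by positivity, fun v hv hb => ?_⟩
  have hq := measurable_shiftedPot R hv
  have hB := abs_shiftedPot_le hR hv hb
  have hc := continuous_ground R hv hb
  have h1 : ∀ t ∈ Icc 0 η, 1 / 2 ≤ ground R v t := by
    intro t ht
    have h2 := sol_eq hq hB ht.1
    have h3 := intervalIntegral.norm_integral_le_of_norm_le_const (a := 0) (b := t)
      (f := fun s => flux (shiftedPot R v) s / (4 * s)) (C := K) ?_
    · rw [sub_zero, abs_of_nonneg ht.1] at h3
      have h4 := (le_abs_self _).trans h3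
      have h5 : K * t ≤ K * η := by
        gcongr
        exact ht.2
      rw [ground, h2]
      linarith
    · intro s hs
      rw [uIoc_of_le ht.1] at hs
      exact abs_flux_div_le hq hB hT.le ⟨hs.1.le, hs.2.trans (ht.2.trans hηT)⟩
  have h2 : ∫ _ in (0 : ℝ)..η, (1 / 2 : ℝ) ^ 2 ≤ ∫ t in (0 : ℝ)..η, ground R v t ^ 2 :=
    intervalIntegral.integral_mono_on hη.le (by simp) ((hc.pow 2).intervalIntegrable _ _)
      fun t ht => pow_le_pow_left₀ (by norm_num) (h1 t ht) 2
  have h3 : ∫ t in (0 : ℝ)..η, ground R v t ^ 2 ≤ normSq R v :=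
    intervalIntegral.integral_mono_interval le_rfl hη.le hηT
      (ae_of_all _ fun t => sq_nonneg _) ((hc.pow 2).intervalIntegrable _ _)
  simp only [intervalIntegral.integral_const, sub_zero, smul_eq_mul] at h2
  linarith

lemma intervalIntegrable_abs_sub (hv : Measurable v) (hbv : ∀ t, |v t| ≤ b) (hw : Measurable w)
    (hbw : ∀ t, |w t| ≤ b) (s t : ℝ) : IntervalIntegrable (fun σ => |v σ - w σ|) volume s t :=
  ((intervalIntegrable_of_bounded hv hbv s t).sub (intervalIntegrable_of_bounded hw hbw s t)).abs

lemma eig_sub_eig_le (hR : 0 < R) {c : ℝ} (hc : 0 < c) (hv : Measurable v)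
    (hbv : ∀ t, |v t| ≤ b) (hw : Measurable w) (hbw : ∀ t, |w t| ≤ b) (hcw : c ≤ normSq R w) :
    eig R v - eig R w ≤ (2 * Real.exp (potBound R b * R ^ 2)) ^ 2 / c
      * ∫ t in (0 : ℝ)..R ^ 2, |v t - w t| := by
  have hT : 0 ≤ R ^ 2 := by positivity
  set M := 2 * Real.exp (potBound R b * R ^ 2)
  have h := eig_sub_eig_mul_le hR hv hbv hw hbw
  have h1 : ∫ t in (0 : ℝ)..R ^ 2, (w t - v t) * ground R w t ^ 2
      ≤ ∫ t in (0 : ℝ)..R ^ 2, M ^ 2 * |v t - w t| := by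
    refine intervalIntegral.integral_mono_on hT ?_
      ((intervalIntegrable_abs_sub hv hbv hw hbw _ _).const_mul _) fun t ht => ?_
    · exact ((intervalIntegrable_of_bounded hw hbw _ _).sub
        (intervalIntegrable_of_bounded hv hbv _ _)).mul_continuousOn
        ((continuous_ground R hw hbw).pow 2).continuousOn
    · have h2 : ground R w t ^ 2 ≤ M ^ 2 := by
        rw [← sq_abs]
        exact pow_le_pow_left₀ (abs_nonneg _) (abs_ground_le hR hw hbw ht) 2
      calc _ ≤ |v t - w t| * ground R w t ^ 2 := by
            refine mul_le_mul_of_nonneg_right ?_ (sq_nonneg _)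
            rw [abs_sub_comm]
            exact le_abs_self _
        _ ≤ |v t - w t| * M ^ 2 := by gcongr
        _ = _ := mul_comm _ _
  rw [intervalIntegral.integral_const_mul] at h1
  have hD : 0 ≤ ∫ t in (0 : ℝ)..R ^ 2, |v t - w t| :=
    intervalIntegral.integral_nonneg hT fun t _ => abs_nonneg _
  set D := ∫ t in (0 : ℝ)..R ^ 2, |v t - w t|
  rcases le_or_gt (eig R v - eig R w) 0 with hle | hlt
  · exact hle.trans (by positivity)
  · rw [div_mul_eq_mul_div, le_div_iff₀ hc]
    calc _ ≤ (eig R v - eig R w) * normSq R w := by gcongr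
      _ ≤ _ := h.trans h1

/-- Continuous dependence of the eigenvalue, the ground state and its flux on the potential. -/
lemma exists_abs_sub_le (hR : 0 < R) (b : ℝ) : ∃ C, 0 ≤ C ∧
    ∀ v w : ℝ → ℝ, Measurable v → (∀ t, |v t| ≤ b) → Measurable w → (∀ t, |w t| ≤ b) →
      |eig R v - eig R w| ≤ C * (∫ t in (0 : ℝ)..R ^ 2, |v t - w t|) ∧
      ∀ t ∈ Icc 0 (R ^ 2),
        |ground R v t - ground R w t| ≤ C * √(∫ t in (0 : ℝ)..R ^ 2, |v t - w t|) ∧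
        |flux (shiftedPot R v) t - flux (shiftedPot R w) t|
          ≤ C * √(∫ t in (0 : ℝ)..R ^ 2, |v t - w t|) := by
  by_cases hb0 : 0 ≤ b
  swap
  · exact ⟨0, le_rfl, fun v _ _ hb => absurd ((abs_nonneg _).trans (hb 0)) hb0⟩
  have hT : 0 ≤ R ^ 2 := by positivity
  obtain ⟨c, hc, hcn⟩ := exists_le_normSq hR b
  set T := R ^ 2
  set B := potBound R b
  set E := Real.exp (B * T)
  have hp : 0 ≤ B := by
    simp only [B, potBound]
    positivity
  set C₁ := (2 * E) ^ 2 / c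
  set k := √(2 * b) + C₁ * √(2 * b * T) * √T
  have hC₁ : 0 ≤ C₁ := by positivity
  have hk : 0 ≤ k := by positivity
  set C₂ := 2 * (E * k * √T) * E
  set C₃ := B * C₂ * T + 2 * E * k * √T
  have hC₂ : 0 ≤ C₂ := by positivity
  have hC₃ : 0 ≤ C₃ := by positivity
  refine ⟨C₁ + C₂ + C₃, by positivity, fun v w hv hbv hw hbw => ?_⟩
  set D := ∫ t in (0 : ℝ)..T, |v t - w t|
  have hD : 0 ≤ D := intervalIntegral.integral_nonneg hT fun t _ => abs_nonneg _
  have hi := intervalIntegrable_abs_sub hv hbv hw hbw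
  have hlam : |eig R v - eig R w| ≤ C₁ * D := by
    refine abs_sub_le_iff.2 ⟨eig_sub_eig_le hR hc hv hbv hw hbw (hcn w hw hbw), ?_⟩
    have := eig_sub_eig_le hR hc hw hbw hv hbv (hcn v hv hbv)
    simpa only [abs_sub_comm] using this
  -- The integral is at most D and at most 2bs, hence at most √(2bsD). The factor √s is the one
  -- `abs_sol_sub_sol_le` requires; its price is √D in place of D.
  have hloc : ∀ s ∈ Icc 0 T, ∫ σ in (0 : ℝ)..s, |v σ - w σ| ≤ √(2 * b) * √s * √D ∧
      ∫ σ in (0 : ℝ)..s, |v σ - w σ| ≤ 2 * b * s := by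
    intro s hs
    have h1 : ∫ σ in (0 : ℝ)..s, |v σ - w σ| ≤ D :=
      intervalIntegral.integral_mono_interval le_rfl hs.1 hs.2
        (ae_of_all _ fun t => abs_nonneg _) (hi _ _)
    have h2 : ∫ σ in (0 : ℝ)..s, |v σ - w σ| ≤ ∫ _ in (0 : ℝ)..s, 2 * b := by
      refine intervalIntegral.integral_mono_on hs.1 (hi _ _) (by simp) fun σ _ => ?_
      exact (abs_sub _ _).trans (by linarith [hbv σ, hbw σ])
    have h3 : 0 ≤ ∫ σ in (0 : ℝ)..s, |v σ - w σ| :=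
      intervalIntegral.integral_nonneg hs.1 fun t _ => abs_nonneg _
    simp only [intervalIntegral.integral_const, sub_zero, smul_eq_mul] at h2
    refine ⟨?_, by linarith⟩
    rw [← Real.sqrt_mul (by positivity), ← Real.sqrt_mul (by have := hs.1; positivity)]
    refine Real.le_sqrt_of_sq_le ?_
    rw [sq]
    refine mul_le_mul (by linarith) h1 h3 ?_
    have := hs.1
    positivity
  have hDT : D ≤ √(2 * b * T) * √D := by
    have h1 := (hloc T ⟨hT, le_rfl⟩).1
    rwa [← Real.sqrt_mul (by positivity)] at h1
  have hκ : ∀ s ∈ Icc 0 T, ∫ σ in (0 : ℝ)..s, |shiftedPot R v σ - shiftedPot R w σ|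
      ≤ k * √D * √s := by
    intro s hs
    have h1 : ∫ σ in (0 : ℝ)..s, |shiftedPot R v σ - shiftedPot R w σ|
        ≤ ∫ σ in (0 : ℝ)..s, (|v σ - w σ| + |eig R v - eig R w|) := by
      refine intervalIntegral.integral_mono_on hs.1 ?_ ((hi _ _).add (by simp)) fun σ _ => ?_
      · exact intervalIntegrable_abs_sub (measurable_shiftedPot R hv) (abs_shiftedPot_le hR hv hbv)
          (measurable_shiftedPot R hw) (abs_shiftedPot_le hR hw hbw) _ _
      · simp only [shiftedPot]
        rw [add_sub_add_comm]
        exact abs_add_le _ _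
    rw [intervalIntegral.integral_add (hi _ _) (by simp)] at h1
    simp only [intervalIntegral.integral_const, sub_zero, smul_eq_mul] at h1
    have h2 := (hloc s hs).1
    have h3 : √s ≤ √T := Real.sqrt_le_sqrt hs.2
    have h4 : s * |eig R v - eig R w| ≤ √T * √s * (C₁ * (√(2 * b * T) * √D)) := by
      have h5 : s ≤ √T * √s := by
        calc s = √s * √s := (Real.mul_self_sqrt hs.1).symm
          _ ≤ _ := by gcongr
      refine mul_le_mul h5 (hlam.trans (by gcongr)) (abs_nonneg _) (by positivity)
    have e : k * √D * √s = √(2 * b) * √s * √D + √T * √s * (C₁ * (√(2 * b * T) * √D)) := by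
      simp only [k]
      ring
    rw [e]
    linarith
  have hq := measurable_shiftedPot R hv
  have hB := abs_shiftedPot_le hR hv hbv
  have hq' := measurable_shiftedPot R hw
  have hB' := abs_shiftedPot_le hR hw hbw
  have hg : ∀ t ∈ Icc 0 T, |ground R v t - ground R w t| ≤ C₂ * √D := by
    intro t ht
    have := abs_sol_sub_sol_le hq hB hq' hB' hT (by positivity) hκ ht
    refine this.trans (le_of_eq ?_)
    simp only [C₂, E, B]
    ring
  refine ⟨hlam.trans (by gcongr; linarith), fun t ht => ⟨(hg t ht).trans (by gcongr; linarith), ?_⟩⟩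
  have h1 := abs_flux_sub_flux_le hq hB hq' hB' hT ht (hκ t ht) (M := C₂ * √D)
    fun σ hσ => hg σ ⟨hσ.1, hσ.2.trans ht.2⟩
  refine h1.trans ?_
  calc _ ≤ B * (C₂ * √D) * T + 2 * E * (k * √D) * √T := by
        have := Real.sqrt_le_sqrt ht.2
        gcongr
        exact ht.2
    _ = C₃ * √D := by simp only [C₃]; ring
    _ ≤ _ := by gcongr; linarith

end Bounds

/-! ### Ground states of potentials near V*. -/

/-- The profile of `V*`, as a function of `|x|²`. -/
noncomputable def step (ts : ℝ) : ℝ → ℝ := (Iic ts).indicator fun _ => 1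

lemma measurable_step (ts : ℝ) : Measurable (step ts) := measurable_const.indicator measurableSet_Iic

lemma step_of_le {ts t : ℝ} (h : t ≤ ts) : step ts t = 1 := indicator_of_mem (s := Iic ts) h _

lemma step_of_lt {ts t : ℝ} (h : ts < t) : step ts t = 0 :=
  indicator_of_notMem (s := Iic ts) (not_le.2 h) _

lemma step_mem_Icc (ts t : ℝ) : step ts t ∈ Icc (0 : ℝ) 1 := by
  rcases le_or_gt t ts with h | h
  · simp [step_of_le h]
  · simp [step_of_lt h]

lemma abs_le_one_of_mem_Icc {x : ℝ} (h : x ∈ Icc (0 : ℝ) 1) : |x| ≤ 1 :=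
  abs_le.2 ⟨by linarith [h.1], h.2⟩

lemma abs_step_le (ts t : ℝ) : |step ts t| ≤ 1 := abs_le_one_of_mem_Icc (step_mem_Icc ts t)

lemma sol_sub_sol_ge {q : ℝ → ℝ} {B : ℝ} (hq : Measurable q) (hB : ∀ t, |q t| ≤ B) {a b T m : ℝ}
    (ha : 0 < a) (hab : a ≤ b) (hbT : b ≤ T) (hm : 0 ≤ m) (h : ∀ s ∈ Icc a b, m ≤ flux q s) :
    m / (4 * T) * (b - a) ≤ sol q a - sol q b := by
  rw [sol_sub_sol hq hB ha.le hab]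
  have h1 : ∫ s in a..b, -flux q s / (4 * s) ≤ ∫ _ in a..b, -(m / (4 * T)) := by
    refine intervalIntegral.integral_mono_on hab
      (intervalIntegrable_neg_flux_div hq hB ha.le hab) (by simp) fun s hs => ?_
    have hs0 : 0 < s := ha.trans_le hs.1
    rw [neg_div, neg_le_neg_iff]
    exact div_le_div₀ (hm.trans (h s hs)) (h s hs) (by positivity) (by linarith [hs.2])
  rw [intervalIntegral.integral_const, smul_eq_mul] at h1
  linarith

section Step

variable {R ts : ℝ}

lemma continuous_flux_ground {b : ℝ} {v : ℝ → ℝ} (R : ℝ) (hv : Measurable v)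
    (hb : ∀ t, |v t| ≤ b) : Continuous (flux (shiftedPot R v)) :=
  continuous_flux (measurable_shiftedPot R hv) (abs_add_const_le hb (eig R v))

lemma ground_nonneg {b : ℝ} {v : ℝ → ℝ} (hR : 0 < R) (hv : Measurable v) (hb : ∀ t, |v t| ≤ b)
    {t : ℝ} (ht : t ∈ Icc 0 (R ^ 2)) : 0 ≤ ground R v t := by
  obtain ⟨h1, h2⟩ := ground_pos_and_eq_zero hR hv hb
  rcases ht.2.lt_or_eq with h | h
  · exact (h1 t ⟨ht.1, h⟩).le
  · rw [h, h2]

lemma flux_ground_end_pos {b : ℝ} {v : ℝ → ℝ} (hR : 0 < R) (hv : Measurable v)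
    (hb : ∀ t, |v t| ≤ b) : 0 < flux (shiftedPot R v) (R ^ 2) := by
  obtain ⟨h1, h2⟩ := ground_pos_and_eq_zero hR hv hb
  exact flux_pos_of_first_zero (measurable_shiftedPot R hv) (abs_add_const_le hb (eig R v))
    (by positivity) h2 h1

/-- The ground state of V* is strictly decreasing. If 1 + λ ≤ 0 the flux at R² would not be
positive, so the flux is positive up to ts. Beyond ts its derivative is λu: for λ ≥ 0 it stays above
its value at ts, for λ < 0 above its value at R². -/
lemma flux_step_pos (hR : 0 < R) (hts : 0 < ts) (htR : ts ≤ R ^ 2) {t : ℝ}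
    (ht : t ∈ Ioc 0 (R ^ 2)) : 0 < flux (shiftedPot R (step ts)) t := by
  have hv := measurable_step ts
  have hb := abs_step_le ts
  have hq := measurable_shiftedPot R hv
  have hB := abs_add_const_le hb (eig R (step ts))
  have hend := flux_ground_end_pos hR hv hb
  have hcs := continuous_ground R hv hb
  set l := eig R (step ts)
  have hl : 0 < 1 + l := by
    by_contra hle
    rw [not_lt] at hle
    refine absurd hend (not_lt.2 ?_)
    rw [flux]
    rw [← neg_nonneg, ← intervalIntegral.integral_neg]
    refine intervalIntegral.integral_nonneg (by positivity) fun s hs => neg_nonneg.2 ?_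
    refine mul_nonpos_of_nonpos_of_nonneg ?_ (ground_nonneg hR hv hb hs)
    have := (step_mem_Icc ts s).2
    change step ts s + l ≤ 0
    linarith
  have h1 : ∀ s ∈ Ioc 0 ts, 0 < flux (shiftedPot R (step ts)) s := by
    intro s hs
    have e : flux (shiftedPot R (step ts)) s = ∫ σ in (0 : ℝ)..s, (1 + l) * ground R (step ts) σ := by
      refine intervalIntegral.integral_congr fun σ hσ => ?_
      rw [uIcc_of_le hs.1.le] at hσ
      simp only [shiftedPot, step_of_le (hσ.2.trans hs.2), ground, l]
    rw [e]
    refine intervalIntegral.integral_pos hs.1 (hcs.const_mul _).continuousOn (fun σ hσ => ?_)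
      ⟨0, ⟨le_rfl, hs.1.le⟩, ?_⟩
    · exact mul_nonneg hl.le (ground_nonneg hR hv hb ⟨hσ.1.le, hσ.2.trans (hs.2.trans htR)⟩)
    · rw [ground_zero R hv hb]
      linarith
  rcases le_or_gt t ts with hle | hlt
  · exact h1 t ⟨ht.1, hle⟩
  · have key : ∀ a b, ts ≤ a → a ≤ b → flux (shiftedPot R (step ts)) b
        = flux (shiftedPot R (step ts)) a + l * ∫ σ in a..b, ground R (step ts) σ := by
      intro a b ha hab
      rw [flux_sub_flux hq hB a b, ← intervalIntegral.integral_const_mul]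
      congr 1
      refine intervalIntegral.integral_congr_ae (ae_of_all _ fun σ hσ => ?_)
      rw [uIoc_of_le hab] at hσ
      simp only [shiftedPot, step_of_lt (ha.trans_lt hσ.1), ground, l, zero_add]
    have hnn : ∀ a b, 0 ≤ a → a ≤ b → b ≤ R ^ 2 → 0 ≤ ∫ σ in a..b, ground R (step ts) σ :=
      fun a b ha hab hb' => intervalIntegral.integral_nonneg hab fun σ hσ =>
        ground_nonneg hR hv hb ⟨ha.trans hσ.1, hσ.2.trans hb'⟩
    rcases le_or_gt 0 l with hl0 | hl0
    · have h2 := key ts t le_rfl hlt.le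
      have h3 := hnn ts t hts.le hlt.le ht.2
      have h4 := h1 ts ⟨hts, le_rfl⟩
      have h5 := mul_nonneg hl0 h3
      linarith
    · have h2 := key t (R ^ 2) hlt.le ht.2
      have h3 := hnn t (R ^ 2) ht.1.le ht.2 le_rfl
      have h5 := mul_nonneg (neg_nonneg.2 hl0.le) h3
      linarith

/-- Near `V*`, ground states separate the points before `3 r*² / 4` from those after. -/
lemma exists_ground_separation (hR : 0 < R) (hts : 0 < ts) (htR : ts < R ^ 2) :
    ∃ d₀ c, 0 < d₀ ∧ 0 < c ∧ ∀ v : ℝ → ℝ, Measurable v → (∀ t, |v t| ≤ 2) →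
      ∫ t in (0 : ℝ)..R ^ 2, |v t - step ts t| ≤ d₀ →
      (∀ τ ∈ Icc (3 * ts / 4) (R ^ 2), ∀ t ∈ Ico 0 τ, ground R v τ < ground R v t) ∧
      ∀ t ∈ Icc 0 ts, c * (ts - t) ≤ ground R v t ^ 2 - ground R v ts ^ 2 := by
  have hsm := measurable_step ts
  have hsb := abs_step_le ts
  have hsb2 : ∀ t, |step ts t| ≤ 2 := fun t => (hsb t).trans one_le_two
  have hT : 0 < R ^ 2 := by positivity
  obtain ⟨C, hC, hcd⟩ := exists_abs_sub_le hR 2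
  have hqs := measurable_shiftedPot R hsm
  have hBs := abs_add_const_le hsb (eig R (step ts))
  set T := R ^ 2
  obtain ⟨s₀, hs₀, hmin⟩ := isCompact_Icc.exists_isMinOn (s := Icc (ts / 2) T)
    ⟨ts, by constructor <;> linarith⟩ (continuous_flux_ground R hsm hsb).continuousOn
  set m := flux (shiftedPot R (step ts)) s₀
  have hm : 0 < m := flux_step_pos hR hts htR.le ⟨by linarith [hs₀.1], hs₀.2⟩
  have hmle : ∀ s ∈ Icc (ts / 2) T, m ≤ flux (shiftedPot R (step ts)) s := isMinOn_iff.1 hmin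
  set g := ground R (step ts) (ts / 2) - ground R (step ts) (3 * ts / 4)
  have hanti : ∀ a b, 0 ≤ a → a < b → b ≤ T → ground R (step ts) b < ground R (step ts) a :=
    fun a b ha hab hb => sol_lt_sol hqs hBs ha hab fun s hs =>
      flux_step_pos hR hts htR.le ⟨ha.trans_lt hs.1, hs.2.le.trans hb⟩
  have hanti' : ∀ a b, 0 ≤ a → a ≤ b → b ≤ T → ground R (step ts) b ≤ ground R (step ts) a := by
    intro a b ha hab hb
    rcases hab.lt_or_eq with h | h
    · exact (hanti a b ha h hb).le
    · rw [h]
  have hg : 0 < g := sub_pos.2 (hanti _ _ (by linarith) (by linarith) (by linarith))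
  set u₀ := ground R (step ts) ts
  have hu₀ : 0 < u₀ := (ground_pos_and_eq_zero hR hsm hsb).1 ts ⟨hts.le, htR⟩
  -- This tolerance keeps the flux above m/2 on [ts/2, R²], preserves a third of the drop g, and
  -- keeps the value at ts above u₀/2.
  set ε := min (m / 2) (min (g / 3) (u₀ / 2))
  have hε : 0 < ε := by positivity
  have hεm : ε ≤ m / 2 := min_le_left _ _
  have hεg : ε ≤ g / 3 := (min_le_right _ _).trans (min_le_left _ _)
  have hεu : ε ≤ u₀ / 2 := (min_le_right _ _).trans (min_le_right _ _)
  set c₁ := min (m / 2 / (4 * T)) (g / 3 / ts)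
  have hc₁ : 0 < c₁ := by positivity
  refine ⟨(ε / (C + 1)) ^ 2, c₁ * (u₀ / 2), by positivity, by positivity, fun v hv hb hD => ?_⟩
  have hq := measurable_shiftedPot R hv
  have hB := abs_add_const_le hb (eig R v)
  obtain ⟨-, hcl⟩ := hcd v (step ts) hv hb hsm hsb2
  have hsmall : C * √(∫ t in (0 : ℝ)..T, |v t - step ts t|) ≤ ε := by
    have h1 : √(∫ t in (0 : ℝ)..T, |v t - step ts t|) ≤ ε / (C + 1) :=
      (Real.sqrt_le_sqrt hD).trans_eq (Real.sqrt_sq (by positivity))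
    calc _ ≤ (C + 1) * (ε / (C + 1)) := by gcongr; linarith
      _ = ε := by field_simp
  have hgr : ∀ t ∈ Icc 0 T, |ground R v t - ground R (step ts) t| ≤ ε :=
    fun t ht => (hcl t ht).1.trans hsmall
  have hfl : ∀ t ∈ Icc (ts / 2) T, m / 2 ≤ flux (shiftedPot R v) t := by
    intro t ht
    have h1 := (abs_le.1 ((hcl t ⟨by linarith [ht.1], ht.2⟩).2.trans hsmall)).1
    have h2 := hmle t ht
    linarith
  have hrate : ∀ a b, ts / 2 ≤ a → a ≤ b → b ≤ T →
      m / 2 / (4 * T) * (b - a) ≤ ground R v a - ground R v b := fun a b ha hab hb' =>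
    sol_sub_sol_ge hq hB (by linarith) hab hb' (by positivity) fun s hs =>
      hfl s ⟨ha.trans hs.1, hs.2.trans hb'⟩
  -- The flux tends to 0 at the origin, so closeness does not give monotonicity there; on [0, ts/2]
  -- values are compared instead of derivatives.
  have hgap : ∀ τ ∈ Icc (3 * ts / 4) T, ∀ t ∈ Icc 0 (ts / 2),
      g / 3 ≤ ground R v t - ground R v τ := by
    intro τ hτ t ht
    have h1 := (abs_le.1 (hgr t ⟨ht.1, by linarith [ht.2]⟩)).1
    have h2 := (abs_le.1 (hgr τ ⟨by linarith [hτ.1], hτ.2⟩)).2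
    have h3 := hanti' t (ts / 2) ht.1 ht.2 (by linarith)
    have h4 := hanti' (3 * ts / 4) τ (by linarith) hτ.1 hτ.2
    linarith
  refine ⟨fun τ hτ t ht => ?_, fun t ht => ?_⟩
  · rcases le_or_gt t (ts / 2) with h | h
    · have := hgap τ hτ t ⟨ht.1, h⟩
      linarith
    · have h1 := hrate t τ h.le ht.2.le hτ.2
      have h2 : 0 < m / 2 / (4 * T) * (τ - t) := mul_pos (by positivity) (sub_pos.2 ht.2)
      linarith
  · have h0 : 0 ≤ ts - t := sub_nonneg.2 ht.2
    have h1 : c₁ * (ts - t) ≤ ground R v t - ground R v ts := by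
      rcases le_or_gt t (ts / 2) with h | h
      · have h1 := hgap ts ⟨by linarith, htR.le⟩ t ⟨ht.1, h⟩
        calc c₁ * (ts - t) ≤ g / 3 / ts * ts := by
              gcongr
              · exact min_le_right _ _
              · linarith [ht.1]
          _ = g / 3 := by field_simp
          _ ≤ _ := h1
      · exact (mul_le_mul_of_nonneg_right (min_le_left _ _) h0).trans (hrate t ts h.le ht.2 htR.le)
    have h2 := (abs_le.1 (hgr ts ⟨hts.le, htR.le⟩)).1
    have h3 : u₀ / 2 ≤ ground R v ts := by linarith
    have h4 := ground_nonneg hR hv hb ⟨ht.1, ht.2.trans htR.le⟩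
    have e : ground R v t ^ 2 - ground R v ts ^ 2
        = (ground R v t - ground R v ts) * (ground R v t + ground R v ts) := by ring
    rw [e]
    calc _ = c₁ * (ts - t) * (u₀ / 2) := by ring
      _ ≤ _ := mul_le_mul h1 (by linarith) (by positivity) ((by positivity : (0:ℝ) ≤ c₁ * (ts - t)).trans h1)

end Step

/-! ### The deficit and quadratic stability near V*. -/

/-- The `L¹` deficit of a potential on `[0, ts]`. -/
noncomputable def deficit (ts : ℝ) (w : ℝ → ℝ) : ℝ := ∫ t in (0 : ℝ)..ts, (1 - w t)

section Deficit

variable {w : ℝ → ℝ} {ts T : ℝ}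

lemma intervalIntegrable_of_mem_Icc (hw : Measurable w) (h : ∀ t, w t ∈ Icc (0 : ℝ) 1) (a b : ℝ) :
    IntervalIntegrable w volume a b :=
  intervalIntegrable_of_bounded hw (fun t => abs_le_one_of_mem_Icc (h t)) a b

lemma deficit_nonneg (hts : 0 ≤ ts) (h : ∀ t, w t ∈ Icc (0 : ℝ) 1) : 0 ≤ deficit ts w :=
  intervalIntegral.integral_nonneg hts fun t _ => sub_nonneg.2 (h t).2

lemma integral_split_step (hts : 0 ≤ ts) (htT : ts ≤ T) {f g k : ℝ → ℝ}
    (hf : IntervalIntegrable f volume 0 ts) (hg : IntervalIntegrable g volume ts T)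
    (h1 : ∀ t ∈ Ioc 0 ts, k t = f t) (h2 : ∀ t ∈ Ioc ts T, k t = g t) :
    ∫ t in (0 : ℝ)..T, k t = (∫ t in (0 : ℝ)..ts, f t) + ∫ t in ts..T, g t := by
  have e1 : EqOn f k (uIoc 0 ts) := by
    rw [uIoc_of_le hts]
    exact fun t ht => (h1 t ht).symm
  have e2 : EqOn g k (uIoc ts T) := by
    rw [uIoc_of_le htT]
    exact fun t ht => (h2 t ht).symm
  rw [← intervalIntegral.integral_add_adjacent_intervals (hf.congr e1) (hg.congr e2)]
  congr 1
  · exact intervalIntegral.integral_congr_ae (ae_of_all _ fun t ht => (e1 ht).symm)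
  · exact intervalIntegral.integral_congr_ae (ae_of_all _ fun t ht => (e2 ht).symm)

lemma integral_step (hts : 0 ≤ ts) (htT : ts ≤ T) : ∫ t in (0 : ℝ)..T, step ts t = ts := by
  rw [integral_split_step hts htT (f := fun _ => 1) (g := fun _ => 0) (by simp) (by simp)
    (fun t ht => step_of_le ht.2) fun t ht => step_of_lt ht.1]
  simp

/-- The difference is 1 - w before ts and w after. When the mass is exactly ts, the L¹ distance is
twice the deficit. -/
lemma integral_abs_sub_step (hw : Measurable w) (h : ∀ t, w t ∈ Icc (0 : ℝ) 1) (hts : 0 ≤ ts)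
    (htT : ts ≤ T) : ∫ t in (0 : ℝ)..T, |w t - step ts t|
      = 2 * deficit ts w + ((∫ t in (0 : ℝ)..T, w t) - ts) := by
  have hi := intervalIntegrable_of_mem_Icc hw h
  rw [integral_split_step hts htT (f := fun t => 1 - w t) (g := w)
    ((by simp : IntervalIntegrable (fun _ => (1 : ℝ)) volume 0 ts).sub (hi _ _)) (hi _ _)
    (fun t ht => ?_) fun t ht => ?_]
  · have h1 : ∫ t in (0 : ℝ)..T, w t = (∫ t in (0 : ℝ)..ts, w t) + ∫ t in ts..T, w t :=
      (intervalIntegral.integral_add_adjacent_intervals (hi _ _) (hi _ _)).symm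
    have h2 : deficit ts w = ts - ∫ t in (0 : ℝ)..ts, w t := by
      rw [deficit, intervalIntegral.integral_sub (by simp) (hi _ _)]
      simp
    rw [← deficit]
    linarith
  · rw [step_of_le ht.2, abs_sub_comm, abs_of_nonneg (sub_nonneg.2 (h t).2)]
  · rw [step_of_lt ht.1, sub_zero, abs_of_nonneg (h t).1]

/-- The one-dimensional bathtub estimate. -/
lemma sq_deficit_le (hw : Measurable w) (h : ∀ t, w t ∈ Icc (0 : ℝ) 1) (hts : 0 ≤ ts) :
    deficit ts w ^ 2 / 4 ≤ ∫ t in (0 : ℝ)..ts, (1 - w t) * (ts - t) := by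
  have hi : ∀ a b, IntervalIntegrable (fun t => 1 - w t) volume a b := fun a b =>
    (by simp : IntervalIntegrable (fun _ => (1 : ℝ)) volume a b).sub
      (intervalIntegrable_of_mem_Icc hw h a b)
  have hic : ∀ a b, IntervalIntegrable (fun t => (1 - w t) * (ts - t)) volume a b := fun a b =>
    (hi a b).mul_continuousOn (by fun_prop)
  have hd0 := deficit_nonneg hts h
  have hle : ∀ a b, a ≤ b → ∫ t in a..b, (1 - w t) ≤ b - a := by
    intro a b hab
    have := intervalIntegral.integral_mono_on hab (hi a b) (by simp)
      (g := fun _ => (1 : ℝ)) fun t _ => by linarith [(h t).1]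
    simpa using this
  have hdt : deficit ts w ≤ ts := by simpa [deficit] using hle 0 ts hts
  set d := deficit ts w
  have hm0 : 0 ≤ ts - d / 2 := by linarith
  have hm1 : ts - d / 2 ≤ ts := by linarith
  -- As 1 - w ≤ 1, the last interval of length d/2 carries at most d/2 of the deficit. The remaining
  -- half lies at distance at least d/2 from ts.
  have e1 : d = (∫ t in (0 : ℝ)..(ts - d / 2), (1 - w t)) + ∫ t in (ts - d / 2)..ts, (1 - w t) :=
    (intervalIntegral.integral_add_adjacent_intervals (hi _ _) (hi _ _)).symm
  have e2 := hle _ _ hm1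
  have e3 : ∫ t in (0 : ℝ)..ts, (1 - w t) * (ts - t)
      = (∫ t in (0 : ℝ)..(ts - d / 2), (1 - w t) * (ts - t))
        + ∫ t in (ts - d / 2)..ts, (1 - w t) * (ts - t) :=
    (intervalIntegral.integral_add_adjacent_intervals (hic _ _) (hic _ _)).symm
  have e4 : 0 ≤ ∫ t in (ts - d / 2)..ts, (1 - w t) * (ts - t) :=
    intervalIntegral.integral_nonneg hm1 fun t ht =>
      mul_nonneg (sub_nonneg.2 (h t).2) (sub_nonneg.2 ht.2)
  have e5 : ∫ t in (0 : ℝ)..(ts - d / 2), (1 - w t) * (d / 2)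
      ≤ ∫ t in (0 : ℝ)..(ts - d / 2), (1 - w t) * (ts - t) :=
    intervalIntegral.integral_mono_on hm0 ((hi _ _).mul_const _) (hic _ _) fun t ht =>
      mul_le_mul_of_nonneg_left (by linarith [ht.2]) (sub_nonneg.2 (h t).2)
  rw [intervalIntegral.integral_mul_const] at e5
  nlinarith

end Deficit

section Stability

variable {R ts : ℝ}

/-- The first variation of the eigenvalue near `V*`, in an admissible direction. -/
lemma exists_first_variation_le (hR : 0 < R) (hts : 0 < ts) (htR : ts < R ^ 2) :
    ∃ d₀ c, 0 < d₀ ∧ 0 < c ∧ ∀ v w : ℝ → ℝ, Measurable v → (∀ t, |v t| ≤ 2) →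
      ∫ t in (0 : ℝ)..R ^ 2, |v t - step ts t| ≤ d₀ →
      Measurable w → (∀ t, w t ∈ Icc (0 : ℝ) 1) → ∫ t in (0 : ℝ)..R ^ 2, w t ≤ ts →
      c * deficit ts w ^ 2 * normSq R v
        ≤ ∫ t in (0 : ℝ)..R ^ 2, (step ts t - w t) * ground R v t ^ 2 := by
  -- Only v, which supplies the ground state, has to be close to V*; w is separate so that the same
  -- estimate serves stability (w = v) and the slope along a segment.
  obtain ⟨d₀, c, hd₀, hc, hsep⟩ := exists_ground_separation hR hts htR
  have hT : 0 < R ^ 2 := by positivity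
  set T := R ^ 2
  set M := (2 * Real.exp (potBound R 2 * T)) ^ 2 * T
  have hM : 0 < M := by positivity
  refine ⟨d₀, c / 4 / M, hd₀, by positivity, fun v w hv hb hD hw hw1 hwi => ?_⟩
  obtain ⟨h1, h2⟩ := hsep v hv hb hD
  have hc2 : Continuous fun t => ground R v t ^ 2 := (continuous_ground R hv hb).pow 2
  have hnM : normSq R v ≤ M := by
    have : normSq R v ≤ ∫ _ in (0 : ℝ)..T, (2 * Real.exp (potBound R 2 * T)) ^ 2 := by
      refine intervalIntegral.integral_mono_on hT.le (hc2.intervalIntegrable _ _) (by simp)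
        fun t ht => ?_
      rw [← sq_abs]
      exact pow_le_pow_left₀ (abs_nonneg _) (abs_ground_le hR hv hb ht) 2
    rw [intervalIntegral.integral_const, smul_eq_mul, sub_zero] at this
    linarith
  have hwb : ∀ t, |w t| ≤ 1 := fun t => abs_le_one_of_mem_Icc (hw1 t)
  have hsw : ∀ a b, IntervalIntegrable (fun t => step ts t - w t) volume a b := fun a b =>
    (intervalIntegrable_of_bounded (measurable_step ts) (abs_step_le ts) a b).sub
      (intervalIntegrable_of_bounded hw hwb a b)
  have hw' : ∀ a b, IntervalIntegrable (fun t => 1 - w t) volume a b := fun a b =>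
    (by simp : IntervalIntegrable (fun _ => (1 : ℝ)) volume a b).sub
      (intervalIntegrable_of_mem_Icc hw hw1 a b)
  have hprod : IntervalIntegrable (fun t => (1 - w t) * (c * (ts - t))) volume 0 ts :=
    (hw' 0 ts).mul_continuousOn (by fun_prop)
  -- A pointwise lower bound once the value of u_v² at ts is subtracted: linear in the distance to
  -- ts on the left, zero on the right.
  set k : ℝ → ℝ := fun t => if t ≤ ts then (1 - w t) * (c * (ts - t)) else 0
  have hk : ∫ t in (0 : ℝ)..T, k t = ∫ t in (0 : ℝ)..ts, (1 - w t) * (c * (ts - t)) := by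
    rw [integral_split_step hts.le htR.le (k := k) (g := fun _ => 0) hprod (by simp)
      (fun t ht => if_pos ht.2) fun t ht => if_neg (not_le.2 ht.1)]
    simp
  have hki : IntervalIntegrable k volume 0 T := by
    refine IntervalIntegrable.trans (b := ts) (hprod.congr fun t ht => ?_)
      ((by simp : IntervalIntegrable (fun _ => (0 : ℝ)) volume ts T).congr fun t ht => ?_)
    · rw [uIoc_of_le hts.le] at ht
      exact (if_pos ht.2).symm
    · rw [uIoc_of_le htR.le] at ht
      exact (if_neg (not_le.2 ht.1)).symm
  have hmono : ∫ t in (0 : ℝ)..T, k t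
      ≤ ∫ t in (0 : ℝ)..T, (step ts t - w t) * (ground R v t ^ 2 - ground R v ts ^ 2) := by
    refine intervalIntegral.integral_mono_on hT.le hki
      ((hsw _ _).mul_continuousOn (hc2.sub continuous_const).continuousOn) fun t ht => ?_
    rcases le_or_gt t ts with h | h
    · simp only [k, if_pos h, step_of_le h]
      exact mul_le_mul_of_nonneg_left (h2 t ⟨ht.1, h⟩) (sub_nonneg.2 (hw1 t).2)
    · simp only [k, if_neg (not_le.2 h), step_of_lt h]
      have h3 := h1 t ⟨by linarith, ht.2⟩ ts ⟨hts.le, h⟩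
      have h4 := ground_nonneg hR hv hb ht
      refine mul_nonneg_of_nonpos_of_nonpos (by linarith [(hw1 t).1]) ?_
      exact sub_nonpos.2 (pow_le_pow_left₀ h4 h3.le 2)
  have e1 : ∫ t in (0 : ℝ)..T, (step ts t - w t) * (ground R v t ^ 2 - ground R v ts ^ 2)
      = (∫ t in (0 : ℝ)..T, (step ts t - w t) * ground R v t ^ 2)
        - ground R v ts ^ 2 * ∫ t in (0 : ℝ)..T, (step ts t - w t) := by
    rw [← intervalIntegral.integral_const_mul, ← intervalIntegral.integral_sub
      ((hsw _ _).mul_continuousOn hc2.continuousOn) ((hsw _ _).const_mul _)]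
    congr 1
    funext t
    ring
  -- Mass at most ts suffices because the subtracted constant u_v(ts)² is nonnegative. Translated
  -- profiles may lose mass, so equality is not assumed.
  have e2 : 0 ≤ ∫ t in (0 : ℝ)..T, (step ts t - w t) := by
    rw [intervalIntegral.integral_sub
      (intervalIntegrable_of_bounded (measurable_step ts) (abs_step_le ts) _ _)
      (intervalIntegrable_of_bounded hw hwb _ _), integral_step hts.le htR.le]
    linarith
  have e3 : ∫ t in (0 : ℝ)..ts, (1 - w t) * (c * (ts - t))
      = c * ∫ t in (0 : ℝ)..ts, (1 - w t) * (ts - t) := by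
    rw [← intervalIntegral.integral_const_mul]
    congr 1
    funext t
    ring
  have h5 := sq_deficit_le hw hw1 hts.le
  have h6 : c / 4 / M * deficit ts w ^ 2 * normSq R v ≤ c * (deficit ts w ^ 2 / 4) := by
    calc _ ≤ c / 4 / M * deficit ts w ^ 2 * M := by gcongr
      _ = _ := by field_simp
  have h7 := mul_nonneg (sq_nonneg (ground R v ts)) e2
  have h8 := mul_le_mul_of_nonneg_left h5 hc.le
  rw [hk, e1, e3] at hmono
  linarith

/-- Quadratic stability of `V*` among nearby potentials. -/
lemma exists_local_stability (hR : 0 < R) (hts : 0 < ts) (htR : ts < R ^ 2) :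
    ∃ d₀ c, 0 < d₀ ∧ 0 < c ∧ ∀ v : ℝ → ℝ, Measurable v → (∀ t, v t ∈ Icc (0 : ℝ) 1) →
      ∫ t in (0 : ℝ)..R ^ 2, v t ≤ ts → deficit ts v ≤ d₀ →
      c * deficit ts v ^ 2 ≤ eig R v - eig R (step ts) := by
  obtain ⟨d₀, c, hd₀, hc, h⟩ := exists_first_variation_le hR hts htR
  refine ⟨d₀ / 2, c, by positivity, hc, fun v hv hv1 hvi hvd => ?_⟩
  have hb : ∀ t, |v t| ≤ 1 := fun t => abs_le_one_of_mem_Icc (hv1 t)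
  have h1 := h v v hv (fun t => (hb t).trans one_le_two) (by
    rw [integral_abs_sub_step hv hv1 hts.le htR.le]
    linarith) hv hv1 hvi
  -- Testing V* with the ground state of v bounds the eigenvalue difference below by a first
  -- variation, without remainder.
  have h2 := eig_sub_eig_mul_le hR (measurable_step ts) (abs_step_le ts) hv hb
  have e : ∫ t in (0 : ℝ)..R ^ 2, (step ts t - v t) * ground R v t ^ 2
      = -∫ t in (0 : ℝ)..R ^ 2, (v t - step ts t) * ground R v t ^ 2 := by
    rw [← intervalIntegral.integral_neg]
    congr 1
    funext t
    ring
  refine le_of_mul_le_mul_right ?_ (normSq_pos hR hv hb)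
  linarith

end Stability

/-! ### Global stability by translating the ground state. -/

section Bathtub

variable {w p : ℝ → ℝ} {ts T : ℝ}

/-- The bathtub principle on an interval. -/
lemma integral_step_sub_mul_nonneg (hts : 0 ≤ ts) (htT : ts ≤ T) (hw : Measurable w)
    (hw1 : ∀ t, w t ∈ Icc (0 : ℝ) 1) (hwi : ∫ t in (0 : ℝ)..T, w t ≤ ts) (hp : Continuous p)
    (hp0 : 0 ≤ p ts) (h1 : ∀ t ∈ Icc 0 ts, p ts ≤ p t) (h2 : ∀ t ∈ Icc ts T, p t ≤ p ts) :
    0 ≤ ∫ t in (0 : ℝ)..T, (step ts t - w t) * p t := by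
  have hsw : IntervalIntegrable (fun t => step ts t - w t) volume 0 T :=
    (intervalIntegrable_of_bounded (measurable_step ts) (abs_step_le ts) _ _).sub
      (intervalIntegrable_of_mem_Icc hw hw1 _ _)
  have e1 : ∫ t in (0 : ℝ)..T, (step ts t - w t) * (p t - p ts)
      = (∫ t in (0 : ℝ)..T, (step ts t - w t) * p t)
        - p ts * ∫ t in (0 : ℝ)..T, (step ts t - w t) := by
    rw [← intervalIntegral.integral_const_mul, ← intervalIntegral.integral_sub
      (hsw.mul_continuousOn hp.continuousOn) (hsw.const_mul _)]
    congr 1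
    funext t
    ring
  have e2 : 0 ≤ ∫ t in (0 : ℝ)..T, (step ts t - w t) := by
    rw [intervalIntegral.integral_sub
      (intervalIntegrable_of_bounded (measurable_step ts) (abs_step_le ts) _ _)
      (intervalIntegrable_of_mem_Icc hw hw1 _ _), integral_step hts htT]
    linarith
  have e3 : 0 ≤ ∫ t in (0 : ℝ)..T, (step ts t - w t) * (p t - p ts) := by
    refine intervalIntegral.integral_nonneg (hts.trans htT) fun t ht => ?_
    rcases le_or_gt t ts with h | h
    · rw [step_of_le h]
      exact mul_nonneg (sub_nonneg.2 (hw1 t).2) (sub_nonneg.2 (h1 t ⟨ht.1, h⟩))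
    · rw [step_of_lt h]
      exact mul_nonneg_of_nonpos_of_nonpos (by linarith [(hw1 t).1])
        (sub_nonpos.2 (h2 t ⟨h.le, ht.2⟩))
  have := mul_nonneg hp0 e2
  linarith

end Bathtub

section Poincare

variable {g : ℝ → ℝ} {K T : ℝ}

lemma intervalIntegrable_sq_of_bounded (hg : Measurable g) (hK : ∀ t, |g t| ≤ K) (a b : ℝ) :
    IntervalIntegrable (fun t => g t ^ 2) volume a b :=
  intervalIntegrable_of_bounded (hg.pow_const 2) (C := K ^ 2) (fun t => by
    rw [abs_pow]
    exact pow_le_pow_left₀ (abs_nonneg _) (hK t) 2) a b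

/-- Cauchy–Schwarz, from the nonnegative integral of ((b - a) g - J)². -/
lemma sq_integral_le (hg : Measurable g) (hK : ∀ t, |g t| ≤ K) {a b : ℝ} (hab : a ≤ b) :
    (∫ t in a..b, g t) ^ 2 ≤ (b - a) * ∫ t in a..b, g t ^ 2 := by
  have hi := intervalIntegrable_of_bounded hg hK a b
  have hi2 := intervalIntegrable_sq_of_bounded hg hK a b
  rcases hab.eq_or_lt with rfl | hlt
  · simp
  have hL : 0 < b - a := sub_pos.2 hlt
  set J := ∫ t in a..b, g t
  have h : 0 ≤ ∫ t in a..b, ((b - a) * g t - J) ^ 2 :=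
    intervalIntegral.integral_nonneg hab fun t _ => sq_nonneg _
  have e : ∫ t in a..b, ((b - a) * g t - J) ^ 2
      = (b - a) ^ 2 * (∫ t in a..b, g t ^ 2) - (b - a) * J ^ 2 := by
    have e1 : (fun t => ((b - a) * g t - J) ^ 2)
        = fun t => ((b - a) ^ 2 * g t ^ 2 - 2 * (b - a) * J * g t) + J ^ 2 := by
      funext t
      ring
    rw [e1, intervalIntegral.integral_add ((hi2.const_mul _).sub (hi.const_mul _)) (by simp),
      intervalIntegral.integral_sub (hi2.const_mul _) (hi.const_mul _),
      intervalIntegral.integral_const_mul, intervalIntegral.integral_const_mul,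
      intervalIntegral.integral_const, smul_eq_mul]
    change _ - 2 * (b - a) * J * J + _ = _
    ring
  rw [e] at h
  have h2 : 0 ≤ (b - a) * ((b - a) * (∫ t in a..b, g t ^ 2) - J ^ 2) := by linarith
  have := nonneg_of_mul_nonneg_right h2 hL
  linarith

/-- Poincaré inequality for functions vanishing at T; it converts the kinetic gain of the
translation into a gain in the eigenvalue. -/
lemma integral_tail_sq_le (hT : 0 ≤ T) (hg : Measurable g) (hK : ∀ t, |g t| ≤ K) :
    ∫ t in (0 : ℝ)..T, tail T g t ^ 2 ≤ T ^ 2 * ∫ t in (0 : ℝ)..T, g t ^ 2 := by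
  have hi2 := intervalIntegrable_sq_of_bounded hg hK
  have h : ∀ t ∈ Icc 0 T, tail T g t ^ 2 ≤ T * ∫ t in (0 : ℝ)..T, g t ^ 2 := by
    intro t ht
    rw [tail, neg_sq]
    refine (sq_integral_le hg hK ht.2).trans ?_
    refine mul_le_mul (by linarith [ht.1]) ?_ ?_ hT
    · exact intervalIntegral.integral_mono_interval ht.1 ht.2 le_rfl
        (ae_of_all _ fun t => sq_nonneg _) (hi2 _ _)
    · exact intervalIntegral.integral_nonneg ht.2 fun t _ => sq_nonneg _
  have h1 := intervalIntegral.integral_mono_on hT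
    (((continuous_tail (T := T) hg hK).pow 2).intervalIntegrable 0 T)
    (continuous_const.intervalIntegrable (μ := volume) 0 T) h
  rw [intervalIntegral.integral_const, smul_eq_mul, sub_zero] at h1
  calc _ ≤ _ := h1
    _ = _ := by ring

end Poincare

/-- The potential shifted to the left by `t₁`, and extended by zero. -/
noncomputable def shiftLeft (T t₁ : ℝ) (v : ℝ → ℝ) : ℝ → ℝ :=
  (Iic (T - t₁)).indicator fun t => v (t + t₁)

section Shift

variable {R ts t₁ : ℝ} {v : ℝ → ℝ}

lemma measurable_shiftLeft (T t₁ : ℝ) (hv : Measurable v) : Measurable (shiftLeft T t₁ v) :=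
  (hv.comp (measurable_id.add_const t₁)).indicator measurableSet_Iic

lemma shiftLeft_mem_Icc (T t₁ : ℝ) (hv : ∀ t, v t ∈ Icc (0 : ℝ) 1) (t : ℝ) :
    shiftLeft T t₁ v t ∈ Icc (0 : ℝ) 1 := by
  by_cases h : t ∈ Iic (T - t₁)
  · rw [shiftLeft, indicator_of_mem h]
    exact hv _
  · rw [shiftLeft, indicator_of_notMem h]
    simp

lemma integral_shiftLeft_mul {T : ℝ} (h0 : 0 ≤ t₁) (hT : t₁ ≤ T) (v p : ℝ → ℝ) :
    ∫ t in (0 : ℝ)..T, shiftLeft T t₁ v t * p (t + t₁) = ∫ t in t₁..T, v t * p t := by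
  rw [integral_eq_of_eq_zero (t₀ := T - t₁) (by linarith) (by linarith) fun t ht => ?_]
  · have := intervalIntegral.integral_comp_add_right (a := 0) (b := T - t₁)
      (fun t => v t * p t) t₁
    rw [zero_add, sub_add_cancel] at this
    rw [← this]
    refine intervalIntegral.integral_congr fun t ht => ?_
    rw [uIcc_of_le (by linarith)] at ht
    simp only [shiftLeft, indicator_of_mem (show t ∈ Iic (T - t₁) from ht.2)]
  · rw [shiftLeft, indicator_of_notMem (show t ∉ Iic (T - t₁) from not_le.2 ht.1), zero_mul]

lemma integral_comp_add_of_eq_zero {T : ℝ} (h0 : 0 ≤ t₁) (hT : t₁ ≤ T) {F : ℝ → ℝ}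
    (hF : ∀ t, T < t → F t = 0) : ∫ t in (0 : ℝ)..T, F (t + t₁) = ∫ t in t₁..T, F t := by
  rw [integral_eq_of_eq_zero (t₀ := T - t₁) (by linarith) (by linarith)
    fun t ht => hF _ (by linarith [ht.1]), intervalIntegral.integral_comp_add_right, zero_add,
    sub_add_cancel]

/-- The point after which the ground state is strictly decreasing. -/
lemma exists_last_critical_point (hR : 0 < R) (hv : Measurable v) {b : ℝ} (hb : ∀ t, |v t| ≤ b) :
    ∃ t₁, 0 ≤ t₁ ∧ t₁ < R ^ 2 ∧ flux (shiftedPot R v) t₁ = 0 ∧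
      ∀ t ∈ Ioc t₁ (R ^ 2), 0 < flux (shiftedPot R v) t := by
  have hc := continuous_flux_ground R hv hb
  have hend := flux_ground_end_pos hR hv hb
  have hT : 0 < R ^ 2 := by positivity
  obtain ⟨t₁, ht₁, hmax⟩ := (isCompact_Icc.inter_right
    (isClosed_le hc continuous_const : IsClosed {t | flux (shiftedPot R v) t ≤ 0})).exists_isGreatest
      (s := Icc 0 (R ^ 2) ∩ {t | flux (shiftedPot R v) t ≤ 0})
      ⟨0, ⟨le_rfl, hT.le⟩, flux_zero.le⟩
  have hlt : t₁ < R ^ 2 := lt_of_le_of_ne ht₁.1.2 fun h => by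
    have := ht₁.2
    rw [h] at this
    exact absurd hend (not_lt.2 this)
  have hpos : ∀ t ∈ Ioc t₁ (R ^ 2), 0 < flux (shiftedPot R v) t := fun t ht => by
    by_contra hle
    exact absurd (hmax ⟨⟨ht₁.1.1.trans ht.1.le, ht.2⟩, not_lt.1 hle⟩) (not_le.2 ht.1)
  refine ⟨t₁, ht₁.1.1, hlt, le_antisymm ht₁.2 ?_, hpos⟩
  refine ge_of_tendsto (hc.tendsto t₁ |>.mono_left nhdsWithin_le_nhds : Tendsto _ (𝓝[>] t₁) _) ?_
  filter_upwards [Ioc_mem_nhdsGT hlt] with t ht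
  exact (hpos t ht).le

/-- The shifted ground state, its energy, and its comparison with `V*`. -/
lemma eig_segment_le (hR : 0 < R) (hts : 0 < ts) (htR : ts < R ^ 2) (hv : Measurable v)
    (hv1 : ∀ t, v t ∈ Icc (0 : ℝ) 1) (h0 : 0 ≤ t₁) (ht₁ : t₁ < R ^ 2)
    (hf0 : flux (shiftedPot R v) t₁ = 0)
    (hf : ∀ t ∈ Ioc t₁ (R ^ 2), 0 < flux (shiftedPot R v) t)
    (hmass : ∫ t in (0 : ℝ)..R ^ 2, shiftLeft (R ^ 2) t₁ v t ≤ ts) {s : ℝ} (hs : s ∈ Icc (0 : ℝ) 1) :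
    eig R (fun t => step ts t + s * (shiftLeft (R ^ 2) t₁ v t - step ts t))
      ≤ eig R v - 4 * t₁ / (R ^ 2) ^ 2 := by
  have hb : ∀ t, |v t| ≤ 1 := fun t => abs_le_one_of_mem_Icc (hv1 t)
  have hT : 0 < R ^ 2 := by positivity
  have hq := measurable_shiftedPot R hv
  have hB := abs_add_const_le hb (eig R v)
  obtain ⟨hupos, hu0⟩ := ground_pos_and_eq_zero hR hv hb
  have huc := continuous_ground R hv hb
  have hsm := measurable_shiftLeft (R ^ 2) t₁ hv
  have hs1 := shiftLeft_mem_Icc (R ^ 2) t₁ hv1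
  have hsb : ∀ t, |shiftLeft (R ^ 2) t₁ v t| ≤ 1 := fun t => abs_le_one_of_mem_Icc (hs1 t)
  set T := R ^ 2
  set z := shiftLeft T t₁ v
  have hGm := measurable_solDeriv hq hB T
  have hGb := abs_solDeriv_le hq hB hT.le
  set G := solDeriv (shiftedPot R v) T
  set K := (1 + |eig R v|) * (2 * Real.exp ((1 + |eig R v|) * T)) / 4
  -- The trial function is u(t + t₁), extended by zero. It is nonincreasing because the flux is
  -- positive beyond t₁.
  set g : ℝ → ℝ := fun t => G (t + t₁)
  have hgm : Measurable g := hGm.comp (measurable_id.add_const t₁)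
  have hgb : ∀ t, |g t| ≤ K := fun t => hGb _
  have hG0 : ∀ t, T < t → G t = 0 := fun t ht =>
    indicator_of_notMem (fun h => absurd h.2 (not_le.2 ht)) _
  have hGneg : ∀ t, t₁ < t → G t ≤ 0 := by
    intro t ht
    rcases le_or_gt t T with h | h
    · simp only [G]
      rw [solDeriv_of_mem ⟨h0.trans_lt ht, h⟩, neg_div]
      have := hf t ⟨ht, h⟩
      have h3 : 0 < t := h0.trans_lt ht
      exact neg_nonpos.2 (by positivity)
    · exact (hG0 t h).le
  have htail : ∀ t, tail T g t = tail (T + t₁) G (t + t₁) := by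
    intro t
    simp only [tail, g]
    rw [intervalIntegral.integral_comp_add_right]
  have htl : ∀ t ∈ Icc 0 (T - t₁), tail T g t = ground R v (t + t₁) := by
    intro t ht
    rw [htail]
    exact tail_solDeriv hq hB (by linarith) hu0 ⟨by linarith [ht.1], by linarith [ht.2]⟩
  have htz : ∀ t ∈ Icc (T - t₁) T, tail T g t = 0 := by
    intro t ht
    rw [htail]
    exact tail_solDeriv_of_le (by linarith [ht.1]) (by linarith [ht.2])
  have htc : Continuous (tail T g) := continuous_tail hgm hgb
  have htanti : ∀ a c, 0 ≤ a → a ≤ c → tail T g c ≤ tail T g a := by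
    intro a c ha hac
    have h1 : tail T g a = tail T g c + ∫ t in a..c, -g t := by
      have := intervalIntegral.integral_add_adjacent_intervals
        (intervalIntegrable_of_bounded hgm hgb a c) (intervalIntegrable_of_bounded hgm hgb c T)
      rw [intervalIntegral.integral_neg, tail, tail, ← this]
      ring
    have h2 : 0 ≤ ∫ t in a..c, -g t := by
      rw [intervalIntegral.integral_of_le hac]
      refine setIntegral_nonneg measurableSet_Ioc fun t ht => neg_nonneg.2 (hGneg _ ?_)
      linarith [ht.1]
    linarith
  have htnn : ∀ t ∈ Icc 0 T, 0 ≤ tail T g t := by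
    intro t ht
    have := htanti t T ht.1 ht.2
    rwa [tail, intervalIntegral.integral_same, neg_zero] at this
  have hcut : ∀ t ∈ Icc 0 T, tail T g t = (Iic T).indicator (ground R v) (t + t₁) := by
    intro t ht
    rcases le_or_gt t (T - t₁) with h | h
    · rw [htl t ⟨ht.1, h⟩, indicator_of_mem (show t + t₁ ∈ Iic T from le_sub_iff_add_le.1 h)]
    · rw [htz t ⟨h.le, ht.2⟩, indicator_of_notMem (show t + t₁ ∉ Iic T from
        not_le.2 (sub_lt_iff_lt_add.1 h))]
  have hin : ∀ t ∈ uIcc t₁ T, (Iic T).indicator (ground R v) t = ground R v t := fun t ht => by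
    rw [uIcc_of_le ht₁.le] at ht
    exact indicator_of_mem (show t ∈ Iic T from ht.2) _
  have hpot : ∫ t in (0 : ℝ)..T, z t * tail T g t ^ 2 = ∫ t in t₁..T, v t * ground R v t ^ 2 := by
    have e1 := integral_shiftLeft_mul h0 ht₁.le v fun t => (Iic T).indicator (ground R v) t ^ 2
    have e2 : ∫ t in t₁..T, v t * (Iic T).indicator (ground R v) t ^ 2
        = ∫ t in t₁..T, v t * ground R v t ^ 2 :=
      intervalIntegral.integral_congr fun t ht => by simp only [hin t ht]
    rw [← e2, ← e1]
    refine intervalIntegral.integral_congr fun t ht => ?_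
    rw [uIcc_of_le hT.le] at ht
    simp only [hcut t ht, z]
  have hnorm : ∫ t in (0 : ℝ)..T, tail T g t ^ 2 = ∫ t in t₁..T, ground R v t ^ 2 := by
    have e1 := integral_comp_add_of_eq_zero h0 ht₁.le
      (F := fun t => (Iic T).indicator (ground R v) t ^ 2) fun t ht => by
        simp only [indicator_of_notMem (show t ∉ Iic T from not_le.2 ht)]
        norm_num
    have e2 : ∫ t in t₁..T, (Iic T).indicator (ground R v) t ^ 2
        = ∫ t in t₁..T, ground R v t ^ 2 :=
      intervalIntegral.integral_congr fun t ht => by simp only [hin t ht]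
    rw [← e2, ← e1]
    refine intervalIntegral.integral_congr fun t ht => ?_
    rw [uIcc_of_le hT.le] at ht
    simp only [hcut t ht]
  have hg2 : ∫ t in (0 : ℝ)..T, g t ^ 2 = ∫ t in t₁..T, G t ^ 2 :=
    integral_comp_add_of_eq_zero h0 ht₁.le (F := fun t => G t ^ 2) fun t ht => by
      simp only [hG0 t ht]
      norm_num
  have hGi := intervalIntegrable_sq_of_bounded hGm hGb t₁ T
  have hGi4 : IntervalIntegrable (fun t => 4 * t * G t ^ 2) volume t₁ T :=
    hGi.continuousOn_mul (by fun_prop)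
  -- The translation lowers the weight from 4t to 4(t - t₁), which is the whole gain.
  have hkin : ∫ t in (0 : ℝ)..T, 4 * t * g t ^ 2
      = (∫ t in t₁..T, 4 * t * G t ^ 2) - 4 * t₁ * ∫ t in (0 : ℝ)..T, g t ^ 2 := by
    have e1 := integral_comp_add_of_eq_zero h0 ht₁.le (F := fun t => 4 * (t - t₁) * G t ^ 2)
      fun t ht => by
        simp only [hG0 t ht]
        norm_num
    simp only [add_sub_cancel_right] at e1
    rw [hg2, e1, ← intervalIntegral.integral_const_mul, ← intervalIntegral.integral_sub hGi4
      (hGi.const_mul _)]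
    congr 1
    funext t
    ring
  have hsqc : Continuous fun t => ground R v t ^ 2 := huc.pow 2
  -- Restricted to [t₁, T] the ground state still has Rayleigh quotient λ(v): flux(t₁) = 0 and u(T)
  -- = 0 remove the boundary terms.
  have hen : ∫ t in t₁..T, 4 * t * G t ^ 2
      = (∫ t in t₁..T, v t * ground R v t ^ 2) + eig R v * ∫ t in t₁..T, ground R v t ^ 2 := by
    have e1 := integral_energy_sol hq hB h0 ht₁.le
    have hu0' : sol (shiftedPot R v) T = 0 := hu0
    rw [hu0', hf0, mul_zero, zero_mul, sub_zero, sub_zero] at e1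
    have e2 : ∫ t in t₁..T, 4 * t * G t ^ 2
        = ∫ t in t₁..T, 4 * t * (-flux (shiftedPot R v) t / (4 * t)) ^ 2 := by
      refine intervalIntegral.integral_congr_ae (ae_of_all _ fun t ht => ?_)
      rw [uIoc_of_le ht₁.le] at ht
      simp only [G]
      rw [solDeriv_of_mem ⟨h0.trans_lt ht.1, ht.2⟩]
    rw [e2, e1, ← intervalIntegral.integral_const_mul, ← intervalIntegral.integral_add
      (intervalIntegrable_bounded_mul hv hb hsqc _ _) ((hsqc.intervalIntegrable _ _).const_mul _)]
    congr 1
    funext t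
    simp only [shiftedPot, ground]
    ring
  set w : ℝ → ℝ := fun t => step ts t + s * (z t - step ts t)
  have hwm : Measurable w :=
    (measurable_step ts).add ((hsm.sub (measurable_step ts)).const_mul s)
  have hwb : ∀ t, |w t| ≤ 1 := fun t => by
    refine abs_le_one_of_mem_Icc ?_
    have e : w t = (1 - s) * step ts t + s * z t := by
      simp only [w]
      ring
    have h1 := step_mem_Icc ts t
    have h2 := hs1 t
    rw [e]
    constructor
    · exact add_nonneg (mul_nonneg (sub_nonneg.2 hs.2) h1.1) (mul_nonneg hs.1 h2.1)
    · nlinarith [mul_le_mul_of_nonneg_left h1.2 (sub_nonneg.2 hs.2),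
        mul_le_mul_of_nonneg_left h2.2 hs.1]
  have hritz := firstEigenvalue_mul_le hR hwm hwb hgm hgb
  have htc2 : Continuous fun t => tail T g t ^ 2 := htc.pow 2
  -- The squared trial function is nonincreasing, so moving from the translated potential towards V*
  -- can only increase the potential term.
  have hbath : 0 ≤ ∫ t in (0 : ℝ)..T, (step ts t - z t) * tail T g t ^ 2 :=
    integral_step_sub_mul_nonneg hts.le htR.le hsm hs1 hmass htc2 (sq_nonneg _)
      (fun t ht => pow_le_pow_left₀ (htnn ts ⟨hts.le, htR.le⟩) (htanti t ts ht.1 ht.2) 2)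
      (fun t ht => pow_le_pow_left₀ (htnn t ⟨hts.le.trans ht.1, ht.2⟩)
        (htanti ts t hts.le ht.1) 2)
  have hwz : ∫ t in (0 : ℝ)..T, w t * tail T g t ^ 2
      = (∫ t in (0 : ℝ)..T, z t * tail T g t ^ 2)
        + (1 - s) * ∫ t in (0 : ℝ)..T, (step ts t - z t) * tail T g t ^ 2 := by
    have hi : IntervalIntegrable (fun t => (step ts t - z t) * tail T g t ^ 2) volume 0 T :=
      ((intervalIntegrable_of_bounded (measurable_step ts) (abs_step_le ts) _ _).sub
        (intervalIntegrable_of_bounded hsm hsb _ _)).mul_continuousOn htc2.continuousOn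
    rw [← intervalIntegral.integral_const_mul, ← intervalIntegral.integral_add
      (intervalIntegrable_bounded_mul hsm hsb htc2 _ _) (hi.const_mul _)]
    congr 1
    funext t
    simp only [w]
    ring
  have hpoin := integral_tail_sq_le hT.le hgm hgb
  have hI : 0 < ∫ t in (0 : ℝ)..T, tail T g t ^ 2 := by
    refine intervalIntegral.integral_pos hT htc2.continuousOn (fun t _ => sq_nonneg _)
      ⟨0, ⟨le_rfl, hT.le⟩, ?_⟩
    rw [htl 0 ⟨le_rfl, by linarith⟩, zero_add]
    exact pow_pos (hupos t₁ ⟨h0, ht₁⟩) 2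
  have hpos2 := mul_nonneg (sub_nonneg.2 hs.2) hbath
  rw [hwz, hkin, hen, hpot, ← hnorm] at hritz
  set I := ∫ t in (0 : ℝ)..T, tail T g t ^ 2
  set J := ∫ t in (0 : ℝ)..T, g t ^ 2
  refine le_of_mul_le_mul_right ?_ hI
  have h1 : 4 * t₁ / T ^ 2 * I ≤ 4 * t₁ * J := by
    calc 4 * t₁ / T ^ 2 * I ≤ 4 * t₁ / T ^ 2 * (T ^ 2 * J) := by gcongr
      _ = 4 * t₁ * J := by field_simp
  change firstEigenvalue R (radial w) * I ≤ _
  rw [sub_mul]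
  linarith

lemma deficit_segment {z : ℝ → ℝ} (s : ℝ) (hts : 0 ≤ ts) :
    deficit ts (fun t => step ts t + s * (z t - step ts t)) = s * deficit ts z := by
  rw [deficit, deficit, ← intervalIntegral.integral_const_mul]
  refine intervalIntegral.integral_congr fun t ht => ?_
  rw [uIcc_of_le hts] at ht
  simp only [step_of_le ht.2]
  ring

/-- Quadratic stability of `V*` among all admissible profiles. -/
lemma exists_global_stability (hR : 0 < R) (hts : 0 < ts) (htR : ts < R ^ 2) :
    ∃ c, 0 < c ∧ ∀ v : ℝ → ℝ, Measurable v → (∀ t, v t ∈ Icc (0 : ℝ) 1) →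
      ∫ t in (0 : ℝ)..R ^ 2, v t ≤ ts → c * deficit ts v ^ 2 ≤ eig R v - eig R (step ts) := by
  obtain ⟨d₀, c, hd₀, hc, hloc⟩ := exists_local_stability hR hts htR
  have hT : 0 < R ^ 2 := by positivity
  set T := R ^ 2
  -- No deficit exceeds ts, so this fixed s puts the point of the segment within range of the local
  -- estimate for every v.
  set s := min 1 (d₀ / ts)
  have hs : 0 < s := by positivity
  have hs1 : s ≤ 1 := min_le_left _ _
  have hsd : s * ts ≤ d₀ := by
    rw [← le_div_iff₀ hts]
    exact min_le_right _ _
  refine ⟨min (c * s ^ 2 / 4) (2 / T ^ 3), by positivity, fun v hv hv1 hvi => ?_⟩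
  have hb : ∀ t, |v t| ≤ 1 := fun t => abs_le_one_of_mem_Icc (hv1 t)
  obtain ⟨t₁, h0, ht₁, hf0, hf⟩ := exists_last_critical_point hR hv hb
  have hi := intervalIntegrable_of_mem_Icc hv hv1
  have hsm := measurable_shiftLeft T t₁ hv
  have hsI := shiftLeft_mem_Icc T t₁ hv1
  set z := shiftLeft T t₁ v
  have hzi := intervalIntegrable_of_mem_Icc hsm hsI
  have hmass : ∫ t in (0 : ℝ)..T, z t ≤ ts := by
    have e1 := integral_shiftLeft_mul h0 ht₁.le v fun _ => 1
    simp only [mul_one] at e1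
    rw [e1]
    refine le_trans ?_ hvi
    exact intervalIntegral.integral_mono_interval h0 ht₁.le le_rfl
      (ae_of_all _ fun t => (hv1 t).1) (hi _ _)
  have hdle : ∀ w : ℝ → ℝ, Measurable w → (∀ t, w t ∈ Icc (0 : ℝ) 1) → deficit ts w ≤ ts := by
    intro w hw hw1
    have := intervalIntegral.integral_mono_on hts.le
      ((intervalIntegrable_const (c := (1 : ℝ))).sub (intervalIntegrable_of_mem_Icc hw hw1 0 ts))
      (intervalIntegrable_const (c := (1 : ℝ))) (fun t _ => by linarith [(hw1 t).1])
    rw [intervalIntegral.integral_const, smul_eq_mul, mul_one, sub_zero] at this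
    exact this
  -- The translation brings at most mass t₁ from beyond ts into [0, ts], because v ≤ 1.
  have hdz : deficit ts v - t₁ ≤ deficit ts z := by
    have e0 : ∀ w : ℝ → ℝ, IntervalIntegrable w volume 0 ts →
        deficit ts w = ts - ∫ t in (0 : ℝ)..ts, w t := by
      intro w hw
      rw [deficit, intervalIntegral.integral_sub intervalIntegrable_const hw]
      simp
    rw [e0 v (hi _ _), e0 z (hzi _ _)]
    have e1 : ∫ t in (0 : ℝ)..ts, z t ≤ ∫ t in (0 : ℝ)..ts, v (t + t₁) := by
      refine intervalIntegral.integral_mono_on hts.le (hzi _ _)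
        (intervalIntegrable_of_mem_Icc (hv.comp (measurable_id.add_const t₁))
          (fun t => hv1 _) _ _) fun t _ => ?_
      by_cases h : t ∈ Iic (T - t₁)
      · exact (indicator_of_mem h _).le
      · exact (indicator_of_notMem h _).le.trans (hv1 _).1
    rw [intervalIntegral.integral_comp_add_right, zero_add] at e1
    have e2 : (∫ t in (0 : ℝ)..t₁, v t) + ∫ t in t₁..(ts + t₁), v t
        = (∫ t in (0 : ℝ)..ts, v t) + ∫ t in ts..(ts + t₁), v t := by
      rw [intervalIntegral.integral_add_adjacent_intervals (hi _ _) (hi _ _),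
        intervalIntegral.integral_add_adjacent_intervals (hi _ _) (hi _ _)]
    have e3 : 0 ≤ ∫ t in (0 : ℝ)..t₁, v t := intervalIntegral.integral_nonneg h0 fun t _ => (hv1 t).1
    have e4 := intervalIntegral.integral_mono_on (show ts ≤ ts + t₁ by linarith) (hi _ _)
      (intervalIntegrable_const (c := (1 : ℝ))) (fun t _ => (hv1 t).2)
    rw [intervalIntegral.integral_const, smul_eq_mul, mul_one, add_sub_cancel_left] at e4
    linarith
  have hseg := eig_segment_le hR hts htR hv hv1 h0 ht₁ hf0 hf hmass (s := s) ⟨hs.le, hs1⟩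
  set w : ℝ → ℝ := fun t => step ts t + s * (z t - step ts t)
  have hwm : Measurable w :=
    (measurable_step ts).add ((hsm.sub (measurable_step ts)).const_mul s)
  have ew : ∀ t, w t = (1 - s) * step ts t + s * z t := fun t => by
    simp only [w]
    ring
  have hw1 : ∀ t, w t ∈ Icc (0 : ℝ) 1 := fun t => by
    have h1 := step_mem_Icc ts t
    have h2 := hsI t
    rw [ew]
    constructor
    · exact add_nonneg (mul_nonneg (sub_nonneg.2 hs1) h1.1) (mul_nonneg hs.le h2.1)
    · nlinarith [mul_le_mul_of_nonneg_left h1.2 (sub_nonneg.2 hs1),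
        mul_le_mul_of_nonneg_left h2.2 hs.le]
  have hwi : ∫ t in (0 : ℝ)..T, w t ≤ ts := by
    simp only [ew]
    rw [intervalIntegral.integral_add
      ((intervalIntegrable_of_bounded (measurable_step ts) (abs_step_le ts) _ _).const_mul _)
      ((hzi _ _).const_mul _), intervalIntegral.integral_const_mul,
      intervalIntegral.integral_const_mul, integral_step hts.le htR.le]
    nlinarith
  have hdw : deficit ts w = s * deficit ts z := deficit_segment s hts.le
  have hst := hloc w hwm hw1 hwi (by
    rw [hdw]
    exact (mul_le_mul_of_nonneg_left (hdle z hsm hsI) hs.le).trans hsd)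
  rw [hdw] at hst
  have hd0 := deficit_nonneg hts.le hv1
  have hdt := hdle v hv hv1
  have hz0 := deficit_nonneg hts.le hsI
  set d := deficit ts v
  have hq0 : 0 ≤ 4 * t₁ / T ^ 2 := by positivity
  have hq1 : 0 ≤ c * (s * deficit ts z) ^ 2 := by positivity
  -- If t₁ ≥ d/2, the kinetic gain 4t₁/T² is at least 2d/T² ≥ 2d²/T³, as d ≤ T. Otherwise the
  -- translated profile keeps deficit at least d/2 and the local estimate applies.
  rcases le_or_gt (d / 2) t₁ with h | h
  · calc _ ≤ 2 / T ^ 3 * d ^ 2 := by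
          gcongr
          exact min_le_right _ _
      _ ≤ 2 / T ^ 3 * (d * T) := by
          rw [sq]
          gcongr
          linarith
      _ = 2 * d / T ^ 2 := by field_simp
      _ ≤ 4 * t₁ / T ^ 2 := div_le_div_of_nonneg_right (by linarith) (by positivity)
      _ ≤ _ := by linarith
  · calc _ ≤ c * s ^ 2 / 4 * d ^ 2 := by
          gcongr
          exact min_le_left _ _
      _ = c * (s * (d / 2)) ^ 2 := by ring
      _ ≤ c * (s * deficit ts z) ^ 2 := by
          gcongr
          linarith
      _ ≤ _ := by linarith

end Shift

/-! ### The annular minimiser by two bathtub problems. -/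

lemma integral_step_interval {a b τ : ℝ} (haτ : a ≤ τ) (hτb : τ ≤ b) :
    ∫ t in a..b, step τ t = τ - a := by
  have hs := intervalIntegrable_of_bounded (measurable_step τ) (abs_step_le τ)
  rw [← intervalIntegral.integral_add_adjacent_intervals (hs a τ) (hs τ b)]
  have e1 : ∫ t in a..τ, step τ t = ∫ _ in a..τ, (1 : ℝ) := by
    refine intervalIntegral.integral_congr_ae (ae_of_all _ fun t ht => ?_)
    rw [uIoc_of_le haτ] at ht
    exact step_of_le ht.2
  have e2 : ∫ t in τ..b, step τ t = ∫ _ in τ..b, (0 : ℝ) := by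
    refine intervalIntegral.integral_congr_ae (ae_of_all _ fun t ht => ?_)
    rw [uIoc_of_le hτb] at ht
    exact step_of_lt ht.1
  rw [e1, e2]
  simp

/-- The strict bathtub principle on an interval. -/
lemma bathtub_interval {a b τ : ℝ} (haτ : a ≤ τ) (hτb : τ ≤ b) {w p : ℝ → ℝ} (hw : Measurable w)
    (hw1 : ∀ t, w t ∈ Icc (0 : ℝ) 1) (hwi : ∫ t in a..b, w t = τ - a) (hp : Continuous p)
    (h1 : ∀ t ∈ Ico a τ, p τ < p t) (h2 : ∀ t ∈ Ioc τ b, p t < p τ) :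
    0 ≤ ∫ t in a..b, (step τ t - w t) * p t ∧
      (∫ t in a..b, (step τ t - w t) * p t ≤ 0 → ∀ᵐ t ∂volume.restrict (Ioc a b), w t = step τ t) := by
  have hab := haτ.trans hτb
  have hs := intervalIntegrable_of_bounded (measurable_step τ) (abs_step_le τ)
  have hsw : IntervalIntegrable (fun t => step τ t - w t) volume a b :=
    (hs a b).sub (intervalIntegrable_of_mem_Icc hw hw1 _ _)
  have hstep := integral_step_interval haτ hτb
  have hsp : IntervalIntegrable (fun t => (step τ t - w t) * (p t - p τ)) volume a b :=
    hsw.mul_continuousOn (hp.sub continuous_const).continuousOn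
  have e : ∫ t in a..b, (step τ t - w t) * p t
      = ∫ t in a..b, (step τ t - w t) * (p t - p τ) := by
    have e1 : ∫ t in a..b, (step τ t - w t) * (p t - p τ)
        = (∫ t in a..b, (step τ t - w t) * p t) - p τ * ∫ t in a..b, (step τ t - w t) := by
      rw [← intervalIntegral.integral_const_mul, ← intervalIntegral.integral_sub
        (hsw.mul_continuousOn hp.continuousOn) (hsw.const_mul _)]
      congr 1
      funext t
      ring
    rw [e1, intervalIntegral.integral_sub (hs a b) (intervalIntegrable_of_mem_Icc hw hw1 _ _),
      hstep, hwi, sub_self, mul_zero, sub_zero]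
  have hnn : ∀ t ∈ Ioc a b, 0 ≤ (step τ t - w t) * (p t - p τ) := by
    intro t ht
    rcases lt_trichotomy t τ with h | h | h
    · rw [step_of_le h.le]
      exact mul_nonneg (sub_nonneg.2 (hw1 t).2) (sub_nonneg.2 (h1 t ⟨ht.1.le, h⟩).le)
    · rw [h, sub_self, mul_zero]
    · rw [step_of_lt h]
      exact mul_nonneg_of_nonpos_of_nonpos (by linarith [(hw1 t).1])
        (sub_nonpos.2 (h2 t ⟨h, ht.2⟩).le)
  rw [e, intervalIntegral.integral_of_le hab]
  have hnn' : 0 ≤ᵐ[volume.restrict (Ioc a b)] fun t => (step τ t - w t) * (p t - p τ) :=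
    (ae_restrict_iff' measurableSet_Ioc).2 (ae_of_all _ hnn)
  refine ⟨integral_nonneg_of_ae hnn', fun hle => ?_⟩
  have h0 := (integral_eq_zero_iff_of_nonneg_ae hnn'
    ((intervalIntegrable_iff_integrableOn_Ioc_of_le hab).1 hsp)).1
    (le_antisymm hle (integral_nonneg_of_ae hnn'))
  have hne : ∀ᵐ t ∂volume.restrict (Ioc a b), t ≠ τ :=
    ae_restrict_of_ae (Measure.ae_ne volume τ)
  filter_upwards [h0, hne, ae_restrict_mem measurableSet_Ioc] with t ht htτ htm
  rcases mul_eq_zero.1 ht with h | h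
  · exact (sub_eq_zero.1 h).symm
  · exfalso
    rcases htτ.lt_or_gt with h' | h'
    · exact (h1 t ⟨htm.1.le, h'⟩).ne' (sub_eq_zero.1 h)
    · exact (h2 t ⟨h', htm.2⟩).ne (sub_eq_zero.1 h)

/-- The profile of the annular minimiser: `χ_{[0, ts - d]} + χ_{[ts, ts + d]}`, up to null sets. -/
noncomputable def annular (ts d : ℝ) : ℝ → ℝ :=
  fun t => if t ≤ ts then step (ts - d) t else step (ts + d) t

section Annular

variable {R ts d : ℝ}

lemma measurable_annular (ts d : ℝ) : Measurable (annular ts d) :=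
  Measurable.ite measurableSet_Iic (measurable_step _) (measurable_step _)

lemma annular_mem_Icc (ts d t : ℝ) : annular ts d t ∈ Icc (0 : ℝ) 1 := by
  unfold annular
  split_ifs
  exacts [step_mem_Icc _ _, step_mem_Icc _ _]

lemma annular_of_le {t : ℝ} (h : t ≤ ts) : annular ts d t = step (ts - d) t := if_pos h

lemma annular_of_lt {t : ℝ} (h : ts < t) : annular ts d t = step (ts + d) t := if_neg (not_le.2 h)

lemma integral_annular {T : ℝ} (hd0 : 0 ≤ d) (hd : d ≤ ts) (hdT : ts + d ≤ T) :
    ∫ t in (0 : ℝ)..T, annular ts d t = ts := by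
  rw [integral_split_step (by linarith : 0 ≤ ts) (by linarith : ts ≤ T)
    (intervalIntegrable_of_bounded (measurable_step (ts - d)) (abs_step_le _) _ _)
    (intervalIntegrable_of_bounded (measurable_step (ts + d)) (abs_step_le _) _ _)
    (fun t ht => annular_of_le ht.2) (fun t ht => annular_of_lt ht.1),
    integral_step_interval (by linarith) (by linarith),
    integral_step_interval (by linarith) hdT]
  ring

lemma deficit_annular (hd0 : 0 ≤ d) (hd : d ≤ ts) : deficit ts (annular ts d) = d := by
  rw [deficit, intervalIntegral.integral_sub (by simp)
    (intervalIntegrable_of_mem_Icc (measurable_annular ts d) (annular_mem_Icc ts d) _ _)]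
  have : ∫ t in (0 : ℝ)..ts, annular ts d t = ∫ t in (0 : ℝ)..ts, step (ts - d) t := by
    refine intervalIntegral.integral_congr fun t ht => ?_
    rw [uIcc_of_le (by linarith)] at ht
    exact annular_of_le ht.2
  rw [this, integral_step_interval (by linarith) (by linarith)]
  simp

/-- The annular profile is the unique minimiser among profiles of the same deficit. -/
lemma exists_annular_minimiser (hR : 0 < R) (hts : 0 < ts) (htR : ts < R ^ 2) :
    ∃ d₀, 0 < d₀ ∧ ∀ d, 0 < d → d ≤ d₀ → ∀ v : ℝ → ℝ, Measurable v →
      (∀ t, v t ∈ Icc (0 : ℝ) 1) → ∫ t in (0 : ℝ)..R ^ 2, v t = ts → deficit ts v = d →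
      eig R (annular ts d) ≤ eig R v ∧ (eig R v ≤ eig R (annular ts d) →
        ∀ᵐ t ∂volume.restrict (Ioc 0 (R ^ 2)), v t = annular ts d t) := by
  obtain ⟨e₀, c, he₀, hc, hsep⟩ := exists_ground_separation hR hts htR
  set T := R ^ 2
  refine ⟨min (e₀ / 2) (min (ts / 4) (T - ts)), lt_min (by positivity) (lt_min (by positivity)
    (sub_pos.2 htR)), fun d hd hd₀ v hv hv1 hvi hvd => ?_⟩
  have hd1 : d ≤ e₀ / 2 := hd₀.trans (min_le_left _ _)
  -- This places the threshold ts - d at or beyond 3ts/4, where ground states separate the points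
  -- before from those after.
  have hd2 : d ≤ ts / 4 := hd₀.trans ((min_le_right _ _).trans (min_le_left _ _))
  have hd3 : d ≤ T - ts := hd₀.trans ((min_le_right _ _).trans (min_le_right _ _))
  have hb : ∀ t, |v t| ≤ 1 := fun t => abs_le_one_of_mem_Icc (hv1 t)
  obtain ⟨hmon, -⟩ := hsep v hv (fun t => (hb t).trans one_le_two) (by
    rw [integral_abs_sub_step hv hv1 hts.le htR.le, hvi, hvd]
    linarith)
  have hi := intervalIntegrable_of_mem_Icc hv hv1
  -- Deficit and total mass fix the mass on each side of ts, so the problem decouples. The `- 0`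
  -- matches the form τ - a of `bathtub_interval`.
  have hi1 : ∫ t in (0 : ℝ)..ts, v t = ts - d - 0 := by
    rw [deficit, intervalIntegral.integral_sub (by simp) (hi _ _)] at hvd
    simp only [intervalIntegral.integral_const, sub_zero, smul_eq_mul, mul_one] at hvd
    linarith
  have hi2 : ∫ t in ts..T, v t = ts + d - ts := by
    have := intervalIntegral.integral_add_adjacent_intervals (hi 0 ts) (hi ts T)
    linarith
  have hc2 : Continuous fun t => ground R v t ^ 2 := (continuous_ground R hv hb).pow 2
  have hsq : ∀ τ ∈ Icc (3 * ts / 4) T, ∀ t ∈ Ico 0 τ, ground R v τ ^ 2 < ground R v t ^ 2 :=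
    fun τ hτ t ht => pow_lt_pow_left₀ (hmon τ hτ t ht)
      (ground_nonneg hR hv hb ⟨ht.1.trans ht.2.le, hτ.2⟩) two_ne_zero
  obtain ⟨b1, b1'⟩ := bathtub_interval (a := 0) (τ := ts - d) (b := ts) (by linarith)
    (by linarith) hv hv1 hi1 hc2 (hsq _ ⟨by linarith, by linarith⟩)
    (fun t ht => hsq t ⟨by linarith [ht.1], by linarith [ht.2]⟩ _ ⟨by linarith, ht.1⟩)
  obtain ⟨b2, b2'⟩ := bathtub_interval (a := ts) (τ := ts + d) (b := T) (by linarith)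
    (by linarith) hv hv1 hi2 hc2
    (fun t ht => hsq _ ⟨by linarith, by linarith⟩ t ⟨by linarith [ht.1], ht.2⟩)
    (fun t ht => hsq t ⟨by linarith [ht.1], by linarith [ht.2]⟩ _ ⟨by linarith, ht.1⟩)
  have hii : ∀ τ a b, IntervalIntegrable (fun t => (step τ t - v t) * ground R v t ^ 2) volume a b :=
    fun τ a b => ((intervalIntegrable_of_bounded (measurable_step τ) (abs_step_le τ) _ _).sub
      (hi _ _)).mul_continuousOn hc2.continuousOn
  have e : ∫ t in (0 : ℝ)..T, (annular ts d t - v t) * ground R v t ^ 2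
      = (∫ t in (0 : ℝ)..ts, (step (ts - d) t - v t) * ground R v t ^ 2)
        + ∫ t in ts..T, (step (ts + d) t - v t) * ground R v t ^ 2 :=
    integral_split_step hts.le htR.le (hii _ _ _) (hii _ _ _)
      (fun t ht => by rw [annular_of_le ht.2]) (fun t ht => by rw [annular_of_lt ht.1])
  -- The weight is the ground state of the competitor, so the sign of the bathtub integrals settles
  -- the comparison, and equality there forces the profile.
  have hritz := eig_sub_eig_mul_le hR (measurable_annular ts d)
    (fun t => abs_le_one_of_mem_Icc (annular_mem_Icc ts d t)) hv hb
  have hneg : ∫ t in (0 : ℝ)..T, (v t - annular ts d t) * ground R v t ^ 2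
      = -∫ t in (0 : ℝ)..T, (annular ts d t - v t) * ground R v t ^ 2 := by
    rw [← intervalIntegral.integral_neg]
    congr 1
    funext t
    ring
  rw [hneg, e] at hritz
  have hn := normSq_pos hR hv hb
  refine ⟨?_, fun hle => ?_⟩
  · have h1 : (eig R (annular ts d) - eig R v) * normSq R v ≤ 0 := by linarith
    have h2 := nonpos_of_mul_nonpos_left h1 hn
    linarith
  · have h1 : 0 ≤ (eig R (annular ts d) - eig R v) * normSq R v :=
      mul_nonneg (sub_nonneg.2 hle) hn.le
    have h3 := b1' (by linarith)
    have h4 := b2' (by linarith)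
    rw [← Ioc_union_Ioc_eq_Ioc hts.le htR.le, ae_restrict_union_iff]
    constructor
    · filter_upwards [h3, ae_restrict_mem measurableSet_Ioc] with t ht htm
      rw [ht, annular_of_le htm.2]
    · filter_upwards [h4, ae_restrict_mem measurableSet_Ioc] with t ht htm
      rw [ht, annular_of_lt htm.1]

end Annular

/-! ### Differentiability of the eigenvalue along a segment. -/

/-- The segment of profiles from `v` to `w`. -/
def profileSegment (v w : ℝ → ℝ) (s : ℝ) : ℝ → ℝ := fun t => v t + s * (w t - v t)

/-- The slope of the eigenvalue along a segment of profiles. -/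
noncomputable def eigSlope (R : ℝ) (v w : ℝ → ℝ) (s : ℝ) : ℝ :=
  (∫ t in (0 : ℝ)..R ^ 2, (v t - w t) * ground R (profileSegment v w s) t ^ 2)
    / normSq R (profileSegment v w s)

section Segment

variable {R b s t : ℝ} {v w : ℝ → ℝ}

/-- Feeds the continuity of the slope: k = v - w treats its numerator and k = 1 its denominator. -/
lemma exists_abs_integral_ground_sq_sub_le (hR : 0 < R) (b : ℝ) : ∃ C, 0 ≤ C ∧
    ∀ v w k : ℝ → ℝ, Measurable v → (∀ t, |v t| ≤ b) → Measurable w → (∀ t, |w t| ≤ b) →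
      Measurable k → (∀ t, |k t| ≤ 1) →
      |(∫ t in (0 : ℝ)..R ^ 2, k t * ground R v t ^ 2)
        - ∫ t in (0 : ℝ)..R ^ 2, k t * ground R w t ^ 2|
        ≤ C * √(∫ t in (0 : ℝ)..R ^ 2, |v t - w t|) := by
  obtain ⟨C, hC, h⟩ := exists_abs_sub_le hR b
  have hT : 0 ≤ R ^ 2 := by positivity
  set M := 2 * Real.exp (potBound R b * R ^ 2)
  refine ⟨C * (2 * M) * R ^ 2, by positivity, fun v w k hv hbv hw hbw hk hk1 => ?_⟩
  obtain ⟨-, h2⟩ := h v w hv hbv hw hbw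
  set D := ∫ t in (0 : ℝ)..R ^ 2, |v t - w t|
  have hcv : Continuous fun t => ground R v t ^ 2 := (continuous_ground R hv hbv).pow 2
  have hcw : Continuous fun t => ground R w t ^ 2 := (continuous_ground R hw hbw).pow 2
  rw [← intervalIntegral.integral_sub (intervalIntegrable_bounded_mul hk hk1 hcv _ _)
    (intervalIntegrable_bounded_mul hk hk1 hcw _ _), ← Real.norm_eq_abs]
  have h3 := intervalIntegral.norm_integral_le_of_norm_le_const (a := 0) (b := R ^ 2)
    (f := fun t => k t * ground R v t ^ 2 - k t * ground R w t ^ 2) (C := C * √D * (2 * M)) ?_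
  · refine h3.trans (le_of_eq ?_)
    rw [sub_zero, abs_of_nonneg hT]
    ring
  · intro t ht
    rw [uIoc_of_le hT] at ht
    have ht' : t ∈ Icc 0 (R ^ 2) := ⟨ht.1.le, ht.2⟩
    have e : k t * ground R v t ^ 2 - k t * ground R w t ^ 2
        = k t * ((ground R v t - ground R w t) * (ground R v t + ground R w t)) := by ring
    rw [e, Real.norm_eq_abs, abs_mul, abs_mul]
    have h4 : |ground R v t + ground R w t| ≤ 2 * M :=
      (abs_add_le _ _).trans (by linarith [abs_ground_le hR hv hbv ht', abs_ground_le hR hw hbw ht'])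
    calc _ ≤ 1 * (C * √D * (2 * M)) := by
          gcongr
          exacts [hk1 t, (h2 t ht').1]
      _ = _ := one_mul _

lemma measurable_profileSegment (hv : Measurable v) (hw : Measurable w) (s : ℝ) :
    Measurable (profileSegment v w s) := hv.add ((hw.sub hv).const_mul s)

lemma abs_sub_le_one_of_mem_Icc {x y : ℝ} (hx : x ∈ Icc (0 : ℝ) 1) (hy : y ∈ Icc (0 : ℝ) 1) :
    |x - y| ≤ 1 := abs_le.2 ⟨by linarith [hx.1, hy.2], by linarith [hx.2, hy.1]⟩

/-- The parameter range exceeds [0, 1] so that both endpoints become interior and the derivative is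
two-sided there; the price is the bound 2 in place of 1. -/
lemma abs_profileSegment_le (hv : ∀ t, v t ∈ Icc (0 : ℝ) 1) (hw : ∀ t, w t ∈ Icc (0 : ℝ) 1)
    (hs : s ∈ Icc (-1 : ℝ) 2) (t : ℝ) : |profileSegment v w s t| ≤ 2 := by
  have h1 := hv t
  have h2 := hw t
  have e : profileSegment v w s t = (1 - s) * v t + s * w t := by
    simp only [profileSegment]
    ring
  have h3 := hs.1
  have h4 := hs.2
  rw [e]
  refine abs_le.2 ⟨?_, ?_⟩
  · nlinarith [h1.1, h1.2, h2.1, h2.2, mul_nonneg (by linarith : 0 ≤ s + 1) h2.1,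
      mul_nonneg (by linarith : 0 ≤ 2 - s) h1.1]
  · nlinarith [h1.1, h1.2, h2.1, h2.2, mul_nonneg (by linarith : 0 ≤ s + 1) (sub_nonneg.2 h1.2),
      mul_nonneg (by linarith : 0 ≤ 2 - s) (sub_nonneg.2 h2.2),
      mul_nonneg (by linarith : 0 ≤ s + 1) (sub_nonneg.2 h2.2),
      mul_nonneg (by linarith : 0 ≤ 2 - s) (sub_nonneg.2 h1.2)]

lemma integral_abs_profileSegment_sub (R : ℝ) (v w : ℝ → ℝ) (s t : ℝ) :
    ∫ σ in (0 : ℝ)..R ^ 2, |profileSegment v w s σ - profileSegment v w t σ|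
      = |s - t| * ∫ σ in (0 : ℝ)..R ^ 2, |w σ - v σ| := by
  rw [← intervalIntegral.integral_const_mul]
  congr 1
  funext σ
  rw [← abs_mul]
  congr 1
  simp only [profileSegment]
  ring

/-- A supporting line from above, obtained by testing the potential at s with the ground state at t.
-/
lemma eig_profileSegment_sub_le (hR : 0 < R) (hv : Measurable v) (hv1 : ∀ t, v t ∈ Icc (0 : ℝ) 1)
    (hw : Measurable w) (hw1 : ∀ t, w t ∈ Icc (0 : ℝ) 1) (hs : s ∈ Icc (-1 : ℝ) 2)
    (ht : t ∈ Icc (-1 : ℝ) 2) :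
    eig R (profileSegment v w s) - eig R (profileSegment v w t) ≤ (s - t) * eigSlope R v w t := by
  have hm := measurable_profileSegment hv hw
  have h := eig_sub_eig_mul_le hR (hm s) (abs_profileSegment_le hv1 hw1 hs) (hm t)
    (abs_profileSegment_le hv1 hw1 ht)
  have hn := normSq_pos hR (hm t) (abs_profileSegment_le hv1 hw1 ht)
  have e : ∫ σ in (0 : ℝ)..R ^ 2, (profileSegment v w t σ - profileSegment v w s σ)
        * ground R (profileSegment v w t) σ ^ 2
      = (s - t) * ∫ σ in (0 : ℝ)..R ^ 2, (v σ - w σ) * ground R (profileSegment v w t) σ ^ 2 := by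
    rw [← intervalIntegral.integral_const_mul]
    congr 1
    funext σ
    simp only [profileSegment]
    ring
  rw [e, ← le_div_iff₀ hn] at h
  rwa [eigSlope, ← mul_div_assoc]

lemma continuousAt_eigSlope (hR : 0 < R) (hv : Measurable v) (hv1 : ∀ t, v t ∈ Icc (0 : ℝ) 1)
    (hw : Measurable w) (hw1 : ∀ t, w t ∈ Icc (0 : ℝ) 1) (ht : t ∈ Ioo (-1 : ℝ) 2) :
    ContinuousAt (eigSlope R v w) t := by
  obtain ⟨C, hC, h⟩ := exists_abs_integral_ground_sq_sub_le hR 2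
  have hm := measurable_profileSegment hv hw
  have hb : ∀ s ∈ Icc (-1 : ℝ) 2, ∀ σ, |profileSegment v w s σ| ≤ 2 := fun s hs =>
    abs_profileSegment_le hv1 hw1 hs
  have htI : t ∈ Icc (-1 : ℝ) 2 := Ioo_subset_Icc_self ht
  have hcont : ∀ k : ℝ → ℝ, Measurable k → (∀ t, |k t| ≤ 1) →
      ContinuousAt (fun s => ∫ σ in (0 : ℝ)..R ^ 2, k σ * ground R (profileSegment v w s) σ ^ 2)
        t := by
    intro k hk hk1
    rw [ContinuousAt, tendsto_iff_dist_tendsto_zero]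
    have hlim : Tendsto (fun s => C * √(|s - t| * ∫ σ in (0 : ℝ)..R ^ 2, |w σ - v σ|)) (𝓝 t)
        (𝓝 0) := by
      have hc : Continuous fun s => C * √(|s - t| * ∫ σ in (0 : ℝ)..R ^ 2, |w σ - v σ|) := by
        fun_prop
      have := hc.tendsto t
      simpa using this
    refine squeeze_zero' (Eventually.of_forall fun s => dist_nonneg) ?_ hlim
    filter_upwards [Ioo_mem_nhds ht.1 ht.2] with s hs
    have hsI := Ioo_subset_Icc_self hs
    rw [Real.dist_eq, ← integral_abs_profileSegment_sub]
    exact h _ _ k (hm s) (hb s hsI) (hm t) (hb t htI) hk hk1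
  have hn := hcont (fun _ => 1) measurable_const (by simp)
  simp only [one_mul] at hn
  exact (hcont (fun σ => v σ - w σ) (hv.sub hw)
    fun σ => abs_sub_le_one_of_mem_Icc (hv1 σ) (hw1 σ)).div hn
      (normSq_pos hR (hm t) (hb t htI)).ne'

/-- The supporting lines at t and at s squeeze the increment between (s - t) times the slope at s
and (s - t) times the slope at t; continuity of the slope closes the gap. -/
lemma hasDerivAt_eig_profileSegment (hR : 0 < R) (hv : Measurable v)
    (hv1 : ∀ t, v t ∈ Icc (0 : ℝ) 1) (hw : Measurable w) (hw1 : ∀ t, w t ∈ Icc (0 : ℝ) 1)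
    (ht : t ∈ Ioo (-1 : ℝ) 2) :
    HasDerivAt (fun s => eig R (profileSegment v w s)) (eigSlope R v w t) t := by
  have hc := continuousAt_eigSlope hR hv hv1 hw hw1 ht
  rw [hasDerivAt_iff_isLittleO, Asymptotics.isLittleO_iff]
  intro ε hε
  filter_upwards [Ioo_mem_nhds ht.1 ht.2, Metric.continuousAt_iff'.1 hc ε hε] with s hs hd
  have h1 := eig_profileSegment_sub_le hR hv hv1 hw hw1 (Ioo_subset_Icc_self hs)
    (Ioo_subset_Icc_self ht)
  have h2 := eig_profileSegment_sub_le hR hv hv1 hw hw1 (Ioo_subset_Icc_self ht)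
    (Ioo_subset_Icc_self hs)
  rw [Real.dist_eq] at hd
  rw [smul_eq_mul, Real.norm_eq_abs, Real.norm_eq_abs]
  have h3 : |(s - t) * (eigSlope R v w s - eigSlope R v w t)| ≤ ε * |s - t| := by
    rw [abs_mul, mul_comm]
    gcongr
  refine le_trans ?_ h3
  have h4 := le_abs_self (-((s - t) * (eigSlope R v w s - eigSlope R v w t)))
  rw [abs_neg] at h4
  refine abs_le.2 ⟨by linarith, ?_⟩
  have h5 := abs_nonneg ((s - t) * (eigSlope R v w s - eigSlope R v w t))
  linarith

/-- A supporting line from above determines the slope. -/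
lemma eigSlope_eq_of_le (hR : 0 < R) (hv : Measurable v)
    (hv1 : ∀ t, v t ∈ Icc (0 : ℝ) 1) (hw : Measurable w) (hw1 : ∀ t, w t ∈ Icc (0 : ℝ) 1)
    (ht : t ∈ Ioo (-1 : ℝ) 2) {D : ℝ} (hD : ∀ s ∈ Ioo (-1 : ℝ) 2,
      eig R (profileSegment v w s) - eig R (profileSegment v w t) ≤ (s - t) * D) :
    eigSlope R v w t = D := by
  have h := (hasDerivAt_eig_profileSegment hR hv hv1 hw hw1 ht).sub
    ((hasDerivAt_id t).mul_const D)
  have hmax : IsLocalMax ((fun s => eig R (profileSegment v w s)) - fun s => id s * D) t := by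
    filter_upwards [Ioo_mem_nhds ht.1 ht.2] with s hs
    have := hD s hs
    simp only [Pi.sub_apply, id]
    linarith
  have := hmax.hasDerivAt_eq_zero h
  linarith

/-- The slope towards the annular profile is bounded below. -/
lemma exists_le_eigSlope (hR : 0 < R) {ts : ℝ} (hts : 0 < ts) (htR : ts < R ^ 2) :
    ∃ d₀ c, 0 < d₀ ∧ 0 < c ∧ ∀ d, 0 < d → d ≤ d₀ → ∀ t ∈ Icc (0 : ℝ) 1,
      c * d ^ 2 ≤ eigSlope R (step ts) (annular ts d) t := by
  obtain ⟨d₀, c, hd₀, hc, h⟩ := exists_first_variation_le hR hts htR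
  refine ⟨min (d₀ / 2) (min ts (R ^ 2 - ts)), c, lt_min (by positivity)
    (lt_min hts (sub_pos.2 htR)), hc, fun d hd hdd t ht => ?_⟩
  have hd1 : d ≤ d₀ / 2 := hdd.trans (min_le_left _ _)
  have hd2 : d ≤ ts := hdd.trans ((min_le_right _ _).trans (min_le_left _ _))
  have hd3 : d ≤ R ^ 2 - ts := hdd.trans ((min_le_right _ _).trans (min_le_right _ _))
  have hm := measurable_profileSegment (measurable_step ts) (measurable_annular ts d) t
  have hb := abs_profileSegment_le (step_mem_Icc ts) (annular_mem_Icc ts d) (s := t)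
    ⟨by linarith [ht.1], by linarith [ht.2]⟩
  have hia := integral_annular hd.le hd2 (T := R ^ 2) (by linarith)
  have hda := deficit_annular hd.le hd2
  have e := integral_abs_profileSegment_sub R (step ts) (annular ts d) t 0
  have e0 : profileSegment (step ts) (annular ts d) 0 = step ts := by
    funext σ
    simp [profileSegment]
  rw [e0, integral_abs_sub_step (measurable_annular ts d) (annular_mem_Icc ts d) hts.le htR.le,
    hia, hda, sub_self, sub_zero, add_zero, abs_of_nonneg ht.1] at e
  -- The point at parameter t is at distance 2dt ≤ d₀ from V*. The deficit in the estimate is that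
  -- of the endpoint, namely d, so the bound does not degenerate as t → 0.
  have h1 := h _ _ hm hb (by rw [e]; nlinarith [ht.1, ht.2]) (measurable_annular ts d)
    (annular_mem_Icc ts d) hia.le
  rw [hda] at h1
  rw [eigSlope, le_div_iff₀ (normSq_pos hR hm hb)]
  exact h1

end Segment

/-! ### Passage between potentials on the disc and their profiles. -/

section Transfer

variable {R V₀ rs δ d : ℝ} {V W u : Plane → ℝ} {v w : ℝ → ℝ}

lemma IsEigenfunction.congr (h : V =ᵐ[muOmega R] W) (hu : IsEigenfunction R V u) :
    IsEigenfunction R W u := by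
  obtain ⟨G, hm, hn, hw⟩ := hu
  refine ⟨G, hm, hn, fun φ hφ => ?_⟩
  rw [← firstEigenvalue_congr h, ← hw φ hφ]
  congr 1
  refine integral_congr_ae ?_
  filter_upwards [h] with x hx
  rw [hx]

lemma ae_normSq_ne (hR : 0 < R) (c : ℝ) : ∀ᵐ x ∂(muOmega R), ‖x‖ ^ 2 ≠ c :=
  ae_radial hR (ae_restrict_of_ae (Measure.ae_ne volume c))

lemma radial_congr (hR : 0 < R) (h : ∀ᵐ t ∂volume.restrict (Ioc 0 (R ^ 2)), v t = w t) :
    radial v =ᵐ[muOmega R] radial w := ae_radial hR h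

lemma VStar_ae_eq (hR : 0 < R) (hrs : 0 < rs) :
    VStar rs =ᵐ[muOmega R] radial (step (rs ^ 2)) := by
  filter_upwards [ae_normSq_ne hR (rs ^ 2)] with x hx
  rcases lt_or_ge ‖x‖ rs with h | h
  · have h2 : ‖x‖ ^ 2 ≤ rs ^ 2 := pow_le_pow_left₀ (norm_nonneg _) h.le 2
    rw [radial, step_of_le h2, VStar, chi, indicator_of_mem (by simpa using h)]
  · have h2 : rs ^ 2 < ‖x‖ ^ 2 := lt_of_le_of_ne (pow_le_pow_left₀ hrs.le h 2) hx.symm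
    rw [radial, step_of_lt h2, VStar, chi, indicator_of_notMem (by simpa using h)]

/-- The radii satisfy (rs - a)² = rs² - d and (rs + b)² = rs² + d, so the removed and the added ring
both have area πd. The circle |x| = rs, where the two descriptions disagree, is null. -/
lemma chi_annularSet_ae_eq (hR : 0 < R) (hrs : 0 < rs) (hd0 : 0 < d) (hd : d ≤ rs ^ 2) :
    chi (annularSet rs (rs - √(rs ^ 2 - d)) (√(rs ^ 2 + d) - rs))
      =ᵐ[muOmega R] radial (annular (rs ^ 2) d) := by
  filter_upwards [ae_normSq_ne hR (rs ^ 2)] with x hx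
  have hn := norm_nonneg x
  have e1 : ‖x‖ ≤ √(rs ^ 2 - d) ↔ ‖x‖ ^ 2 ≤ rs ^ 2 - d := Real.le_sqrt hn (by linarith)
  have e2 : ‖x‖ ≤ √(rs ^ 2 + d) ↔ ‖x‖ ^ 2 ≤ rs ^ 2 + d := Real.le_sqrt hn (by positivity)
  have e3 : rs ≤ ‖x‖ ↔ rs ^ 2 ≤ ‖x‖ ^ 2 := (sq_le_sq₀ hrs.le hn).symm
  have hmem : x ∈ annularSet rs (rs - √(rs ^ 2 - d)) (√(rs ^ 2 + d) - rs)
      ↔ ‖x‖ ^ 2 ≤ rs ^ 2 - d ∨ (rs ^ 2 ≤ ‖x‖ ^ 2 ∧ ‖x‖ ^ 2 ≤ rs ^ 2 + d) := by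
    rw [← e1, ← e2, ← e3]
    simp [annularSet]
  rw [radial]
  rcases lt_or_gt_of_ne hx with h | h
  · rw [annular_of_le h.le]
    rcases le_or_gt (‖x‖ ^ 2) (rs ^ 2 - d) with h' | h'
    · rw [step_of_le h', chi, indicator_of_mem (hmem.2 (Or.inl h'))]
    · rw [step_of_lt h', chi, indicator_of_notMem]
      rw [hmem]
      rintro (h2 | h2)
      · exact absurd h2 (not_le.2 h')
      · exact absurd h2.1 (not_le.2 h)
  · rw [annular_of_lt h]
    rcases le_or_gt (‖x‖ ^ 2) (rs ^ 2 + d) with h' | h'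
    · rw [step_of_le h', chi, indicator_of_mem (hmem.2 (Or.inr ⟨h.le, h'⟩))]
    · rw [step_of_lt h', chi, indicator_of_notMem]
      rw [hmem]
      rintro (h2 | h2)
      · linarith
      · exact absurd h2.2 (not_le.2 h')

lemma volume_Omega_toReal (hR : 0 < R) : (volume (Omega R)).toReal = Real.pi * R ^ 2 := by
  have h := integral_radial (f := fun _ => (1 : ℝ)) hR measurable_const
  simp only [radial, integral_const, intervalIntegral.integral_const, smul_eq_mul, mul_one,
    sub_zero] at h
  simpa [muOmega, Measure.real] using h

lemma radius_bounds (hR : 0 < R) (hV₀ : 0 < V₀) (hV₁ : V₀ < 1) (hrs : VStar rs ∈ admissible R V₀) :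
    0 < rs ∧ rs < R := by
  obtain ⟨-, -, hm⟩ := hrs
  constructor
  · by_contra hle
    rw [not_lt] at hle
    have : VStar rs = fun _ => 0 := by
      funext x
      simp [VStar, chi, Metric.ball_eq_empty.2 hle]
    rw [this] at hm
    simp only [integral_zero, mul_zero] at hm
    linarith
  · by_contra hle
    rw [not_lt] at hle
    have e : VStar rs =ᵐ[muOmega R] radial fun _ => (1 : ℝ) := by
      filter_upwards [ae_mem_Omega R] with x hx
      have hx' : x ∈ Metric.ball (0 : Plane) rs := Metric.ball_subset_ball hle hx
      rw [VStar, chi, indicator_of_mem hx', radial]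
    rw [integral_congr_ae e, integral_radial hR measurable_const, volume_Omega_toReal hR] at hm
    simp only [intervalIntegral.integral_const, smul_eq_mul, mul_one, sub_zero] at hm
    rw [inv_mul_cancel₀ (by positivity)] at hm
    linarith

/-- Admissibility of V* expresses V₀ through rs and R, after which V₀ is no longer needed. -/
lemma mean_eq_iff (hR : 0 < R) (hr0 : 0 < rs) (hrR : rs < R) (hrs : VStar rs ∈ admissible R V₀)
    (hv : Measurable v) (hV : V =ᵐ[muOmega R] radial v) :
    ((volume (Omega R)).toReal)⁻¹ * (∫ x, V x ∂(muOmega R)) = V₀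
      ↔ ∫ t in (0 : ℝ)..R ^ 2, v t = rs ^ 2 := by
  have h := hrs.2.2
  rw [integral_congr_ae (VStar_ae_eq hR hr0), integral_radial hR (measurable_step _),
    integral_step (by positivity) (pow_le_pow_left₀ hr0.le hrR.le 2), volume_Omega_toReal hR] at h
  rw [integral_congr_ae hV, integral_radial hR hv, volume_Omega_toReal hR, ← h]
  have h1 : (Real.pi * R ^ 2)⁻¹ ≠ 0 := by positivity
  constructor
  · intro h2
    exact mul_left_cancel₀ Real.pi_ne_zero (mul_left_cancel₀ h1 h2)
  · intro h2
    rw [h2]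

lemma integral_abs_sub_VStar (hR : 0 < R) (hr0 : 0 < rs) (hrR : rs < R) (hv : Measurable v)
    (hv1 : ∀ t, v t ∈ Icc (0 : ℝ) 1) (hvi : ∫ t in (0 : ℝ)..R ^ 2, v t = rs ^ 2)
    (hV : V =ᵐ[muOmega R] radial v) :
    ∫ x, |V x - VStar rs x| ∂(muOmega R) = 2 * Real.pi * deficit (rs ^ 2) v := by
  have e : (fun x => |V x - VStar rs x|) =ᵐ[muOmega R] radial fun t => |v t - step (rs ^ 2) t| := by
    filter_upwards [hV, VStar_ae_eq hR hr0] with x h1 h2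
    rw [h1, h2]
    rfl
  have hm : Measurable fun t => |v t - step (rs ^ 2) t| :=
    continuous_abs.measurable.comp (hv.sub (measurable_step _))
  rw [integral_congr_ae e, integral_radial hR hm,
    integral_abs_sub_step hv hv1 (by positivity) (pow_le_pow_left₀ hr0.le hrR.le 2), hvi]
  ring

/-- Clamping to [0, 1] makes the almost-everywhere bounds hold everywhere within the same class. The
relation δ = 2πd combines the factor π of the change of variables with the factor 2 from equal
masses. -/
lemma exists_profile (hR : 0 < R) (hr0 : 0 < rs) (hrR : rs < R) (hrs : VStar rs ∈ admissible R V₀)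
    (hV : V ∈ radialAdmissible R V₀ rs δ) : ∃ v : ℝ → ℝ, Measurable v ∧
      (∀ t, v t ∈ Icc (0 : ℝ) 1) ∧ V =ᵐ[muOmega R] radial v ∧
      ∫ t in (0 : ℝ)..R ^ 2, v t = rs ^ 2 ∧ deficit (rs ^ 2) v = δ / (2 * Real.pi) := by
  obtain ⟨⟨-, h01, hmean⟩, ⟨f, hf, hVf⟩, hdist⟩ := hV
  set v : ℝ → ℝ := fun t => max 0 (min 1 (f (√t)))
  have hv : Measurable v :=
    measurable_const.max (measurable_const.min (hf.comp Real.continuous_sqrt.measurable))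
  have hv1 : ∀ t, v t ∈ Icc (0 : ℝ) 1 := fun t =>
    ⟨le_max_left _ _, max_le zero_le_one (min_le_left _ _)⟩
  have hVv : V =ᵐ[muOmega R] radial v := by
    filter_upwards [h01, hVf] with x h1 h2
    simp only [radial, v, Real.sqrt_sq (norm_nonneg x)]
    rw [← h2, min_eq_right h1.2, max_eq_right h1.1]
  have hvi := (mean_eq_iff hR hr0 hrR hrs hv hVv).1 hmean
  refine ⟨v, hv, hv1, hVv, hvi, ?_⟩
  rw [integral_abs_sub_VStar hR hr0 hrR hv hv1 hvi hVv] at hdist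
  rw [← hdist]
  field_simp

lemma mem_radialAdmissible (hR : 0 < R) (hr0 : 0 < rs) (hrR : rs < R)
    (hrs : VStar rs ∈ admissible R V₀) (hv : Measurable v) (hv1 : ∀ t, v t ∈ Icc (0 : ℝ) 1)
    (hV : V =ᵐ[muOmega R] radial v) (hvi : ∫ t in (0 : ℝ)..R ^ 2, v t = rs ^ 2)
    (hd : deficit (rs ^ 2) v = δ / (2 * Real.pi)) : V ∈ radialAdmissible R V₀ rs δ := by
  refine ⟨⟨⟨radial v, (measurable_radial hv).stronglyMeasurable, hV⟩, ?_,
    (mean_eq_iff hR hr0 hrR hrs hv hV).2 hvi⟩, ⟨fun r => v (r ^ 2), hv.comp (by fun_prop), hV⟩, ?_⟩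
  · filter_upwards [hV] with x hx
    rw [hx]
    exact hv1 _
  · rw [integral_abs_sub_VStar hR hr0 hrR hv hv1 hvi hV, hd]
    field_simp

/-- Every bounded radial potential has a normalised eigenfunction. -/
lemma exists_isEigenfunction (hR : 0 < R) (hv : Measurable v) {b : ℝ} (hb : ∀ t, |v t| ≤ b) :
    ∃ u, IsEigenfunction R (radial v) u := by
  have hn : 0 < Real.pi * normSq R v := mul_pos Real.pi_pos (normSq_pos hR hv hb)
  obtain ⟨u, hu, -⟩ := isEigenfunction_of_sol hR hv hb rfl (ground_pos_and_eq_zero hR hv hb).2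
    (eq_inv_sqrt_mul hn)
  exact ⟨u, hu⟩

/-- The slope along a segment, by means of any normalised eigenfunction. -/
lemma eigSlope_eq_integral (hR : 0 < R) (hv : Measurable v) (hv1 : ∀ t, v t ∈ Icc (0 : ℝ) 1)
    (hw : Measurable w) (hw1 : ∀ t, w t ∈ Icc (0 : ℝ) 1) {t : ℝ} (ht : t ∈ Icc (0 : ℝ) 1)
    (hu : IsEigenfunction R (radial (profileSegment v w t)) u) :
    eigSlope R v w t = -∫ x, radial (fun σ => w σ - v σ) x * u x ^ 2 ∂(muOmega R) := by
  have hm := fun s => (measurable_radial (measurable_profileSegment hv hw s)).aestronglyMeasurable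
    (μ := muOmega R)
  have hb : ∀ s ∈ Icc (-1 : ℝ) 2, ∀ᵐ x ∂(muOmega R), |radial (profileSegment v w s) x| ≤ 2 :=
    fun s hs => abs_radial_le (abs_profileSegment_le hv1 hw1 hs)
  have htI : t ∈ Ioo (-1 : ℝ) 2 := ⟨by linarith [ht.1], by linarith [ht.2]⟩
  obtain ⟨G, hG, hn, hE⟩ := hu.energy_eq (hm t) (hb t (Ioo_subset_Icc_self htI))
  -- A normalised eigenfunction at t attains λ there, so as a trial function at s it gives a
  -- supporting line, and differentiability leaves only one possible slope.
  refine eigSlope_eq_of_le hR hv hv1 hw hw1 htI fun s hs => ?_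
  have hsI := Ioo_subset_Icc_self hs
  have h1 := firstEigenvalue_le (hm s) (hb s hsI) hG hn
  have hi := fun s hs => integrable_mul_sq (hm s) (hb s hs) hG.1
  have e : ∫ x, radial (profileSegment v w s) x * u x ^ 2 ∂(muOmega R)
      = (∫ x, radial (profileSegment v w t) x * u x ^ 2 ∂(muOmega R))
        + (s - t) * ∫ x, radial (fun σ => w σ - v σ) x * u x ^ 2 ∂(muOmega R) := by
    have hd : Integrable (fun x => radial (fun σ => w σ - v σ) x * u x ^ 2) (muOmega R) :=
      integrable_mul_sq (measurable_radial (hw.sub hv)).aestronglyMeasurable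
        (abs_radial_le fun σ => abs_sub_le_one_of_mem_Icc (hw1 σ) (hv1 σ)) hG.1
    rw [← integral_const_mul, ← integral_add (hi t (Ioo_subset_Icc_self htI)) (hd.const_mul _)]
    refine integral_congr_ae (ae_of_all _ fun x => ?_)
    simp only [radial, profileSegment]
    ring
  rw [e] at h1
  rw [eig, eig]
  linarith

end Transfer

end RadialSchrodinger

/-! ### Assembly of the three parts. -/

theorem mainTheorem3 (R V₀ rs : ℝ) (hR : 0 < R) (hV₀ : 0 < V₀) (hV₁ : V₀ < 1)
    (hrs : RadialSchrodinger.VStar rs ∈ RadialSchrodinger.admissible R V₀) :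
    ∃ C : ℝ, 0 < C ∧
      (∀ δ : ℝ, 0 < δ → ∀ V ∈ RadialSchrodinger.radialAdmissible R V₀ rs δ,
        RadialSchrodinger.firstEigenvalue R V
          - RadialSchrodinger.firstEigenvalue R (RadialSchrodinger.VStar rs) ≥ C * δ ^ 2) ∧
      ∃ δbar : ℝ, 0 < δbar ∧ ∀ δ : ℝ, 0 < δ → δ ≤ δbar →
        ∃ a b : ℝ, 0 < a ∧ a < rs ∧ 0 < b ∧ rs + b < R ∧
          RadialSchrodinger.chi (RadialSchrodinger.annularSet rs a b)
            ∈ RadialSchrodinger.radialAdmissible R V₀ rs δ ∧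
          (∀ V ∈ RadialSchrodinger.radialAdmissible R V₀ rs δ,
            IsMinOn (RadialSchrodinger.firstEigenvalue R)
                (RadialSchrodinger.radialAdmissible R V₀ rs δ) V ↔
              V =ᵐ[RadialSchrodinger.muOmega R]
                RadialSchrodinger.chi (RadialSchrodinger.annularSet rs a b)) ∧
          ∀ t ∈ Set.Icc (0 : ℝ) 1,
            (∃ u : RadialSchrodinger.Plane → ℝ,
              RadialSchrodinger.IsEigenfunction R (RadialSchrodinger.VPath rs a b t) u) ∧
            ∀ u : RadialSchrodinger.Plane → ℝ,
              RadialSchrodinger.IsEigenfunction R (RadialSchrodinger.VPath rs a b t) u →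
              HasDerivWithinAt
                (fun s : ℝ =>
                  RadialSchrodinger.firstEigenvalue R (RadialSchrodinger.VPath rs a b s))
                (-∫ x, RadialSchrodinger.hPert rs a b x * u x ^ 2
                  ∂(RadialSchrodinger.muOmega R))
                (Set.Icc 0 1) t ∧
              -(∫ x, RadialSchrodinger.hPert rs a b x * u x ^ 2
                  ∂(RadialSchrodinger.muOmega R)) ≥ C * δ ^ 2 := by
  obtain ⟨hr0, hrR⟩ := RadialSchrodinger.radius_bounds hR hV₀ hV₁ hrs
  have hts : 0 < rs ^ 2 := by positivity
  have htR : rs ^ 2 < R ^ 2 := pow_lt_pow_left₀ hrR hr0.le two_ne_zero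
  obtain ⟨c₁, hc₁, hglob⟩ := RadialSchrodinger.exists_global_stability hR hts htR
  obtain ⟨d₂, hd₂, hmin⟩ := RadialSchrodinger.exists_annular_minimiser hR hts htR
  obtain ⟨d₃, c₃, hd₃, hc₃, hslope⟩ := RadialSchrodinger.exists_le_eigSlope hR hts htR
  have hstar := RadialSchrodinger.firstEigenvalue_congr (RadialSchrodinger.VStar_ae_eq hR hr0)
  -- The estimates on profiles are quadratic in d = δ/(2π), whence the factor (2π)².
  refine ⟨min c₁ c₃ / (2 * Real.pi) ^ 2, by positivity, fun δ hδ V hV => ?_, ?_⟩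
  · obtain ⟨v, hv, hv1, hVv, hvi, hvd⟩ := RadialSchrodinger.exists_profile hR hr0 hrR hrs hV
    have h := hglob v hv hv1 hvi.le
    rw [hvd] at h
    rw [RadialSchrodinger.firstEigenvalue_congr hVv, hstar]
    refine ge_iff_le.2 (le_trans ?_ h)
    rw [div_mul_eq_mul_div, mul_div_assoc, ← div_pow]
    gcongr
    exact min_le_left _ _
  -- The halves ensure rs² - d > 0 and rs² + d < R²: the inner disc is nondegenerate and the outer
  -- ring stays inside Ω.
  set d₀ := min (min d₂ d₃) (min (rs ^ 2 / 2) ((R ^ 2 - rs ^ 2) / 2))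
  have hd₀ : 0 < d₀ :=
    lt_min (lt_min hd₂ hd₃) (lt_min (by positivity) (half_pos (sub_pos.2 htR)))
  refine ⟨d₀ * (2 * Real.pi), by positivity, fun δ hδ hδd => ?_⟩
  have hdd : δ / (2 * Real.pi) ≤ d₀ := (div_le_iff₀ (by positivity)).2 hδd
  have hd : 0 < δ / (2 * Real.pi) := by positivity
  set d := δ / (2 * Real.pi)
  have hdd₂ : d ≤ d₂ := hdd.trans ((min_le_left _ _).trans (min_le_left _ _))
  have hdd₃ : d ≤ d₃ := hdd.trans ((min_le_left _ _).trans (min_le_right _ _))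
  have hdt : d ≤ rs ^ 2 / 2 := hdd.trans ((min_le_right _ _).trans (min_le_left _ _))
  have hdT : d ≤ (R ^ 2 - rs ^ 2) / 2 := hdd.trans ((min_le_right _ _).trans (min_le_right _ _))
  have hA := RadialSchrodinger.chi_annularSet_ae_eq (R := R) hR hr0 hd (by linarith)
  have hsm := RadialSchrodinger.measurable_step (rs ^ 2)
  have hs1 := RadialSchrodinger.step_mem_Icc (rs ^ 2)
  have ham := RadialSchrodinger.measurable_annular (rs ^ 2) d
  have ha1 := RadialSchrodinger.annular_mem_Icc (rs ^ 2) d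
  have hmem := RadialSchrodinger.mem_radialAdmissible hR hr0 hrR hrs ham ha1 hA
    (RadialSchrodinger.integral_annular hd.le (by linarith) (by linarith))
    (RadialSchrodinger.deficit_annular hd.le (by linarith))
  refine ⟨rs - √(rs ^ 2 - d), √(rs ^ 2 + d) - rs, ?_, ?_, ?_, ?_, hmem, fun V hV => ?_,
    fun t ht => ?_⟩
  · rw [sub_pos, Real.sqrt_lt' hr0]
    linarith
  · linarith [Real.sqrt_pos.2 (show 0 < rs ^ 2 - d by linarith)]
  · rw [sub_pos]
    exact Real.lt_sqrt_of_sq_lt (by linarith)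
  · rw [add_sub_cancel, Real.sqrt_lt' hR]
    linarith
  -- As `hmem` puts the annular potential in the class, this equivalence contains existence of the
  -- minimiser as well as uniqueness.
  · constructor
    · intro hVmin
      obtain ⟨v, hv, hv1, hVv, hvi, hvd⟩ := RadialSchrodinger.exists_profile hR hr0 hrR hrs hV
      have hle := isMinOn_iff.1 hVmin _ hmem
      rw [RadialSchrodinger.firstEigenvalue_congr hVv, RadialSchrodinger.firstEigenvalue_congr hA]
        at hle
      exact hVv.trans ((RadialSchrodinger.radial_congr hR
        ((hmin d hd hdd₂ v hv hv1 hvi hvd).2 hle)).trans hA.symm)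
    · intro hVA
      refine isMinOn_iff.2 fun W hW => ?_
      obtain ⟨w, hw, hw1, hWw, hwi, hwd⟩ := RadialSchrodinger.exists_profile hR hr0 hrR hrs hW
      rw [RadialSchrodinger.firstEigenvalue_congr (hVA.trans hA),
        RadialSchrodinger.firstEigenvalue_congr hWw]
      exact (hmin d hd hdd₂ w hw hw1 hwi hwd).1
  · have hpath : ∀ s, RadialSchrodinger.VPath rs (rs - √(rs ^ 2 - d)) (√(rs ^ 2 + d) - rs) s
        =ᵐ[RadialSchrodinger.muOmega R] RadialSchrodinger.radial (RadialSchrodinger.profileSegment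
          (RadialSchrodinger.step (rs ^ 2)) (RadialSchrodinger.annular (rs ^ 2) d) s) := by
      intro s
      filter_upwards [RadialSchrodinger.VStar_ae_eq hR hr0, hA] with x h1 h2
      rw [RadialSchrodinger.VPath, RadialSchrodinger.hPert, h1, h2]
      rfl
    constructor
    · obtain ⟨u, hu⟩ := RadialSchrodinger.exists_isEigenfunction hR
        (RadialSchrodinger.measurable_profileSegment hsm ham t)
        (RadialSchrodinger.abs_profileSegment_le hs1 ha1
          ⟨by linarith [ht.1], by linarith [ht.2]⟩)
      exact ⟨u, hu.congr (hpath t).symm⟩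
    · intro u hu
      have hslope_eq := RadialSchrodinger.eigSlope_eq_integral hR hsm hs1 ham ha1 ht
        (hu.congr (hpath t))
      have hint : ∫ x, RadialSchrodinger.hPert rs (rs - √(rs ^ 2 - d)) (√(rs ^ 2 + d) - rs) x
            * u x ^ 2 ∂(RadialSchrodinger.muOmega R)
          = ∫ x, RadialSchrodinger.radial (fun σ => RadialSchrodinger.annular (rs ^ 2) d σ
            - RadialSchrodinger.step (rs ^ 2) σ) x * u x ^ 2 ∂(RadialSchrodinger.muOmega R) := by
        refine integral_congr_ae ?_
        filter_upwards [RadialSchrodinger.VStar_ae_eq hR hr0, hA] with x h1 h2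
        rw [RadialSchrodinger.hPert, h1, h2]
        rfl
      have hfun : (fun s : ℝ => RadialSchrodinger.firstEigenvalue R
            (RadialSchrodinger.VPath rs (rs - √(rs ^ 2 - d)) (√(rs ^ 2 + d) - rs) s))
          = fun s => RadialSchrodinger.eig R (RadialSchrodinger.profileSegment
            (RadialSchrodinger.step (rs ^ 2)) (RadialSchrodinger.annular (rs ^ 2) d) s) :=
        funext fun s => RadialSchrodinger.firstEigenvalue_congr (hpath s)
      rw [hint, ← hslope_eq, hfun]
      refine ⟨(RadialSchrodinger.hasDerivAt_eig_profileSegment hR hsm hs1 ham ha1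
        ⟨by linarith [ht.1], by linarith [ht.2]⟩).hasDerivWithinAt, ?_⟩
      refine ge_iff_le.2 (le_trans ?_ (hslope d hd hdd₃ t ht))
      rw [div_mul_eq_mul_div, mul_div_assoc, ← div_pow]
      gcongr
      exact min_le_right _ _
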